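/- Let $N\ge 4$ be an integer, $\frac{N^2-4N+2}{N(N-2)}<\beta<1$, let $B$ be the open unit ball of $\mathbb R^N$ and $V_N$ its volume. Let $\chi:[1,\infty)\to[1,\infty)$ be continuous with $\chi(1)=1$ and suppose that for some $M>0$ and all $r\ge 1$ $$\frac1{r^{N^2/2}}\Big(\int_1^r t^{N-1}\chi(t)\,dt\Big)\Big(\int_1^r\frac{t^{N-1}}{\chi(t)}\,dt\Big)^{\frac N2-1}\le M,\qquad \frac1{r^{N^2/2}}\int_1^r t^{N-1}\chi(t)\,dt\le M,\qquad \frac{\max_{[r,4r]}\chi}{\min_{[r,4r]}\chi}\le M .$$ Put $w_\beta(x)=\big(\log\frac{e}{|x|}\big)^{\beta(\frac N2-1)}$ for $|x|<1$ and $w_\beta(x)=\chi(|x|)$ for $|x|\ge1$. Let $E$ be the space of radial functions $u\in L^{N/2}(\mathbb R^N)$ that have a weak gradient and a weak Laplacian (locally integrable functions) with $$\|u\|^{N/2}:=\int_{\mathbb R^N}w_\beta|\Delta u|^{N/2}+|\nabla u|^{N/2}+|u|^{N/2}\,dx<\infty .$$ Let $W^{2,N/2}_{0,rad}(B,w_\beta)$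 be the closure of the radial functions of $C_c^\infty(B)$ in the weighted Sobolev space $W^{2,N/2}(B,w_\beta)$ with norm $\big(\sum_{|\tau|\le1}\int_B|D^\tau u|^{N/2}dx+\sum_{|\tau|=2}\int_B w_\beta|D^\tau u|^{N/2}dx\big)^{2/N}$. Let $$\gamma=\frac{N}{(N-2)(1-\beta)},\qquad \alpha_\beta=N\big[(N-2)^{N/2}\,N\,V_N\big]^{\frac{2}{(N-2)(1-\beta)}}(1-\beta)^{\frac1{1-\beta}} .$$ Then: (i) $\int_{\mathbb R^N}(e^{|u|^\gamma}-1)\,dx<\infty$ for every $u\in E$. (ii) For $\alpha\in\mathbb R$, $$\sup\Big\{\int_B(e^{\alpha|u|^\gamma}-1)\,dx:\ u\in W^{2,N/2}_{0,rad}(B,w_\beta),\ \int_B w_\beta|\Delta u|^{N/2}dx\le1\Big\}<\infty\iff\alpha\le\alpha_\beta .$$ (iii) $\sup_{u\in E,\ \|u\|\le1}\int_{\mathbb R^N}(e^{\alpha|u|^\gamma}-1)\,dx$ is finite if $\alpha<\alpha_\beta$ and equals $+\infty$ if $\alpha>\alpha_\beta$. -/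

import Mathlib

open MeasureTheory Set Filter Topology
open scoped ENNReal ContDiff Laplacian InnerProductSpace

namespace LogAdams

/-- Euclidean space of dimension `N`. -/
abbrev Rn (N : ℕ) : Type := EuclideanSpace ℝ (Fin N)

/-- The open unit ball `B` of `ℝ^N`. -/
def unitBall (N : ℕ) : Set (Rn N) := Metric.ball 0 1

/-- `V_N`, the volume of the unit ball of `ℝ^N`. -/
noncomputable def ballVolume (N : ℕ) : ℝ := (volume (unitBall N)).toReal

/-- Test functions on `Ω`: real-valued, smooth, with compact support contained in `Ω`. -/
def IsTestFunction {N : ℕ} (Ω : Set (Rn N)) (φ : Rn N → ℝ) : Prop :=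
  ContDiff ℝ ∞ φ ∧ HasCompactSupport φ ∧ tsupport φ ⊆ Ω

/-- The classical partial derivative `∂φ/∂x_i`. -/
noncomputable def partialDeriv {N : ℕ} (i : Fin N) (φ : Rn N → ℝ) (x : Rn N) : ℝ :=
  fderiv ℝ φ x (EuclideanSpace.single i 1)

/-- `G` is a weak (distributional) gradient of `u` on `Ω`. -/
def HasWeakGradient {N : ℕ} (Ω : Set (Rn N)) (u : Rn N → ℝ) (G : Rn N → Rn N) : Prop :=
  LocallyIntegrableOn u Ω ∧ LocallyIntegrableOn G Ω ∧
    ∀ φ : Rn N → ℝ, IsTestFunction Ω φ → ∀ i : Fin N,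
      ∫ x in Ω, u x * partialDeriv i φ x = - ∫ x in Ω, G x i * φ x

/-- `f` is a weak (distributional) Laplacian of `u` on `Ω`. -/
def HasWeakLaplacian {N : ℕ} (Ω : Set (Rn N)) (u f : Rn N → ℝ) : Prop :=
  LocallyIntegrableOn u Ω ∧ LocallyIntegrableOn f Ω ∧
    ∀ φ : Rn N → ℝ, IsTestFunction Ω φ →
      ∫ x in Ω, u x * (Δ φ) x = ∫ x in Ω, f x * φ x

/-- Two locally integrable functions with the same integrals against all test functions on an
open set agree almost everywhere on it. -/
theorem ae_eq_of_forall_test {N : ℕ} {Ω : Set (Rn N)} (hΩ : IsOpen Ω) {f g : Rn N → ℝ}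
    (hf : LocallyIntegrableOn f Ω) (hg : LocallyIntegrableOn g Ω)
    (h : ∀ φ : Rn N → ℝ, IsTestFunction Ω φ → ∫ x in Ω, f x * φ x = ∫ x in Ω, g x * φ x) :
    f =ᵐ[volume.restrict Ω] g := by
  have key := hΩ.ae_eq_zero_of_integral_contDiff_smul_eq_zero (μ := volume) (hf.sub hg) ?_
  · rw [Filter.EventuallyEq, ae_restrict_iff' hΩ.measurableSet]
    filter_upwards [key] with x hx hxΩ
    exact sub_eq_zero.mp (hx hxΩ)
  · intro φ h1 h2 h3
    have hφ : IsTestFunction Ω φ := ⟨h1, h2, h3⟩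
    have int : ∀ {k : Rn N → ℝ}, LocallyIntegrableOn k Ω →
        IntegrableOn (fun x => k x * φ x) Ω := by
      intro k hk
      have hK : IntegrableOn k (tsupport φ) := hk.integrableOn_compact_subset h3 h2
      have h4 : IntegrableOn (fun x => k x * φ x) (tsupport φ) :=
        hK.mul_continuousOn h1.continuous.continuousOn h2
      refine h4.of_forall_sdiff_eq_zero hΩ.measurableSet ?_
      intro x hx
      simp [image_eq_zero_of_notMem_tsupport hx.2]
    have e : ∫ x, φ x • (f - g) x = ∫ x in Ω, (f x * φ x - g x * φ x) := by
      rw [setIntegral_eq_integral_of_forall_compl_eq_zero]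
      · congr 1; ext x; simp; ring
      · intro x hx
        simp [image_eq_zero_of_notMem_tsupport (fun hc => hx (h3 hc))]
    rw [e, integral_sub (int hf) (int hg), h φ hφ, sub_self]

/-- Weak gradients on an open set are unique up to null sets. -/
theorem HasWeakGradient.ae_eq {N : ℕ} {Ω : Set (Rn N)} (hΩ : IsOpen Ω) {u : Rn N → ℝ}
    {G G' : Rn N → Rn N} (h : HasWeakGradient Ω u G) (h' : HasWeakGradient Ω u G') :
    G =ᵐ[volume.restrict Ω] G' := by
  have comp : ∀ {K : Rn N → Rn N} (i : Fin N), LocallyIntegrableOn K Ω →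
      LocallyIntegrableOn (fun x => K x i) Ω := by
    intro K i hK x hx
    obtain ⟨s, hs, hi⟩ := hK x hx
    exact ⟨s, hs, (EuclideanSpace.proj (𝕜 := ℝ) i).integrable_comp hi⟩
  have : ∀ i : Fin N, (fun x => G x i) =ᵐ[volume.restrict Ω] fun x => G' x i := fun i =>
    ae_eq_of_forall_test hΩ (comp i h.2.1) (comp i h'.2.1) fun φ hφ => by
      have a := h.2.2 φ hφ i
      have b := h'.2.2 φ hφ i
      linarith
  filter_upwards [ae_all_iff.2 this] with x hx
  ext i
  exact hx i

/-- Weak Laplacians on an open set are unique up to null sets. -/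
theorem HasWeakLaplacian.ae_eq {N : ℕ} {Ω : Set (Rn N)} (hΩ : IsOpen Ω) {u f f' : Rn N → ℝ}
    (h : HasWeakLaplacian Ω u f) (h' : HasWeakLaplacian Ω u f') :
    f =ᵐ[volume.restrict Ω] f' :=
  ae_eq_of_forall_test hΩ h.2.1 h'.2.1 fun φ hφ => (h.2.2 φ hφ).symm.trans (h'.2.2 φ hφ)

open Classical in
/-- The weak gradient of `u` on `Ω` (a representative; zero if there is none). -/
noncomputable def weakGradient {N : ℕ} (Ω : Set (Rn N)) (u : Rn N → ℝ) : Rn N → Rn N :=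
  if h : ∃ G, HasWeakGradient Ω u G then h.choose else 0

open Classical in
/-- The weak Laplacian of `u` on `Ω` (a representative; zero if there is none). -/
noncomputable def weakLaplacian {N : ℕ} (Ω : Set (Rn N)) (u : Rn N → ℝ) : Rn N → ℝ :=
  if h : ∃ f, HasWeakLaplacian Ω u f then h.choose else 0

theorem HasWeakGradient.weakGradient_ae_eq {N : ℕ} {Ω : Set (Rn N)} (hΩ : IsOpen Ω)
    {u : Rn N → ℝ} {G : Rn N → Rn N} (h : HasWeakGradient Ω u G) :
    weakGradient Ω u =ᵐ[volume.restrict Ω] G := by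
  have hex : ∃ G, HasWeakGradient Ω u G := ⟨G, h⟩
  rw [weakGradient, dif_pos hex]
  exact hex.choose_spec.ae_eq hΩ h

theorem HasWeakLaplacian.weakLaplacian_ae_eq {N : ℕ} {Ω : Set (Rn N)} (hΩ : IsOpen Ω)
    {u f : Rn N → ℝ} (h : HasWeakLaplacian Ω u f) :
    weakLaplacian Ω u =ᵐ[volume.restrict Ω] f := by
  have hex : ∃ f, HasWeakLaplacian Ω u f := ⟨f, h⟩
  rw [weakLaplacian, dif_pos hex]
  exact hex.choose_spec.ae_eq hΩ h

/-- The weight `w_β`: `(log (e/|x|))^{β(N/2-1)}` for `|x| < 1` and `χ(|x|)` for `|x| ≥ 1`. -/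
noncomputable def weight (N : ℕ) (β : ℝ) (χ : ℝ → ℝ) (x : Rn N) : ℝ :=
  if ‖x‖ < 1 then (Real.log (Real.exp 1 / ‖x‖)) ^ (β * ((N : ℝ) / 2 - 1)) else χ ‖x‖

/-- The standing assumptions on the outer part `χ : [1,∞) → [1,∞)` of the weight. -/
structure AdmissibleChi (N : ℕ) (χ : ℝ → ℝ) : Prop where
  continuousOn : ContinuousOn χ (Ici 1)
  one : χ 1 = 1
  one_le : ∀ t, 1 ≤ t → 1 ≤ χ t
  growth : ∃ M : ℝ, 0 < M ∧ ∀ r : ℝ, 1 ≤ r →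
    1 / r ^ ((N : ℝ) ^ 2 / 2) * (∫ t in (1 : ℝ)..r, t ^ (N - 1) * χ t) *
        (∫ t in (1 : ℝ)..r, t ^ (N - 1) / χ t) ^ ((N : ℝ) / 2 - 1) ≤ M ∧
    1 / r ^ ((N : ℝ) ^ 2 / 2) * (∫ t in (1 : ℝ)..r, t ^ (N - 1) * χ t) ≤ M ∧
    sSup (χ '' Icc r (4 * r)) / sInf (χ '' Icc r (4 * r)) ≤ M

/-- The `N/2`-th power of the norm of `E`:
`∫ w_β |Δu|^{N/2} + ∫ |∇u|^{N/2} + ∫ |u|^{N/2}` over `ℝ^N`. -/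
noncomputable def energy (N : ℕ) (β : ℝ) (χ : ℝ → ℝ) (u : Rn N → ℝ) : ℝ≥0∞ :=
  (∫⁻ x, ENNReal.ofReal (weight N β χ x * |weakLaplacian univ u x| ^ ((N : ℝ) / 2))) +
  (∫⁻ x, ENNReal.ofReal (‖weakGradient univ u x‖ ^ ((N : ℝ) / 2))) +
  ∫⁻ x, ENNReal.ofReal (|u x| ^ ((N : ℝ) / 2))

/-- The norm of `E`. -/
noncomputable def normE (N : ℕ) (β : ℝ) (χ : ℝ → ℝ) (u : Rn N → ℝ) : ℝ≥0∞ :=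
  energy N β χ u ^ (2 / (N : ℝ))

/-- The space `E`: radial functions in `L^{N/2}(ℝ^N)` whose weak gradient and weak Laplacian are
functions, with finite energy. -/
def spaceE (N : ℕ) (β : ℝ) (χ : ℝ → ℝ) : Set (Rn N → ℝ) :=
  {u | MemLp u (ENNReal.ofReal ((N : ℝ) / 2)) volume ∧
    (∃ v : ℝ → ℝ, u =ᵐ[volume] fun x => v ‖x‖) ∧
    (∃ G, HasWeakGradient univ u G) ∧ (∃ f, HasWeakLaplacian univ u f) ∧
    energy N β χ u < ⊤}

/-- `u` belongs to `W^{2,N/2}(B,w)`, with weak first derivatives `G x i` and weak second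
derivatives `H i x j`: lower-order terms are in `L^{N/2}(B)`, those of order two in
`L^{N/2}(B,w)`. -/
def IsW2 (N : ℕ) (β : ℝ) (χ : ℝ → ℝ) (u : Rn N → ℝ) (G : Rn N → Rn N)
    (H : Fin N → Rn N → Rn N) : Prop :=
  HasWeakGradient (unitBall N) u G ∧
  (∀ i, HasWeakGradient (unitBall N) (fun x => G x i) (H i)) ∧
  (∫⁻ x in unitBall N, ENNReal.ofReal (|u x| ^ ((N : ℝ) / 2))) < ⊤ ∧
  (∀ i, (∫⁻ x in unitBall N, ENNReal.ofReal (|G x i| ^ ((N : ℝ) / 2))) < ⊤) ∧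
  (∀ i j, (∫⁻ x in unitBall N,
    ENNReal.ofReal (weight N β χ x * |H i x j| ^ ((N : ℝ) / 2))) < ⊤)

/-- The `N/2`-th power of the distance, in the norm of `W^{2,N/2}(B,w)`, between a smooth
function `φ` and the element with zeroth, first and second derivatives `u`, `G`, `H`. -/
noncomputable def distW2 (N : ℕ) (β : ℝ) (χ : ℝ → ℝ) (φ u : Rn N → ℝ) (G : Rn N → Rn N)
    (H : Fin N → Rn N → Rn N) : ℝ≥0∞ :=
  (∫⁻ x in unitBall N, ENNReal.ofReal (|φ x - u x| ^ ((N : ℝ) / 2))) +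
  (∑ i, ∫⁻ x in unitBall N, ENNReal.ofReal (|partialDeriv i φ x - G x i| ^ ((N : ℝ) / 2))) +
  ∑ i, ∑ j, ∫⁻ x in unitBall N, ENNReal.ofReal
    (weight N β χ x * |partialDeriv j (partialDeriv i φ) x - H i x j| ^ ((N : ℝ) / 2))

/-- `W^{2,N/2}_{0,rad}(B,w)`: the closure in `W^{2,N/2}(B,w)` of the radial smooth functions with
compact support in `B`. Only the values of `u` on `B` matter. -/
def spaceW0rad (N : ℕ) (β : ℝ) (χ : ℝ → ℝ) : Set (Rn N → ℝ) :=
  {u | ∃ G H, IsW2 N β χ u G H ∧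
    ∃ φ : ℕ → Rn N → ℝ,
      (∀ n, IsTestFunction (unitBall N) (φ n) ∧ ∀ x y, ‖x‖ = ‖y‖ → φ n x = φ n y) ∧
      Tendsto (fun n => distW2 N β χ (φ n) u G H) atTop (𝓝 0)}

/-- The exponent `γ = N/((N-2)(1-β))`. -/
noncomputable def gammaExp (N : ℕ) (β : ℝ) : ℝ := (N : ℝ) / (((N : ℝ) - 2) * (1 - β))

/-- The critical constant
`α_β = N [(N-2)^{N/2} N V_N]^{2/((N-2)(1-β))} (1-β)^{1/(1-β)}`. -/
noncomputable def alphaCrit (N : ℕ) (β : ℝ) : ℝ :=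
  (N : ℝ) * (((N : ℝ) - 2) ^ ((N : ℝ) / 2) * ((N : ℝ) * ballVolume N)) ^
      (2 / (((N : ℝ) - 2) * (1 - β))) *
    (1 - β) ^ (1 / (1 - β))

end LogAdams

open LogAdams

namespace LogAdams

/-! Write ω for the area of the unit sphere and ℓ(r) = log(e/r). A radial function with weak
Laplacian f has, by the divergence theorem, radial derivative ω⁻¹ s^{1-N} ∫_{|y|<s} f, so it is a
primitive of this flux up to a constant (`exists_radial_representation`). Integrating the flux from
r to r₀ and exchanging integrals turns the increment into an integral of f against a kernel bounded
by max(r,|y|)^{2-N} / (ω(N-2)). Hölder with exponents N/2 and N/(N-2), the weight being split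
between the factors, leaves the dual integral of ℓ^{-β} max(r,|y|)^{-N}, which grows like ω
ℓ(r)^{1-β}/(1-β). This is the sharp estimate `abs_integral_flux_le`, and `alphaCrit` is the constant
that normalizes it: if the weighted Laplacian energy is at most one, then α_β |increment|^γ ≤ N
((1-β)T(r))^{1/(1-β)}, with T the `dualMass`.

The critical value α_β is admissible on the ball because the dual integral falls short of
ℓ^{1-β}/(1-β) by a constant. After the power is taken, the bound becomes N(ℓ - (3/4)ℓ^β), so the
exponential is at most e^N |x|^{-N} exp(-(3N/4)ℓ^β), and the last factor makes this integrable over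
the ball. One function thus dominates the exponential for all test functions of energy one at once.
For elements of the closure the pointwise bound passes to the limit along an almost everywhere
convergent subsequence, whose energies are controlled by Minkowski's inequality.

A function of E need not vanish on the unit sphere, so |u| is bounded by a constant plus the
increment. The constant is controlled because a radial function oscillates boundedly on each dyadic
annulus and lies in L^{N/2} (`exists_outer_bound`). Absorbing it costs a factor (1+δ)^γ, affordable
for α < α_β; for a single u any exponent is affordable, since the energy near the origin can be made
small. Away from the origin u is bounded, and γ ≥ N/2 lets |u|^{N/2} dominate the exponential minus
one.

For α > α_β the functions k^{1/γ} η(-log|x|/k) concentrate at the origin. In the variable y =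
-log|x|/k all powers of k cancel in the leading energy, which tends to ω ∫ y^{β(N/2-1)}
((N-2)η')^{N/2} dy on (0,1), while the lower order terms decay exponentially. On the ball of radius
e^{-k} the function is constant, and the exponential integral diverges with k as soon as α (∫η')^γ >
N. Equality in Hölder suggests η' proportional to y^{-β}; a smooth truncation of this profile has
energy below one exactly because α exceeds α_β. -/

/-! ### Classical derivatives as weak derivatives -/

theorem partialDeriv_contDiff {N : ℕ} {φ : Rn N → ℝ} (h : ContDiff ℝ ∞ φ) (i : Fin N) :
    ContDiff ℝ ∞ (partialDeriv i φ) := by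
  have h1 : ContDiff ℝ ∞ (fderiv ℝ φ) := h.fderiv_right (by simp)
  exact h1.clm_apply contDiff_const

theorem partialDeriv_hasCompactSupport {N : ℕ} {φ : Rn N → ℝ} (h : HasCompactSupport φ)
    (i : Fin N) : HasCompactSupport (partialDeriv i φ) :=
  h.fderiv_apply ℝ _

theorem laplacian_eq_sum_partialDeriv {N : ℕ} {φ : Rn N → ℝ} (h : ContDiff ℝ ∞ φ) (x : Rn N) :
    (Δ φ) x = ∑ i, partialDeriv i (partialDeriv i φ) x := by
  rw [InnerProductSpace.laplacian_eq_iteratedFDeriv_orthonormalBasis φ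
    (EuclideanSpace.basisFun (Fin N) ℝ)]
  refine Finset.sum_congr rfl fun i _ => ?_
  have h1 : ContDiff ℝ ∞ (fderiv ℝ φ) := h.fderiv_right (by simp)
  have h2 : DifferentiableAt ℝ (fderiv ℝ φ) x := h1.contDiffAt.differentiableAt (by simp)
  rw [iteratedFDeriv_two_apply]
  unfold partialDeriv
  rw [fderiv_clm_apply h2 (differentiableAt_const _)]
  simp

/-- The gradient as a vector of partial derivatives. -/
noncomputable def gradVec {N : ℕ} (φ : Rn N → ℝ) (x : Rn N) : Rn N :=
  WithLp.toLp 2 fun i => partialDeriv i φ x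

@[simp] theorem gradVec_apply {N : ℕ} (φ : Rn N → ℝ) (x : Rn N) (i : Fin N) :
    gradVec φ x i = partialDeriv i φ x := rfl

theorem gradVec_continuous {N : ℕ} {φ : Rn N → ℝ} (h : ContDiff ℝ ∞ φ) :
    Continuous (gradVec φ) := by
  refine (PiLp.continuous_toLp 2 _).comp (continuous_pi fun i => ?_)
  exact (partialDeriv_contDiff h i).continuous

theorem setIntegral_mul_test {N : ℕ} {Ω : Set (Rn N)} {f ψ : Rn N → ℝ}
    (hψ : tsupport ψ ⊆ Ω) : ∫ x in Ω, f x * ψ x = ∫ x, f x * ψ x := by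
  refine setIntegral_eq_integral_of_forall_compl_eq_zero fun x hx => ?_
  simp [image_eq_zero_of_notMem_tsupport (fun hc => hx (hψ hc))]

theorem tsupport_partialDeriv_subset {N : ℕ} (φ : Rn N → ℝ) (i : Fin N) :
    tsupport (partialDeriv i φ) ⊆ tsupport φ :=
  tsupport_fderiv_apply_subset ℝ _

theorem hasWeakGradient_of_contDiff {N : ℕ} (Ω : Set (Rn N)) {φ : Rn N → ℝ}
    (h : ContDiff ℝ ∞ φ) : HasWeakGradient Ω φ (gradVec φ) := by
  refine ⟨h.continuous.locallyIntegrable.locallyIntegrableOn _,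
    (gradVec_continuous h).locallyIntegrable.locallyIntegrableOn _, fun ψ hψ i => ?_⟩
  obtain ⟨h1, h2, h3⟩ := hψ
  rw [setIntegral_mul_test ((tsupport_partialDeriv_subset ψ i).trans h3),
    setIntegral_mul_test h3]
  have c1 := (partialDeriv_contDiff h i).continuous
  have c2 := (partialDeriv_contDiff h1 i).continuous
  refine integral_mul_fderiv_eq_neg_fderiv_mul_of_integrable ?_ ?_ ?_ ?_ ?_
  · exact (c1.mul h1.continuous).integrable_of_hasCompactSupport (h2.mul_left)
  · exact (h.continuous.mul c2).integrable_of_hasCompactSupport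
      ((partialDeriv_hasCompactSupport h2 i).mul_left)
  · exact (h.continuous.mul h1.continuous).integrable_of_hasCompactSupport (h2.mul_left)
  · exact fun x _ => h.contDiffAt.differentiableAt (by simp)
  · exact fun x _ => h1.contDiffAt.differentiableAt (by simp)

theorem IsTestFunction.partialDeriv {N : ℕ} {Ω : Set (Rn N)} {φ : Rn N → ℝ}
    (h : IsTestFunction Ω φ) (i : Fin N) : IsTestFunction Ω (LogAdams.partialDeriv i φ) :=
  ⟨partialDeriv_contDiff h.1 i, partialDeriv_hasCompactSupport h.2.1 i,
    (tsupport_partialDeriv_subset φ i).trans h.2.2⟩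

theorem integrableOn_mul_test {N : ℕ} {Ω : Set (Rn N)} (hΩ : IsOpen Ω) {k φ : Rn N → ℝ}
    (hk : LocallyIntegrableOn k Ω) (hφ : IsTestFunction Ω φ) :
    IntegrableOn (fun x => k x * φ x) Ω := by
  have hK : IntegrableOn k (tsupport φ) := hk.integrableOn_compact_subset hφ.2.2 hφ.2.1
  have h4 : IntegrableOn (fun x => k x * φ x) (tsupport φ) :=
    hK.mul_continuousOn hφ.1.continuous.continuousOn hφ.2.1
  refine h4.of_forall_sdiff_eq_zero hΩ.measurableSet ?_
  intro x hx
  simp [image_eq_zero_of_notMem_tsupport hx.2]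

theorem locallyIntegrableOn_apply {N : ℕ} {Ω : Set (Rn N)} {K : Rn N → Rn N}
    (hK : LocallyIntegrableOn K Ω) (i : Fin N) : LocallyIntegrableOn (fun x => K x i) Ω := by
  intro x hx
  obtain ⟨s, hs, hi⟩ := hK x hx
  exact ⟨s, hs, (EuclideanSpace.proj (𝕜 := ℝ) i).integrable_comp hi⟩

/-- The trace of the weak Hessian is the weak Laplacian. -/
theorem hasWeakLaplacian_of_hessian {N : ℕ} {Ω : Set (Rn N)} (hΩ : IsOpen Ω) {u : Rn N → ℝ}
    {G : Rn N → Rn N} {H : Fin N → Rn N → Rn N} (hu : HasWeakGradient Ω u G)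
    (hG : ∀ i, HasWeakGradient Ω (fun x => G x i) (H i)) :
    HasWeakLaplacian Ω u (fun x => ∑ i, H i x i) := by
  refine ⟨hu.1, ?_, fun φ hφ => ?_⟩
  · have : ∀ s : Finset (Fin N), LocallyIntegrableOn (fun x => ∑ i ∈ s, H i x i) Ω := by
      classical
      intro s
      induction s using Finset.induction_on with
      | empty => simpa using (locallyIntegrable_zero (X := Rn N)).locallyIntegrableOn Ω
      | insert a s ha ih =>
        simp only [Finset.sum_insert ha]
        exact (locallyIntegrableOn_apply (hG a).2.1 a).add ih
    exact this _
  · have e1 : ∀ x, u x * (Δ φ) x = ∑ i, u x * partialDeriv i (partialDeriv i φ) x := fun x => by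
      rw [laplacian_eq_sum_partialDeriv hφ.1, Finset.mul_sum]
    have e2 : ∀ x, (∑ i, H i x i) * φ x = ∑ i, H i x i * φ x := fun x => Finset.sum_mul ..
    simp_rw [e1, e2]
    rw [integral_finsetSum _ fun i _ =>
      integrableOn_mul_test hΩ hu.1 ((hφ.partialDeriv i).partialDeriv i),
      integral_finsetSum _ fun i _ =>
      integrableOn_mul_test hΩ (locallyIntegrableOn_apply (hG i).2.1 i) hφ]
    refine Finset.sum_congr rfl fun i _ => ?_
    rw [hu.2.2 _ (hφ.partialDeriv i) i, (hG i).2.2 φ hφ i, neg_neg]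

theorem hasWeakLaplacian_of_contDiff {N : ℕ} {Ω : Set (Rn N)} (hΩ : IsOpen Ω) {φ : Rn N → ℝ}
    (h : ContDiff ℝ ∞ φ) : HasWeakLaplacian Ω φ (Δ φ) := by
  have := hasWeakLaplacian_of_hessian hΩ (hasWeakGradient_of_contDiff Ω h)
    (H := fun i => gradVec (partialDeriv i φ))
    fun i => hasWeakGradient_of_contDiff Ω (partialDeriv_contDiff h i)
  convert this using 1
  ext x
  simp [laplacian_eq_sum_partialDeriv h]

/-! ### Radial functions built from their radial derivative -/

section Radial

variable {N : ℕ} {q : ℝ → ℝ} {a b : ℝ}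

/-- The radial function with radial derivative `q` that vanishes at radius `b`. -/
noncomputable def radialPrimitive (N : ℕ) (q : ℝ → ℝ) (b : ℝ) (x : Rn N) : ℝ :=
  ∫ s in b..‖x‖, q s

theorem contDiff_primitive (hq : ContDiff ℝ ∞ q) (b : ℝ) :
    ContDiff ℝ ∞ fun t => ∫ s in b..t, q s := by
  have hd : ∀ t, HasDerivAt (fun t => ∫ s in b..t, q s) (q t) t := fun t =>
    intervalIntegral.integral_hasDerivAt_right (hq.continuous.intervalIntegrable _ _)
      (hq.continuous.stronglyMeasurableAtFilter _ _) hq.continuous.continuousAt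
  rw [contDiff_infty_iff_deriv]
  refine ⟨fun t => (hd t).differentiableAt, ?_⟩
  rwa [funext fun t => (hd t).deriv]

theorem radialPrimitive_eq_of_norm_lt (hq : ContDiff ℝ ∞ q) (h0 : ∀ s, |s| < a → q s = 0)
    {x : Rn N} (hx : ‖x‖ < a) : radialPrimitive N q b x = ∫ s in b..0, q s := by
  unfold radialPrimitive
  rw [← intervalIntegral.integral_add_adjacent_intervals (b := 0)
    (hq.continuous.intervalIntegrable _ _) (hq.continuous.intervalIntegrable _ _)]
  rw [intervalIntegral.integral_zero_ae (a := 0), add_zero]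
  refine Eventually.of_forall fun s hs => h0 s ?_
  rw [uIoc_of_le (norm_nonneg x)] at hs
  rw [abs_of_pos hs.1]
  exact hs.2.trans_lt hx

/-- The norm is not smooth at the origin. Since `q` vanishes near zero, the function is constant
there and the singularity disappears. -/
theorem radialPrimitive_contDiff (ha : 0 < a) (hq : ContDiff ℝ ∞ q)
    (h0 : ∀ s, |s| < a → q s = 0) : ContDiff ℝ ∞ (radialPrimitive N q b) := by
  rw [contDiff_iff_contDiffAt]
  intro x
  by_cases hx : x = 0
  · subst hx
    refine (contDiffAt_const (c := ∫ s in b..0, q s)).congr_of_eventuallyEq ?_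
    filter_upwards [Metric.ball_mem_nhds (0 : Rn N) ha] with y hy
    exact radialPrimitive_eq_of_norm_lt hq h0 (by simpa using hy)
  · exact (contDiff_primitive hq b).contDiffAt.comp x (contDiffAt_norm ℝ hx)

theorem radialPrimitive_eq_zero (h1 : ∀ s, b ≤ s → q s = 0) {x : Rn N} (hx : b ≤ ‖x‖) :
    radialPrimitive N q b x = 0 := by
  refine intervalIntegral.integral_zero_ae (Eventually.of_forall fun s hs => h1 s ?_)
  rw [uIoc_of_le hx] at hs
  exact hs.1.le

theorem radialPrimitive_tsupport (h1 : ∀ s, b ≤ s → q s = 0) :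
    tsupport (radialPrimitive N q b) ⊆ Metric.closedBall 0 b := by
  refine closure_minimal (fun x hx => ?_) Metric.isClosed_closedBall
  by_contra hc
  rw [mem_closedBall_zero_iff, not_le] at hc
  exact hx (radialPrimitive_eq_zero h1 hc.le)

theorem radialPrimitive_hasCompactSupport (h1 : ∀ s, b ≤ s → q s = 0) :
    HasCompactSupport (radialPrimitive N q b) :=
  (isCompact_closedBall (0 : Rn N) b).of_isClosed_subset (isClosed_tsupport _)
    (radialPrimitive_tsupport h1)

theorem radialPrimitive_isTestFunction (ha : 0 < a) (hq : ContDiff ℝ ∞ q)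
    (h0 : ∀ s, |s| < a → q s = 0) (h1 : ∀ s, b ≤ s → q s = 0) {Ω : Set (Rn N)}
    (hΩ : Metric.closedBall 0 b ⊆ Ω) : IsTestFunction Ω (radialPrimitive N q b) :=
  ⟨radialPrimitive_contDiff ha hq h0, radialPrimitive_hasCompactSupport h1,
    (radialPrimitive_tsupport h1).trans hΩ⟩

theorem hasFDerivAt_comp_norm {E : Type*} [NormedAddCommGroup E] [InnerProductSpace ℝ E]
    {h : ℝ → ℝ} {h' : ℝ} {x : E} (hx : x ≠ 0) (hh : HasDerivAt h h' ‖x‖) :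
    HasFDerivAt (fun y : E => h ‖y‖) ((h' / ‖x‖) • innerSL ℝ x) x := by
  have h2 : HasFDerivAt (fun y : E => ‖y‖) (‖x‖⁻¹ • innerSL ℝ x) x := by
    have h3 := (hasStrictFDerivAt_norm_sq x).hasFDerivAt.sqrt
      (pow_ne_zero 2 (norm_ne_zero_iff.2 hx))
    have e : (fun y : E => √(‖y‖ ^ 2)) = fun y => ‖y‖ := by
      ext y; exact Real.sqrt_sq (norm_nonneg y)
    rw [e, Real.sqrt_sq (norm_nonneg x)] at h3
    have e2 : (1 / (2 * ‖x‖)) • 2 • (innerSL ℝ) x = ‖x‖⁻¹ • innerSL ℝ x := by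
      ext z
      simp
      field_simp
    rwa [e2] at h3
  have h3 := hh.comp_hasFDerivAt x h2
  rw [smul_smul, ← div_eq_mul_inv] at h3
  exact h3

theorem partialDeriv_radialPrimitive (ha : 0 < a) (hq : ContDiff ℝ ∞ q)
    (h0 : ∀ s, |s| < a → q s = 0) (i : Fin N) (x : Rn N) :
    partialDeriv i (radialPrimitive N q b) x = q ‖x‖ / ‖x‖ * x i := by
  by_cases hx : x = 0
  · subst hx
    have : radialPrimitive N q b =ᶠ[𝓝 0] fun _ => ∫ s in b..0, q s := by
      filter_upwards [Metric.ball_mem_nhds (0 : Rn N) ha] with y hy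
      exact radialPrimitive_eq_of_norm_lt hq h0 (by simpa using hy)
    simp [partialDeriv, this.fderiv_eq]
  · have hd : HasDerivAt (fun t => ∫ s in b..t, q s) (q ‖x‖) ‖x‖ :=
      intervalIntegral.integral_hasDerivAt_right (hq.continuous.intervalIntegrable _ _)
        (hq.continuous.stronglyMeasurableAtFilter _ _) hq.continuous.continuousAt
    have := (hasFDerivAt_comp_norm hx hd).fderiv
    unfold partialDeriv radialPrimitive
    rw [this]
    simp [EuclideanSpace.inner_single_right]

theorem laplacian_radialPrimitive (ha : 0 < a) (hq : ContDiff ℝ ∞ q)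
    (h0 : ∀ s, |s| < a → q s = 0) {x : Rn N} (hx : x ≠ 0) :
    (Δ (radialPrimitive N q b)) x = deriv q ‖x‖ + ((N : ℝ) - 1) / ‖x‖ * q ‖x‖ := by
  rw [laplacian_eq_sum_partialDeriv (radialPrimitive_contDiff ha hq h0)]
  have hn : ‖x‖ ≠ 0 := norm_ne_zero_iff.2 hx
  have hdq : HasDerivAt q (deriv q ‖x‖) ‖x‖ :=
    (hq.contDiffAt.differentiableAt (by simp)).hasDerivAt
  have hd := hasFDerivAt_comp_norm hx (hdq.div (hasDerivAt_id ‖x‖) hn)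
  -- Product rule for (q(r)/r) x_i. Summing over i, the first term gives N q/r and Σ x_i² = r² turns
  -- the second into q' - q/r.
  have key : ∀ i : Fin N, partialDeriv i (partialDeriv i (radialPrimitive N q b)) x =
      q ‖x‖ / ‖x‖ + (deriv q ‖x‖ * ‖x‖ - q ‖x‖) / ‖x‖ ^ 3 * x i ^ 2 := by
    intro i
    rw [show partialDeriv i (radialPrimitive N q b) = fun x => q ‖x‖ / ‖x‖ * x i from
      funext fun x => partialDeriv_radialPrimitive ha hq h0 i x]
    have h3 := hd.mul (EuclideanSpace.proj (𝕜 := ℝ) i : Rn N →L[ℝ] ℝ).hasFDerivAt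
    unfold partialDeriv
    erw [h3.fderiv]
    simp [EuclideanSpace.inner_single_right]
    field_simp
  simp_rw [key]
  rw [Finset.sum_add_distrib, ← Finset.mul_sum, Finset.sum_const, Finset.card_univ,
    Fintype.card_fin, nsmul_eq_mul, ← EuclideanSpace.real_norm_sq_eq]
  field_simp
  ring

theorem norm_gradVec_radialPrimitive (ha : 0 < a) (hq : ContDiff ℝ ∞ q)
    (h0 : ∀ s, |s| < a → q s = 0) (x : Rn N) :
    ‖gradVec (radialPrimitive N q b) x‖ = |q ‖x‖| := by
  have : gradVec (radialPrimitive N q b) x = (q ‖x‖ / ‖x‖) • x := by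
    ext i
    simp [partialDeriv_radialPrimitive ha hq h0]
  rw [this, norm_smul, Real.norm_eq_abs, abs_div, abs_norm]
  by_cases hx : ‖x‖ = 0
  · simp [hx, h0 0 (by simpa using ha)]
  · field_simp

end Radial

/-! ### Polar coordinates -/

/-- The surface area `N V_N` of the unit sphere. -/
noncomputable def sphereArea (N : ℕ) : ℝ := N * ballVolume N

theorem ballVolume_pos (N : ℕ) : 0 < ballVolume N :=
  ENNReal.toReal_pos (Metric.measure_ball_pos volume 0 one_pos).ne' measure_ball_lt_top.ne

theorem sphereArea_pos {N : ℕ} (hN : 0 < N) : 0 < sphereArea N :=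
  mul_pos (by exact_mod_cast hN) (ballVolume_pos N)

theorem integral_radial {N : ℕ} (hN : 0 < N) (f : ℝ → ℝ) :
    ∫ x : Rn N, f ‖x‖ = sphereArea N * ∫ y in Ioi (0 : ℝ), y ^ (N - 1) * f y := by
  have : Nonempty (Fin N) := ⟨⟨0, hN⟩⟩
  rw [integral_fun_norm_addHaar volume f]
  simp [sphereArea, ballVolume, unitBall, Measure.real, mul_assoc]

theorem integrable_radial {N : ℕ} (hN : 0 < N) {f : ℝ → ℝ} :
    Integrable (fun x : Rn N => f ‖x‖) ↔
      IntegrableOn (fun y : ℝ => y ^ (N - 1) * f y) (Ioi 0) := by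
  have : Nonempty (Fin N) := ⟨⟨0, hN⟩⟩
  rw [integrable_fun_norm_addHaar volume]
  simp

theorem lintegral_radial {N : ℕ} (hN : 0 < N) {f : ℝ → ℝ} (hf : ∀ r, 0 ≤ r → 0 ≤ f r)
    (hi : IntegrableOn (fun y : ℝ => y ^ (N - 1) * f y) (Ioi 0)) :
    ∫⁻ x : Rn N, ENNReal.ofReal (f ‖x‖) =
      ENNReal.ofReal (sphereArea N * ∫ y in Ioi (0 : ℝ), y ^ (N - 1) * f y) := by
  rw [← integral_radial hN, ofReal_integral_eq_lintegral_ofReal ((integrable_radial hN).2 hi)]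
  exact Eventually.of_forall fun x => hf _ (norm_nonneg x)

/-- A null set of radii has null preimage: in polar coordinates the integral of its indicator is
zero. The bad set is first enlarged to a measurable hull so that the indicator can be composed with
the norm. -/
theorem ae_norm_of_ae {N : ℕ} (hN : 0 < N) {P : ℝ → Prop}
    (h : ∀ᵐ r ∂volume.restrict (Ioi (0 : ℝ)), P r) : ∀ᵐ x : Rn N, P ‖x‖ := by
  set Z := toMeasurable (volume.restrict (Ioi (0 : ℝ))) {r | ¬ P r} with hZ
  have hZm : MeasurableSet Z := measurableSet_toMeasurable _ _
  have hZ0 : volume.restrict (Ioi (0 : ℝ)) Z = 0 := by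
    rw [hZ, measure_toMeasurable]; exact h
  have hae : (fun y : ℝ => y ^ (N - 1) * Z.indicator (fun _ => (1 : ℝ)) y)
      =ᵐ[volume.restrict (Ioi (0 : ℝ))] 0 := by
    have : ∀ᵐ r ∂volume.restrict (Ioi (0 : ℝ)), r ∉ Z := measure_eq_zero_iff_ae_notMem.1 hZ0
    filter_upwards [this] with r hr
    simp [hr]
  have hl := lintegral_radial (N := N) hN (f := Z.indicator fun _ => 1)
    (fun r _ => indicator_nonneg (fun _ _ => zero_le_one) r)
    ((integrable_zero _ _ _).congr hae.symm)
  rw [integral_congr_ae hae] at hl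
  simp only [Pi.zero_apply, integral_zero, mul_zero, ENNReal.ofReal_zero] at hl
  have hmeas : Measurable fun x : Rn N => Z.indicator (fun _ => (1 : ℝ)) ‖x‖ :=
    (measurable_const.indicator hZm).comp measurable_norm
  rw [lintegral_eq_zero_iff hmeas.ennreal_ofReal] at hl
  filter_upwards [hl] with x hx
  by_contra hc
  have : ‖x‖ ∈ Z := subset_toMeasurable _ _ hc
  simp [this] at hx

/-! ### Weak derivatives on the half line -/

theorem exists_support_bounds {Ψ : ℝ → ℝ} (h1 : HasCompactSupport Ψ) (h2 : tsupport Ψ ⊆ Ioi 0) :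
    ∃ a b : ℝ, 0 < a ∧ a < b ∧ (∀ s, s ≤ a → Ψ s = 0) ∧ ∀ s, b ≤ s → Ψ s = 0 := by
  rcases (tsupport Ψ).eq_empty_or_nonempty with he | hne
  · have : ∀ s, Ψ s = 0 := fun s => image_eq_zero_of_notMem_tsupport (by simp [he])
    exact ⟨1, 2, one_pos, one_lt_two, fun s _ => this s, fun s _ => this s⟩
  · obtain ⟨m, hm, hmin⟩ := h1.exists_isLeast hne
    obtain ⟨M, hM, hmax⟩ := h1.exists_isGreatest hne
    have hm0 : 0 < m := h2 hm
    have hmM : m ≤ M := hmin hM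
    refine ⟨m / 2, M + 1, by positivity, by linarith, fun s hs => ?_, fun s hs => ?_⟩
    · refine image_eq_zero_of_notMem_tsupport fun hc => ?_
      have := hmin hc
      linarith
    · refine image_eq_zero_of_notMem_tsupport fun hc => ?_
      have := hmax hc
      linarith

theorem setIntegral_Ioi_eq_intervalIntegral {F : ℝ → ℝ} {a b : ℝ} (ha : 0 ≤ a) (hab : a ≤ b)
    (h0 : ∀ s, s ≤ a → F s = 0) (h1 : ∀ s, b ≤ s → F s = 0) :
    ∫ s in Ioi (0 : ℝ), F s = ∫ s in a..b, F s := by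
  rw [intervalIntegral.integral_of_le hab]
  refine (setIntegral_eq_of_subset_of_forall_sdiff_eq_zero measurableSet_Ioi
    (fun x hx => ha.trans_lt hx.1) fun x hx => ?_)
  by_cases hxa : x ≤ a
  · exact h0 x hxa
  · refine h1 x ?_
    by_contra hc
    exact hx.2 ⟨not_le.1 hxa, (not_le.1 hc).le⟩

/-- A function on the half line with continuous weak derivative `h` is a primitive of `h`. -/
theorem ae_eq_primitive_of_weak_deriv {v h : ℝ → ℝ} (hv : LocallyIntegrableOn v (Ioi 0))
    (hh : ContinuousOn h (Ioi 0))
    (H : ∀ Ψ : ℝ → ℝ, ContDiff ℝ ∞ Ψ → HasCompactSupport Ψ → tsupport Ψ ⊆ Ioi 0 →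
      ∫ r in Ioi (0 : ℝ), v r * deriv Ψ r = - ∫ r in Ioi (0 : ℝ), h r * Ψ r) :
    ∃ c : ℝ, ∀ᵐ r ∂volume.restrict (Ioi (0 : ℝ)), v r = c + ∫ s in (1 : ℝ)..r, h s := by
  set Q : ℝ → ℝ := fun r => ∫ s in (1 : ℝ)..r, h s with hQdef
  have hint : ∀ a b : ℝ, 0 < a → 0 < b → IntervalIntegrable h volume a b := fun a b ha hb =>
    (hh.mono fun x hx => (lt_min ha hb).trans_le hx.1).intervalIntegrable
  have hQd : ∀ r, 0 < r → HasDerivAt Q (h r) r := fun r hr =>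
    intervalIntegral.integral_hasDerivAt_right (hint 1 r one_pos hr)
      (hh.stronglyMeasurableAtFilter isOpen_Ioi r hr) (hh.continuousAt (Ioi_mem_nhds hr))
  have hQc : ContinuousOn Q (Ioi 0) := fun r hr => (hQd r hr).continuousAt.continuousWithinAt
  have hvQ : LocallyIntegrableOn (fun r => v r - Q r) (Ioi 0) :=
    hv.sub (hQc.locallyIntegrableOn measurableSet_Ioi)
  have int : ∀ {k : ℝ → ℝ}, LocallyIntegrableOn k (Ioi 0) → ∀ {Ψ : ℝ → ℝ}, Continuous Ψ →
      HasCompactSupport Ψ → tsupport Ψ ⊆ Ioi 0 → IntegrableOn (fun x => k x * Ψ x) (Ioi 0) := by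
    intro k hk Ψ h1 h2 h3
    have hK : IntegrableOn k (tsupport Ψ) := hk.integrableOn_compact_subset h3 h2
    have h4 : IntegrableOn (fun x => k x * Ψ x) (tsupport Ψ) :=
      hK.mul_continuousOn h1.continuousOn h2
    refine h4.of_forall_sdiff_eq_zero measurableSet_Ioi fun x hx => ?_
    simp [image_eq_zero_of_notMem_tsupport hx.2]
  -- The difference v - Q annihilates all derivatives of test functions, so it must be constant (du
  -- Bois-Reymond).
  have H2 : ∀ Ψ : ℝ → ℝ, ContDiff ℝ ∞ Ψ → HasCompactSupport Ψ → tsupport Ψ ⊆ Ioi 0 →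
      ∫ r in Ioi (0 : ℝ), (v r - Q r) * deriv Ψ r = 0 := by
    intro Ψ h1 h2 h3
    obtain ⟨a, b, ha, hab, hza, hzb⟩ := exists_support_bounds h2 h3
    have hd : ∀ r, HasDerivAt Ψ (deriv Ψ r) r := fun r =>
      (h1.contDiffAt.differentiableAt (by simp)).hasDerivAt
    have hcd : Continuous (deriv Ψ) := h1.continuous_deriv (by simp)
    have h2' : HasCompactSupport (deriv Ψ) := h2.deriv
    have h3' : tsupport (deriv Ψ) ⊆ Ioi 0 := (tsupport_deriv_subset (𝕜 := ℝ)).trans h3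
    have e1 : ∫ r in Ioi (0 : ℝ), Q r * deriv Ψ r = - ∫ r in Ioi (0 : ℝ), h r * Ψ r := by
      obtain ⟨a', b', ha', hab', hza', hzb'⟩ := exists_support_bounds h2' h3'
      set A := min a a' with hA
      set B := max b b' with hB
      have hA0 : 0 < A := lt_min ha ha'
      have hAB : A ≤ B := (min_le_left _ _).trans (hab.le.trans (le_max_left _ _))
      rw [setIntegral_Ioi_eq_intervalIntegral hA0.le hAB
        (fun s hs => by rw [hza' s (hs.trans (min_le_right _ _)), mul_zero])
        (fun s hs => by rw [hzb' s ((le_max_right _ _).trans hs), mul_zero]),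
        setIntegral_Ioi_eq_intervalIntegral hA0.le hAB
        (fun s hs => by rw [hza s (hs.trans (min_le_left _ _)), mul_zero])
        (fun s hs => by rw [hzb s ((le_max_left _ _).trans hs), mul_zero])]
      rw [intervalIntegral.integral_mul_deriv_eq_deriv_mul (u' := h)
        (fun x hx => hQd x (by rw [uIcc_of_le hAB] at hx; exact hA0.trans_le hx.1))
        (fun x _ => hd x) (hint A B hA0 (hA0.trans_le hAB)) (hcd.intervalIntegrable _ _)]
      rw [hza A (min_le_left _ _), hzb B (le_max_left _ _)]
      simp
    have e2 := H Ψ h1 h2 h3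
    simp_rw [sub_mul]
    rw [integral_sub (int hv hcd h2' h3')
      (int (hQc.locallyIntegrableOn measurableSet_Ioi) hcd h2' h3'), e1, e2, sub_self]
  -- A bump of unit mass supported in [1, 3], inside the half line; the constant is the average of v
  -- - Q against it.
  let θ : ContDiffBump (2 : ℝ) := ⟨1 / 2, 1, by norm_num, by norm_num⟩
  set Θ : ℝ → ℝ := θ.normed volume with hΘ
  have hΘ1 : ContDiff ℝ ∞ Θ := θ.contDiff_normed
  have hΘ2 : HasCompactSupport Θ := θ.hasCompactSupport_normed
  have hΘ3 : tsupport Θ ⊆ Ioi 0 := by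
    rw [hΘ, θ.tsupport_normed_eq]
    intro x hx
    have : |x - 2| ≤ 1 := by simpa [Real.dist_eq] using hx
    have := abs_le.1 this
    show (0 : ℝ) < x
    linarith
  refine ⟨∫ r in Ioi (0 : ℝ), (v r - Q r) * Θ r, ?_⟩
  set C := ∫ r in Ioi (0 : ℝ), (v r - Q r) * Θ r with hC
  have key := isOpen_Ioi.ae_eq_zero_of_integral_contDiff_smul_eq_zero (μ := volume)
    (f := fun r => v r - Q r - C) (U := Ioi (0 : ℝ))
    (hvQ.sub ((locallyIntegrable_const C).locallyIntegrableOn _)) ?_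
  · rw [ae_restrict_iff' measurableSet_Ioi]
    filter_upwards [key] with r hr hr0
    have := hr hr0
    linarith
  -- Subtracting from g its integral times the bump gives mean zero, so the result is the derivative
  -- of a compactly supported function, to which `H2` applies.
  · intro g g1 g2 g3
    set I := ∫ r, g r with hI
    set η : ℝ → ℝ := fun r => g r - I * Θ r with hη
    have η1 : ContDiff ℝ ∞ η := g1.sub (contDiff_const.mul hΘ1)
    have η0 : ∫ r, η r = 0 := by
      rw [hη, integral_sub (g1.continuous.integrable_of_hasCompactSupport g2)
        ((hΘ1.continuous.integrable_of_hasCompactSupport hΘ2).const_mul I), integral_const_mul,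
        hΘ, θ.integral_normed, mul_one, sub_self]
    obtain ⟨a, b, ha, hab, hza, hzb⟩ := exists_support_bounds g2 g3
    obtain ⟨a', b', ha', hab', hza', hzb'⟩ := exists_support_bounds hΘ2 hΘ3
    set A := min a a' with hA
    set B := max b b' with hB
    have hA0 : 0 < A := lt_min ha ha'
    have hAB : A ≤ B := (min_le_left _ _).trans (hab.le.trans (le_max_left _ _))
    have ηA : ∀ s, s ≤ A → η s = 0 := fun s hs => by
      simp [hη, hza s (hs.trans (min_le_left _ _)), hza' s (hs.trans (min_le_right _ _))]
    have ηB : ∀ s, B ≤ s → η s = 0 := fun s hs => by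
      simp [hη, hzb s ((le_max_left _ _).trans hs), hzb' s ((le_max_right _ _).trans hs)]
    have ηAB : ∫ s in A..B, η s = 0 := by
      rw [← setIntegral_Ioi_eq_intervalIntegral hA0.le hAB ηA ηB,
        setIntegral_eq_integral_of_forall_compl_eq_zero, η0]
      intro x hx
      exact ηA x ((not_lt.1 hx).trans hA0.le)
    set Ψ : ℝ → ℝ := fun r => ∫ s in A..r, η s with hΨ
    have Ψ1 : ContDiff ℝ ∞ Ψ := contDiff_primitive η1 A
    have Ψs : tsupport Ψ ⊆ Icc A B := by
      refine closure_minimal (fun x hx => ?_) isClosed_Icc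
      by_contra hc
      refine hx ?_
      rcases not_and_or.1 hc with hc | hc
      · rw [not_le] at hc
        refine intervalIntegral.integral_zero_ae (Eventually.of_forall fun s hs => ηA s ?_)
        rw [uIoc_of_ge hc.le] at hs
        exact hs.2
      · rw [not_le] at hc
        have : ∫ s in B..x, η s = 0 :=
          intervalIntegral.integral_zero_ae (Eventually.of_forall fun s hs => ηB s (by
            rw [uIoc_of_le hc.le] at hs; exact hs.1.le))
        rw [hΨ]
        simp only
        rw [← intervalIntegral.integral_add_adjacent_intervals (b := B)
          (η1.continuous.intervalIntegrable _ _) (η1.continuous.intervalIntegrable _ _), ηAB,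
          this, add_zero]
    have Ψ' : deriv Ψ = η := funext fun r =>
      (intervalIntegral.integral_hasDerivAt_right (η1.continuous.intervalIntegrable _ _)
        (η1.continuous.stronglyMeasurableAtFilter _ _) η1.continuous.continuousAt).deriv
    have e := H2 Ψ Ψ1 (isCompact_Icc.of_isClosed_subset (isClosed_tsupport _) Ψs)
      (Ψs.trans fun x hx => hA0.trans_le hx.1)
    rw [Ψ'] at e
    have e3 : ∀ r, (v r - Q r) * η r = (v r - Q r) * g r - I * ((v r - Q r) * Θ r) := fun r => by
      simp only [hη]; ring
    simp_rw [e3] at e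
    rw [integral_sub (int hvQ g1.continuous g2 g3)
      ((int hvQ hΘ1.continuous hΘ2 hΘ3).const_mul I), integral_const_mul, ← hC] at e
    have z : ∀ x : ℝ, x ∉ Ioi (0 : ℝ) → g x = 0 := fun x hx =>
      image_eq_zero_of_notMem_tsupport fun hc => hx (g3 hc)
    rw [← setIntegral_eq_integral_of_forall_compl_eq_zero (s := Ioi (0 : ℝ))
      fun x hx => by simp [z x hx]]
    have hI' : I = ∫ r in Ioi (0 : ℝ), g r :=
      (setIntegral_eq_integral_of_forall_compl_eq_zero z).symm
    have e4 : ∀ r, g r • (v r - Q r - C) = (v r - Q r) * g r - C * g r := fun r => by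
      simp only [smul_eq_mul]; ring
    simp_rw [e4]
    rw [integral_sub (int hvQ g1.continuous g2 g3)
      ((g1.continuous.integrable_of_hasCompactSupport g2).integrableOn.const_mul C),
      integral_const_mul, ← hI']
    linarith

/-! ### The flux and the representation of radial functions -/

/-- The mass of `f` in the ball of radius `s`. -/
noncomputable def ballMass {N : ℕ} (f : Rn N → ℝ) (s : ℝ) : ℝ := ∫ y in Metric.ball 0 s, f y

theorem LocallyIntegrable.integrableOn_ball {N : ℕ} {f : Rn N → ℝ} (hf : LocallyIntegrable f)
    (s : ℝ) : IntegrableOn f (Metric.ball 0 s) :=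
  (hf.integrableOn_isCompact (isCompact_closedBall 0 s)).mono_set Metric.ball_subset_closedBall

/-- Dominated convergence: off the sphere of radius s, which is null, the indicator of the ball of
radius t is locally constant in t near s. -/
theorem continuous_ballMass {N : ℕ} (hN : 0 < N) {f : Rn N → ℝ} (hf : LocallyIntegrable f) :
    Continuous (ballMass f) := by
  have : Nonempty (Fin N) := ⟨⟨0, hN⟩⟩
  rw [continuous_iff_continuousAt]
  intro s
  have e : ballMass f = fun t => ∫ y, (Metric.ball (0 : Rn N) t).indicator f y := by
    ext t
    rw [integral_indicator Metric.isOpen_ball.measurableSet, ballMass]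
  rw [e]
  refine continuousAt_of_dominated
    (bound := (Metric.ball (0 : Rn N) (s + 1)).indicator fun y => ‖f y‖) ?_ ?_ ?_ ?_
  · exact Eventually.of_forall fun t =>
      hf.aestronglyMeasurable.indicator Metric.isOpen_ball.measurableSet
  · filter_upwards [Iio_mem_nhds (lt_add_one s)] with t ht
    refine Eventually.of_forall fun y => ?_
    rw [norm_indicator_eq_indicator_norm]
    exact indicator_le_indicator_of_subset (Metric.ball_subset_ball (le_of_lt ht))
      (fun _ => norm_nonneg _) y
  · rw [integrable_indicator_iff Metric.isOpen_ball.measurableSet]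
    exact (LocallyIntegrable.integrableOn_ball hf _).norm
  · have : ∀ᵐ y : Rn N, y ∉ Metric.sphere (0 : Rn N) s :=
      measure_eq_zero_iff_ae_notMem.1 (Measure.addHaar_sphere volume 0 s)
    filter_upwards [this] with y hy
    have hy : ‖y‖ ≠ s := by simpa using hy
    rcases lt_or_gt_of_ne hy with h | h
    · refine (continuousAt_const (y := f y)).congr ?_
      filter_upwards [Ioi_mem_nhds h] with t ht
      rw [indicator_of_mem (by simpa using ht)]
    · refine (continuousAt_const (y := (0 : ℝ))).congr ?_
      filter_upwards [Iio_mem_nhds h] with t ht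
      rw [indicator_of_notMem]
      simpa using le_of_lt ht

/-- Fubini on the region where |y| < s. This exchanges the radial integral of a flux for an integral
of f against an explicit kernel, and serves both the weak formulation and the sharp estimate. -/
theorem integral_mul_ballMass {N : ℕ} {f : Rn N → ℝ} {g : ℝ → ℝ} {a b : ℝ} (hab : a ≤ b)
    (hf : IntegrableOn f (Metric.ball 0 b)) (hg : IntervalIntegrable g volume a b) :
    ∫ s in a..b, g s * ballMass f s =
      ∫ y in Metric.ball 0 b, f y * ∫ s in (max a ‖y‖)..b, g s := by
  have hg' : IntegrableOn g (Ioc a b) := (intervalIntegrable_iff_integrableOn_Ioc_of_le hab).1 hg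
  have hS : MeasurableSet {z : Rn N × ℝ | ‖z.1‖ < z.2} :=
    (isOpen_lt (by fun_prop) (by fun_prop)).measurableSet
  have hF : Integrable ({z : Rn N × ℝ | ‖z.1‖ < z.2}.indicator fun z => f z.1 * g z.2)
      ((volume.restrict (Metric.ball (0 : Rn N) b)).prod (volume.restrict (Ioc a b))) :=
    (Integrable.mul_prod hf hg').indicator hS
  have sw := integral_integral_swap (f := fun (y : Rn N) (s : ℝ) =>
    {z : Rn N × ℝ | ‖z.1‖ < z.2}.indicator (fun z => f z.1 * g z.2) (y, s)) hF
  rw [intervalIntegral.integral_of_le hab]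
  have e1 : ∀ s ∈ Ioc a b, g s * ballMass f s = ∫ y in Metric.ball (0 : Rn N) b,
      {z : Rn N × ℝ | ‖z.1‖ < z.2}.indicator (fun z => f z.1 * g z.2) (y, s) := by
    intro s hs
    have : ∀ y, {z : Rn N × ℝ | ‖z.1‖ < z.2}.indicator (fun z => f z.1 * g z.2) (y, s) =
        (Metric.ball (0 : Rn N) s).indicator (fun y => g s * f y) y := by
      intro y
      simp only [indicator, mem_ofPred_eq, mem_ball_zero_iff, mul_comm]
    simp_rw [this]
    rw [setIntegral_indicator Metric.isOpen_ball.measurableSet,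
      inter_eq_self_of_subset_right (Metric.ball_subset_ball hs.2), integral_const_mul, ballMass]
  rw [setIntegral_congr_fun measurableSet_Ioc e1, ← sw]
  refine setIntegral_congr_fun Metric.isOpen_ball.measurableSet fun y hy => ?_
  have hy : ‖y‖ < b := by simpa using hy
  have : ∀ s, {z : Rn N × ℝ | ‖z.1‖ < z.2}.indicator (fun z => f z.1 * g z.2) (y, s) =
        (Ioi ‖y‖).indicator (fun s => f y * g s) s := by
    intro s
    simp only [indicator, mem_ofPred_eq, mem_Ioi]
  simp_rw [this]
  rw [setIntegral_indicator measurableSet_Ioi, integral_const_mul,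
    intervalIntegral.integral_of_le (max_le hab hy.le)]
  congr 3
  ext s
  simp only [mem_inter_iff, mem_Ioc, mem_Ioi, max_lt_iff]
  tauto

/-- The radial derivative of a radial function with Laplacian `f`. -/
noncomputable def flux {N : ℕ} (f : Rn N → ℝ) (s : ℝ) : ℝ :=
  ballMass f s / (sphereArea N * s ^ (N - 1))

theorem continuousOn_flux {N : ℕ} (hN : 0 < N) {f : Rn N → ℝ} (hf : LocallyIntegrable f) :
    ContinuousOn (flux f) (Ioi 0) := by
  have hS := sphereArea_pos hN
  refine (continuous_ballMass hN hf).continuousOn.div (by fun_prop) fun x hx => ?_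
  have : (0 : ℝ) < x := hx
  positivity

/-- A radial function with locally integrable weak Laplacian `f` is, up to an additive constant,
the radial primitive of the flux. -/
theorem exists_radial_representation {N : ℕ} (hN : 2 ≤ N) {u f : Rn N → ℝ} {v : ℝ → ℝ}
    (hv : u =ᵐ[volume] fun x => v ‖x‖) (hL : HasWeakLaplacian univ u f) :
    ∃ c : ℝ, ∀ᵐ x : Rn N,
      u x = c + ∫ s in (1 : ℝ)..‖x‖, flux f s := by
  have hN0 : 0 < N := by omega
  obtain ⟨hu, hf, hw⟩ := hL
  rw [locallyIntegrableOn_univ] at hu hf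
  have hS := sphereArea_pos hN0
  -- On a compact set of positive radii the polar weight y^{N-1} is continuous and nonzero, so it
  -- can be divided out.
  have hvi : LocallyIntegrableOn v (Ioi 0) := by
    rw [locallyIntegrableOn_iff isOpen_Ioi.isLocallyClosed]
    intro K hK hKc
    rcases K.eq_empty_or_nonempty with rfl | hne
    · simp
    obtain ⟨m, hm, hmin⟩ := hKc.exists_isLeast hne
    obtain ⟨M, hM, hmax⟩ := hKc.exists_isGreatest hne
    have hm0 : 0 < m := hK hm
    have : Nonempty (Fin N) := ⟨⟨0, hN0⟩⟩
    have h1 : IntegrableOn (fun x : Rn N => v ‖x‖) (Metric.ball 0 (M + 1)) :=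
      (LocallyIntegrable.integrableOn_ball hu _).congr (ae_restrict_of_ae hv)
    rw [integrableOn_fun_norm_addHaar] at h1
    have h2 : IntegrableOn (fun y : ℝ => y ^ (N - 1) * v y) K := by
      refine IntegrableOn.mono_set (by simpa using h1) fun x hx => ?_
      exact ⟨hK hx, (hmax hx).trans_lt (lt_add_one M)⟩
    have h3 : ContinuousOn (fun y : ℝ => (y ^ (N - 1))⁻¹) K :=
      (continuousOn_pow _).inv₀ fun x hx => pow_ne_zero _ (hK hx : (0 : ℝ) < x).ne'
    refine (h2.mul_continuousOn h3 hKc).congr_fun (fun x hx => ?_) hKc.measurableSet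
    have : x ≠ 0 := (hK hx : (0 : ℝ) < x).ne'
    field_simp
  have hh := continuousOn_flux hN0 hf
  suffices H : ∀ Ψ : ℝ → ℝ, ContDiff ℝ ∞ Ψ → HasCompactSupport Ψ → tsupport Ψ ⊆ Ioi 0 →
      ∫ r in Ioi (0 : ℝ), v r * deriv Ψ r =
        - ∫ r in Ioi (0 : ℝ), flux f r * Ψ r by
    obtain ⟨c, hc⟩ := ae_eq_primitive_of_weak_deriv hvi hh H
    refine ⟨c, ?_⟩
    filter_upwards [hv, ae_norm_of_ae hN0 hc] with x h1 h2
    exact h1.trans h2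
  intro Ψ h1 h2 h3
  obtain ⟨a, b, ha, hab, hza, hzb⟩ := exists_support_bounds h2 h3
  -- The test function with radial derivative Ψ/s^{N-1} has Laplacian s^{1-N}(s^{N-1}q)' =
  -- s^{1-N}Ψ', so the polar weight cancels and the one-dimensional weak equation appears.
  set q : ℝ → ℝ := fun s => Ψ s / s ^ (N - 1) with hq
  have hq1 : ContDiff ℝ ∞ q := by
    rw [contDiff_iff_contDiffAt]
    intro s
    by_cases hs : s < a
    · refine (contDiffAt_const (c := (0 : ℝ))).congr_of_eventuallyEq ?_
      filter_upwards [Iio_mem_nhds hs] with t ht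
      simp [hq, hza t (le_of_lt ht)]
    · have : s ≠ 0 := (ha.trans_le (not_lt.1 hs)).ne'
      exact h1.contDiffAt.div (by fun_prop) (pow_ne_zero _ this)
  have hq0 : ∀ s, |s| < a → q s = 0 := fun s hs => by
    simp [hq, hza s ((le_abs_self s).trans hs.le)]
  have hqb : ∀ s, b ≤ s → q s = 0 := fun s hs => by simp [hq, hzb s hs]
  have ht : IsTestFunction univ (radialPrimitive N q b) :=
    radialPrimitive_isTestFunction ha hq1 hq0 hqb (subset_univ _)
  have E := hw _ ht
  rw [setIntegral_univ, setIntegral_univ] at E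
  have L : ∫ x, u x * (Δ (radialPrimitive N q b)) x =
      sphereArea N * ∫ r in Ioi (0 : ℝ), v r * deriv Ψ r := by
    have e1 : (fun x => u x * (Δ (radialPrimitive N q b)) x) =ᵐ[volume]
        fun x => (fun r => v r * (deriv q r + ((N : ℝ) - 1) / r * q r)) ‖x‖ := by
      have : Nonempty (Fin N) := ⟨⟨0, hN0⟩⟩
      filter_upwards [hv, compl_mem_ae_iff.2 (measure_singleton (0 : Rn N))] with x hx hx0
      rw [hx, laplacian_radialPrimitive ha hq1 hq0 (by simpa using hx0)]
    rw [integral_congr_ae e1,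
      integral_radial hN0 fun r => v r * (deriv q r + ((N : ℝ) - 1) / r * q r)]
    congr 1
    refine setIntegral_congr_fun measurableSet_Ioi fun r hr => ?_
    have hr0 : (0 : ℝ) < r := hr
    have eΨ : Ψ =ᶠ[𝓝 r] fun s => s ^ (N - 1) * q s := by
      filter_upwards [Ioi_mem_nhds hr0] with s hs
      have : s ≠ 0 := (hs : (0 : ℝ) < s).ne'
      simp only [hq]
      field_simp
    have hd := (hasDerivAt_pow (N - 1) r).mul (hq1.contDiffAt.differentiableAt (by simp)).hasDerivAt
    rw [eΨ.deriv_eq]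
    erw [hd.deriv]
    obtain ⟨n, rfl⟩ : ∃ n, N = n + 2 := ⟨N - 2, by omega⟩
    simp only [Nat.add_sub_cancel, show n + 2 - 1 = n + 1 from rfl]
    push_cast
    field_simp
    ring
  -- The test function at x equals minus the integral of q from |x| to b, so Fubini gives minus the
  -- integral of q times the ball mass.
  have R : ∫ x, f x * radialPrimitive N q b x =
      - (sphereArea N * ∫ r in Ioi (0 : ℝ),
        ballMass f r / (sphereArea N * r ^ (N - 1)) * Ψ r) := by
    have hb0 : 0 < b := ha.trans hab
    have hqm : Continuous fun s => q s * ballMass f s :=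
      hq1.continuous.mul (continuous_ballMass hN0 hf)
    rw [← setIntegral_eq_integral_of_forall_compl_eq_zero (s := Metric.ball (0 : Rn N) b)
      fun x hx => by rw [radialPrimitive_eq_zero hqb (by simpa using hx), mul_zero]]
    have e2 : ∀ x ∈ Metric.ball (0 : Rn N) b, f x * radialPrimitive N q b x =
        - (f x * ∫ s in (max 0 ‖x‖)..b, q s) := fun x _ => by
      rw [radialPrimitive, intervalIntegral.integral_symm, max_eq_right (norm_nonneg x)]
      ring
    rw [setIntegral_congr_fun Metric.isOpen_ball.measurableSet e2, integral_neg,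
      ← integral_mul_ballMass hb0.le (LocallyIntegrable.integrableOn_ball hf b)
        (hq1.continuous.intervalIntegrable _ _),
      setIntegral_Ioi_eq_intervalIntegral ha.le hab.le (fun s hs => by simp [hza s hs])
        (fun s hs => by simp [hzb s hs]), ← intervalIntegral.integral_const_mul,
      ← intervalIntegral.integral_add_adjacent_intervals (a := 0) (b := a) (c := b)
        (hqm.intervalIntegrable _ _)
        (hqm.intervalIntegrable _ _),
      intervalIntegral.integral_zero_ae (Eventually.of_forall fun s hs => ?_), zero_add]
    · congr 1
      refine intervalIntegral.integral_congr fun s hs => ?_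
      rw [uIcc_of_le hab.le] at hs
      have : s ≠ 0 := (ha.trans_le hs.1).ne'
      simp only [hq]
      field_simp
    · rw [uIoc_of_le ha.le] at hs
      simp [hq, hza s hs.2]
  rw [L, R, ← mul_neg] at E
  exact mul_left_cancel₀ hS.ne' E

/-! ### The logarithmic variable and the dual weight integral -/

/-- The logarithmic variable `log (e / r)`. -/
noncomputable def ell (r : ℝ) : ℝ := Real.log (Real.exp 1 / r)

theorem ell_eq {r : ℝ} (hr : 0 < r) : ell r = 1 - Real.log r := by
  rw [ell, Real.log_div (Real.exp_ne_zero 1) hr.ne', Real.log_exp]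

theorem one_le_ell {r : ℝ} (hr : 0 < r) (hr1 : r ≤ 1) : 1 ≤ ell r := by
  rw [ell_eq hr]
  linarith [Real.log_nonpos hr.le hr1]

theorem ell_anti {r s : ℝ} (hr : 0 < r) (hrs : r ≤ s) : ell s ≤ ell r := by
  rw [ell_eq hr, ell_eq (hr.trans_le hrs)]
  linarith [Real.log_le_log hr hrs]

theorem hasDerivAt_ell {r : ℝ} (hr : 0 < r) : HasDerivAt ell (-r⁻¹) r := by
  have h : HasDerivAt (fun r => 1 - Real.log r) (-r⁻¹) r := by
    simpa using (Real.hasDerivAt_log hr.ne').const_sub 1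
  refine h.congr_of_eventuallyEq ?_
  filter_upwards [Ioi_mem_nhds hr] with s hs
  exact ell_eq hs

theorem integral_inv_mul_ell_rpow {β : ℝ} (hβ1 : β < 1) {r : ℝ} (hr : 0 < r) (hr1 : r ≤ 1) :
    ∫ s in r..1, s⁻¹ * ell s ^ (-β) = (ell r ^ (1 - β) - 1) / (1 - β) := by
  have h1β : 1 - β ≠ 0 := by linarith
  have hpos : ∀ s ∈ uIcc r 1, 0 < s ∧ 1 ≤ ell s := fun s hs => by
    rw [uIcc_of_le hr1] at hs
    exact ⟨hr.trans_le hs.1, one_le_ell (hr.trans_le hs.1) hs.2⟩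
  have hd : ∀ s ∈ uIcc r 1, HasDerivAt (fun s => -(ell s ^ (1 - β) / (1 - β)))
      (s⁻¹ * ell s ^ (-β)) s := fun s hs => by
    obtain ⟨h1, h2⟩ := hpos s hs
    have h3 := (((hasDerivAt_ell h1).rpow_const (p := 1 - β)
      (Or.inl (by linarith))).div_const (1 - β)).neg
    refine h3.congr_deriv ?_
    rw [show 1 - β - 1 = -β by ring]
    field_simp
  rw [intervalIntegral.integral_eq_sub_of_hasDerivAt hd]
  · have : ell 1 = 1 := by simp [ell]
    rw [this, Real.one_rpow]
    ring
  · refine ContinuousOn.intervalIntegrable fun s hs => ?_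
    obtain ⟨h1, h2⟩ := hpos s hs
    exact ((continuousAt_inv₀ h1.ne').mul ((hasDerivAt_ell h1).continuousAt.rpow_const
      (Or.inl (by linarith)))).continuousWithinAt

/-- The dual weight integral `(ell^{1-β} - 1)/(1-β) + ell^{-β}/N`. -/
noncomputable def dualMass (N : ℕ) (β r : ℝ) : ℝ :=
  (ell r ^ (1 - β) - 1) / (1 - β) + ell r ^ (-β) / N

theorem dualMass_nonneg {N : ℕ} {β : ℝ} (hβ1 : β < 1) {r : ℝ} (hr : 0 < r)
    (hr1 : r ≤ 1) : 0 ≤ dualMass N β r := by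
  have h1 := one_le_ell hr hr1
  have : 1 ≤ ell r ^ (1 - β) := Real.one_le_rpow h1 (by linarith)
  unfold dualMass
  have h2 : 0 ≤ (ell r ^ (1 - β) - 1) / (1 - β) := div_nonneg (by linarith) (by linarith)
  positivity

/-- This is the dual factor in Hölder's inequality. Outside the ball of radius r the integral is
computed exactly; inside it, ℓ(|x|) ≥ ℓ(r) allows the weight to be frozen at r, and the volume of
the ball contributes ℓ(r)^{-β}/N. -/
theorem lintegral_dual_le {N : ℕ} (hN : 0 < N) {β : ℝ} (hβ0 : 0 ≤ β) (hβ1 : β < 1) {r : ℝ}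
    (hr : 0 < r) (hr1 : r ≤ 1) :
    ∫⁻ x in unitBall N, ENNReal.ofReal (ell ‖x‖ ^ (-β) * (max r ‖x‖ ^ N)⁻¹) ≤
      ENNReal.ofReal (sphereArea N * dualMass N β r) := by
  have hN0 : (N : ℝ) ≠ 0 := by exact_mod_cast hN.ne'
  have : Nonempty (Fin N) := ⟨⟨0, hN⟩⟩
  set k : ℝ → ℝ := fun ρ => (Iic r).indicator (fun _ => ell r ^ (-β) * (r ^ N)⁻¹) ρ +
    (Ioc r 1).indicator (fun ρ => ell ρ ^ (-β) * (ρ ^ N)⁻¹) ρ with hk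
  have hℓr := one_le_ell hr hr1
  have hk0 : ∀ ρ, 0 ≤ ρ → 0 ≤ k ρ := fun ρ hρ => by
    refine add_nonneg (indicator_nonneg (fun _ _ => by positivity) _)
      (indicator_nonneg (fun x hx => ?_) _)
    have h1 : 0 < x := hr.trans hx.1
    have := one_le_ell h1 hx.2
    positivity
  have e : ∀ y : ℝ, y ^ (N - 1) * k y =
      (Iic r).indicator (fun y => ell r ^ (-β) * (r ^ N)⁻¹ * y ^ (N - 1)) y +
      (Ioc r 1).indicator (fun y => y⁻¹ * ell y ^ (-β)) y := fun y => by
    simp only [hk, mul_add]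
    congr 1
    · by_cases hy : y ∈ Iic r <;> simp [hy]; ring
    · by_cases hy : y ∈ Ioc r 1 <;> simp [hy]
      have : y ≠ 0 := (hr.trans hy.1).ne'
      obtain ⟨n, rfl⟩ : ∃ n, N = n + 1 := ⟨N - 1, by omega⟩
      simp only [Nat.add_sub_cancel]
      field_simp
      ring
  have i1 : IntegrableOn ((Iic r).indicator
      (fun y : ℝ => ell r ^ (-β) * (r ^ N)⁻¹ * y ^ (N - 1))) (Ioi 0) := by
    rw [IntegrableOn, integrable_indicator_iff measurableSet_Iic, IntegrableOn,
      Measure.restrict_restrict measurableSet_Iic, inter_comm, Ioi_inter_Iic]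
    exact (Continuous.integrableOn_Icc (by fun_prop)).mono_set Ioc_subset_Icc_self
  have i2 : IntegrableOn ((Ioc r 1).indicator (fun y : ℝ => y⁻¹ * ell y ^ (-β))) (Ioi 0) := by
    rw [IntegrableOn, integrable_indicator_iff measurableSet_Ioc, IntegrableOn,
      Measure.restrict_restrict measurableSet_Ioc, inter_eq_self_of_subset_left
        (show Ioc r 1 ⊆ Ioi 0 from fun x hx => hr.trans hx.1)]
    refine (ContinuousOn.integrableOn_Icc fun s hs => ?_).mono_set Ioc_subset_Icc_self
    have h1 : 0 < s := hr.trans_le hs.1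
    have h2 := one_le_ell h1 hs.2
    exact ((continuousAt_inv₀ h1.ne').mul ((hasDerivAt_ell h1).continuousAt.rpow_const
      (Or.inl (by linarith)))).continuousWithinAt
  have hi : IntegrableOn (fun y : ℝ => y ^ (N - 1) * k y) (Ioi 0) := by
    simp_rw [e]
    exact i1.add i2
  calc ∫⁻ x in unitBall N, ENNReal.ofReal (ell ‖x‖ ^ (-β) * (max r ‖x‖ ^ N)⁻¹)
      ≤ ∫⁻ x in unitBall N, ENNReal.ofReal (k ‖x‖) := by
        refine lintegral_mono_ae ?_
        rw [unitBall, ae_restrict_iff' Metric.isOpen_ball.measurableSet]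
        filter_upwards [compl_mem_ae_iff.2 (measure_singleton (0 : Rn N))] with x hx0 hx
        refine ENNReal.ofReal_le_ofReal ?_
        have hx1 : ‖x‖ < 1 := by simpa using hx
        have hx0 : 0 < ‖x‖ := norm_pos_iff.2 (by simpa using hx0)
        by_cases h : ‖x‖ ≤ r
        · have h' : ‖x‖ ∉ Ioc r 1 := fun hc => absurd hc.1 (not_lt.2 h)
          simp only [hk, indicator_of_mem (show ‖x‖ ∈ Iic r from h), indicator_of_notMem h',
            add_zero, max_eq_left h]
          gcongr ?_ * _
          exact Real.rpow_le_rpow_of_nonpos (by linarith) (ell_anti hx0 h) (by linarith)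
        · have h' : ‖x‖ ∈ Ioc r 1 := ⟨not_le.1 h, hx1.le⟩
          simp only [hk, indicator_of_notMem (show ‖x‖ ∉ Iic r from h), indicator_of_mem h',
            zero_add, max_eq_right (not_le.1 h).le]
          exact le_rfl
    _ ≤ ∫⁻ x : Rn N, ENNReal.ofReal (k ‖x‖) := setLIntegral_le_lintegral _ _
    _ = ENNReal.ofReal (sphereArea N * dualMass N β r) := by
        rw [lintegral_radial hN hk0 hi]
        congr 2
        simp_rw [e]
        rw [integral_add i1 i2, setIntegral_indicator measurableSet_Iic,
          setIntegral_indicator measurableSet_Ioc, Ioi_inter_Iic,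
          inter_eq_self_of_subset_right (show Ioc r 1 ⊆ Ioi 0 from fun x hx => hr.trans hx.1),
          ← intervalIntegral.integral_of_le hr.le, ← intervalIntegral.integral_of_le hr1,
          integral_inv_mul_ell_rpow hβ1 hr hr1, intervalIntegral.integral_const_mul,
          integral_pow, dualMass, add_comm]
        congr 1
        obtain ⟨n, rfl⟩ : ∃ n, N = n + 1 := ⟨N - 1, by omega⟩
        simp only [Nat.add_sub_cancel]
        push_cast at hN0 ⊢
        have := hr.ne'
        field_simp
        simp

/-! ### The sharp pointwise estimate -/

theorem weight_of_mem {N : ℕ} {β : ℝ} {χ : ℝ → ℝ} {x : Rn N} (hx : ‖x‖ < 1) :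
    weight N β χ x = ell ‖x‖ ^ (β * ((N : ℝ) / 2 - 1)) := by
  rw [weight, if_pos hx, ell]

/-- The origin is excluded because division by zero and `Real.log 0 = 0` make the base of the power
there equal to zero. -/
theorem one_le_weight {N : ℕ} (hN : 2 ≤ N) {β : ℝ} (hβ0 : 0 ≤ β) {χ : ℝ → ℝ}
    (hχ : ∀ t, 1 ≤ t → 1 ≤ χ t) {x : Rn N} (hx : x ≠ 0) : 1 ≤ weight N β χ x := by
  have hN' : (2 : ℝ) ≤ N := by exact_mod_cast hN
  by_cases h : ‖x‖ < 1
  · rw [weight_of_mem h]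
    exact Real.one_le_rpow (one_le_ell (norm_pos_iff.2 hx) h.le)
      (mul_nonneg hβ0 (by linarith))
  · rw [weight, if_neg h]
    exact hχ _ (not_lt.1 h)

theorem holderConjugate_half {N : ℕ} (hN : 3 ≤ N) :
    ((N : ℝ) / 2).HolderConjugate ((N : ℝ) / (N - 2)) := by
  have hN' : (3 : ℝ) ≤ N := by exact_mod_cast hN
  rw [Real.holderConjugate_iff]
  refine ⟨by linarith, ?_⟩
  have : (N : ℝ) - 2 ≠ 0 := by linarith
  field_simp
  ring

theorem aemeasurable_weight {N : ℕ} (β : ℝ) (χ : ℝ → ℝ) {r₀ : ℝ} (hr : r₀ ≤ 1) :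
    AEMeasurable (weight N β χ) (volume.restrict (Metric.ball (0 : Rn N) r₀)) := by
  have h : Measurable fun x : Rn N => ell ‖x‖ ^ (β * ((N : ℝ) / 2 - 1)) := by
    unfold ell
    fun_prop
  refine h.aemeasurable.congr ?_
  filter_upwards [ae_restrict_mem Metric.isOpen_ball.measurableSet] with x hx
  rw [weight_of_mem]
  have : ‖x‖ < r₀ := by simpa using hx
  linarith

theorem integral_inv_pow_le {N : ℕ} (hN : 3 ≤ N) {m r₀ : ℝ} (hm : 0 < m) (hmr : m ≤ r₀) :
    ∫ s in m..r₀, (s ^ (N - 1))⁻¹ ≤ (m ^ (N - 2))⁻¹ / (N - 2) := by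
  have hN' : (3 : ℝ) ≤ N := by exact_mod_cast hN
  obtain ⟨n, rfl⟩ : ∃ n, N = n + 3 := ⟨N - 3, by omega⟩
  simp only [show n + 3 - 1 = n + 2 from rfl, show n + 3 - 2 = n + 1 from rfl]
  have hpos : ∀ s ∈ uIcc m r₀, 0 < s := fun s hs => by
    rw [uIcc_of_le hmr] at hs; exact hm.trans_le hs.1
  have hc : ((n : ℝ) + 1) ≠ 0 := by positivity
  have hd : ∀ s ∈ uIcc m r₀, HasDerivAt (fun s : ℝ => -((s ^ (n + 1))⁻¹ / (n + 1)))
      ((s ^ (n + 2))⁻¹) s := fun s hs => by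
    have h1 := (hpos s hs).ne'
    have h2 := (((hasDerivAt_pow (n + 1) s).inv (pow_ne_zero _ h1)).div_const ((n : ℝ) + 1)).neg
    refine h2.congr_deriv ?_
    push_cast
    field_simp
    ring
  rw [intervalIntegral.integral_eq_sub_of_hasDerivAt hd]
  · have h0 : 0 < r₀ := hm.trans_le hmr
    have : 0 ≤ (r₀ ^ (n + 1))⁻¹ / ((n : ℝ) + 1) := by positivity
    push_cast
    rw [show (n : ℝ) + 3 - 2 = n + 1 by ring]
    linarith
  · exact ContinuousOn.intervalIntegrable fun s hs =>
      ((continuousAt_id.pow _).inv₀ (pow_ne_zero _ (hpos s hs).ne')).continuousWithinAt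

/-- The sharp pointwise estimate for the increments of radial functions in terms of the weighted
norm of the Laplacian. -/
theorem abs_integral_flux_le {N : ℕ} (hN : 3 ≤ N) {β : ℝ} (hβ0 : 0 ≤ β) (hβ1 : β < 1)
    {χ : ℝ → ℝ} {f : Rn N → ℝ} {r r₀ : ℝ} (hr : 0 < r) (hrr : r ≤ r₀) (hr₀ : r₀ ≤ 1)
    (hf : IntegrableOn f (Metric.ball 0 r₀))
    (hA : ∫⁻ x in Metric.ball 0 r₀,
      ENNReal.ofReal (weight N β χ x * |f x| ^ ((N : ℝ) / 2)) < ⊤) :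
    |∫ s in r..r₀, flux f s| ≤ (sphereArea N)⁻¹ * ((N : ℝ) - 2)⁻¹ *
      ((∫⁻ x in Metric.ball 0 r₀,
        ENNReal.ofReal (weight N β χ x * |f x| ^ ((N : ℝ) / 2))).toReal ^ (1 / ((N : ℝ) / 2)) *
      (sphereArea N * dualMass N β r) ^ (1 / ((N : ℝ) / (N - 2)))) := by
  have hN0 : 0 < N := by omega
  have hN' : (3 : ℝ) ≤ N := by exact_mod_cast hN
  have : Nonempty (Fin N) := ⟨⟨0, hN0⟩⟩
  have hS := sphereArea_pos hN0
  have hpq := holderConjugate_half hN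
  set A := ∫⁻ x in Metric.ball 0 r₀,
    ENNReal.ofReal (weight N β χ x * |f x| ^ ((N : ℝ) / 2)) with hAdef
  have hT := dualMass_nonneg (N := N) hβ1 hr (hrr.trans hr₀)
  -- Fubini: the increment is f integrated against the Green-type kernel ∫ s^{1-N} ds from
  -- max(r,|y|) to r₀.
  have e1 : ∫ s in r..r₀, flux f s = (sphereArea N)⁻¹ *
      ∫ y in Metric.ball 0 r₀, f y * ∫ s in (max r ‖y‖)..r₀, (s ^ (N - 1))⁻¹ := by
    rw [← integral_mul_ballMass hrr hf, ← intervalIntegral.integral_const_mul]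
    · congr 1
      ext s
      rw [flux, div_eq_mul_inv, mul_inv]
      ring
    · refine ContinuousOn.intervalIntegrable fun s hs => ?_
      rw [uIcc_of_le hrr] at hs
      exact ((continuousAt_id.pow _).inv₀
        (pow_ne_zero _ (hr.trans_le hs.1).ne')).continuousWithinAt
  set Bd := A.toReal ^ (1 / ((N : ℝ) / 2)) *
      (sphereArea N * dualMass N β r) ^ (1 / ((N : ℝ) / (N - 2))) with hBd
  have hBd0 : 0 ≤ Bd := by positivity
  suffices h : |∫ y in Metric.ball 0 r₀, f y * ∫ s in (max r ‖y‖)..r₀, (s ^ (N - 1))⁻¹| ≤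
      ((N : ℝ) - 2)⁻¹ * Bd by
    rw [e1, abs_mul, abs_of_pos (inv_pos.2 hS), mul_assoc]
    gcongr
  rw [← ENNReal.ofReal_le_ofReal_iff (mul_nonneg (inv_nonneg.2 (by linarith)) hBd0),
    ← Real.norm_eq_abs, ofReal_norm]
  -- The kernel is at most max(r,|y|)^{2-N}/(N-2), and w^{2/N} w^{-2/N} = 1 is inserted to prepare
  -- Hölder.
  have hae : ∀ᵐ y ∂volume.restrict (Metric.ball (0 : Rn N) r₀),
      ‖f y * ∫ s in (max r ‖y‖)..r₀, (s ^ (N - 1))⁻¹‖ₑ ≤ ENNReal.ofReal (((N : ℝ) - 2)⁻¹) *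
        (ENNReal.ofReal (weight N β χ y ^ (1 / ((N : ℝ) / 2)) * |f y|) *
          ENNReal.ofReal (weight N β χ y ^ (-(1 / ((N : ℝ) / 2))) *
            (max r ‖y‖ ^ (N - 2))⁻¹)) := by
    rw [ae_restrict_iff' Metric.isOpen_ball.measurableSet]
    filter_upwards [compl_mem_ae_iff.2 (measure_singleton (0 : Rn N))] with y hy0 hy
    have hy1 : ‖y‖ < r₀ := by simpa using hy
    have hy0 : 0 < ‖y‖ := norm_pos_iff.2 (by simpa using hy0)
    have hm : 0 < max r ‖y‖ := hr.trans_le (le_max_left _ _)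
    have hw : 0 < weight N β χ y := by
      rw [weight_of_mem (hy1.trans_le hr₀)]
      have := one_le_ell hy0 (hy1.le.trans hr₀)
      positivity
    have hk0 : 0 ≤ ∫ s in (max r ‖y‖)..r₀, (s ^ (N - 1))⁻¹ :=
      intervalIntegral.integral_nonneg (max_le hrr hy1.le) fun s hs => by
        have : 0 < s := hm.trans_le hs.1
        positivity
    rw [← ofReal_norm, Real.norm_eq_abs, abs_mul, abs_of_nonneg hk0,
      ← ENNReal.ofReal_mul (by positivity),
      ← ENNReal.ofReal_mul (inv_nonneg.2 (by linarith))]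
    refine ENNReal.ofReal_le_ofReal ?_
    have hww : weight N β χ y ^ (1 / ((N : ℝ) / 2)) * weight N β χ y ^ (-(1 / ((N : ℝ) / 2)))
        = 1 := by rw [← Real.rpow_add hw]; simp
    calc |f y| * ∫ s in (max r ‖y‖)..r₀, (s ^ (N - 1))⁻¹
        ≤ |f y| * ((max r ‖y‖ ^ (N - 2))⁻¹ / (N - 2)) := by
          gcongr
          exact integral_inv_pow_le hN hm (max_le hrr hy1.le)
      _ = ((N : ℝ) - 2)⁻¹ * (|f y| * (max r ‖y‖ ^ (N - 2))⁻¹ * 1) := by ring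
      _ = ((N : ℝ) - 2)⁻¹ * (|f y| * (max r ‖y‖ ^ (N - 2))⁻¹ *
            (weight N β χ y ^ (1 / ((N : ℝ) / 2)) *
              weight N β χ y ^ (-(1 / ((N : ℝ) / 2))))) := by rw [hww]
      _ = _ := by ring
  refine (enorm_integral_le_lintegral_enorm _).trans ((lintegral_mono_ae hae).trans ?_)
  have hwm := aemeasurable_weight (N := N) β χ hr₀
  have hm1 : AEMeasurable (fun y => ENNReal.ofReal (weight N β χ y ^ (1 / ((N : ℝ) / 2)) * |f y|))
      (volume.restrict (Metric.ball (0 : Rn N) r₀)) :=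
    ((hwm.pow_const _).mul hf.aemeasurable.abs).ennreal_ofReal
  have hm2 : AEMeasurable (fun y => ENNReal.ofReal (weight N β χ y ^ (-(1 / ((N : ℝ) / 2))) *
      (max r ‖y‖ ^ (N - 2))⁻¹)) (volume.restrict (Metric.ball (0 : Rn N) r₀)) :=
    ((hwm.pow_const _).mul (by fun_prop)).ennreal_ofReal
  rw [lintegral_const_mul' _ _ ENNReal.ofReal_ne_top,
    ENNReal.ofReal_mul (inv_nonneg.2 (by linarith))]
  gcongr
  refine (ENNReal.lintegral_mul_le_Lp_mul_Lq _ hpq hm1 hm2).trans ?_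
  rw [hBd, ENNReal.ofReal_mul (by positivity)]
  have hp0 : (0 : ℝ) ≤ 1 / ((N : ℝ) / 2) := by positivity
  have hq0 : (0 : ℝ) ≤ 1 / ((N : ℝ) / (N - 2)) := hpq.symm.one_div_nonneg
  gcongr
  · rw [← ENNReal.ofReal_rpow_of_nonneg ENNReal.toReal_nonneg hp0, ENNReal.ofReal_toReal hA.ne]
    refine ENNReal.rpow_le_rpow (le_of_eq ?_) hp0
    refine setLIntegral_congr_fun_ae Metric.isOpen_ball.measurableSet ?_
    filter_upwards [compl_mem_ae_iff.2 (measure_singleton (0 : Rn N))] with y hy0 hy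
    have hy1 : ‖y‖ < r₀ := by simpa using hy
    have hy0 : 0 < ‖y‖ := norm_pos_iff.2 (by simpa using hy0)
    have hw : 0 < weight N β χ y := by
      rw [weight_of_mem (hy1.trans_le hr₀)]
      have := one_le_ell hy0 (hy1.le.trans hr₀)
      positivity
    rw [ENNReal.ofReal_rpow_of_nonneg (by positivity) hpq.nonneg,
      Real.mul_rpow (by positivity) (abs_nonneg _), ← Real.rpow_mul hw.le,
      one_div_mul_cancel hpq.ne_zero, Real.rpow_one]
  · rw [← ENNReal.ofReal_rpow_of_nonneg (mul_nonneg hS.le hT) hq0]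
    refine ENNReal.rpow_le_rpow (le_trans ?_ (lintegral_dual_le hN0 hβ0 hβ1 hr (hrr.trans hr₀)))
      hq0
    refine le_trans (lintegral_mono_ae ?_)
      (lintegral_mono_set (Metric.ball_subset_ball hr₀))
    rw [ae_restrict_iff' Metric.isOpen_ball.measurableSet]
    filter_upwards [compl_mem_ae_iff.2 (measure_singleton (0 : Rn N))] with y hy0 hy
    have hy1 : ‖y‖ < r₀ := by simpa using hy
    have hy0 : 0 < ‖y‖ := norm_pos_iff.2 (by simpa using hy0)
    have hℓ := one_le_ell hy0 (hy1.le.trans hr₀)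
    have hm : 0 < max r ‖y‖ := hr.trans_le (le_max_left _ _)
    rw [weight_of_mem (hy1.trans_le hr₀),
      ENNReal.ofReal_rpow_of_nonneg (by positivity) hpq.symm.nonneg,
      Real.mul_rpow (by positivity) (by positivity), ← Real.rpow_mul (by positivity),
      ← Real.rpow_mul (by positivity), Real.inv_rpow (by positivity), ← Real.rpow_natCast,
      ← Real.rpow_mul hm.le, ← Real.rpow_natCast]
    refine le_of_eq ?_
    have h2 : (N : ℝ) - 2 ≠ 0 := by linarith
    -- The dual exponent turns w^{-2/N} into ℓ^{-β} and max^{2-N} into max^{-N}, the integrand of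
    -- `lintegral_dual_le`.
    rw [show β * ((N : ℝ) / 2 - 1) * (-(1 / ((N : ℝ) / 2)) * ((N : ℝ) / (N - 2))) = -β by
      field_simp, show ((N - 2 : ℕ) : ℝ) * ((N : ℝ) / (N - 2)) = N by
      rw [Nat.cast_sub (by omega)]; push_cast; field_simp]

/-! ### The critical constant and the critical exponent -/

theorem alphaCrit_pos {N : ℕ} (hN : 3 ≤ N) {β : ℝ} (hβ1 : β < 1) : 0 < alphaCrit N β := by
  have hN' : (3 : ℝ) ≤ N := by exact_mod_cast hN
  have h1 : (0 : ℝ) < N - 2 := by linarith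
  have h2 : 0 < 1 - β := by linarith
  have h3 := ballVolume_pos N
  unfold alphaCrit
  positivity

theorem gammaExp_pos {N : ℕ} (hN : 3 ≤ N) {β : ℝ} (hβ1 : β < 1) : 0 < gammaExp N β := by
  have hN' : (3 : ℝ) ≤ N := by exact_mod_cast hN
  have h1 : (0 : ℝ) < N - 2 := by linarith
  have h2 : 0 < 1 - β := by linarith
  unfold gammaExp
  positivity

/-- The constant `alphaCrit` is the normalization that turns the sharp pointwise bound into an
identity. -/
theorem alphaCrit_mul_rpow {N : ℕ} (hN : 3 ≤ N) {β : ℝ} (hβ1 : β < 1) {a T : ℝ} (ha : 0 ≤ a)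
    (hT : 0 ≤ T) :
    alphaCrit N β * ((sphereArea N)⁻¹ * ((N : ℝ) - 2)⁻¹ * (a ^ (1 / ((N : ℝ) / 2)) *
      (sphereArea N * T) ^ (1 / ((N : ℝ) / (N - 2))))) ^ gammaExp N β =
    N * a ^ (2 / (((N : ℝ) - 2) * (1 - β))) * ((1 - β) * T) ^ (1 / (1 - β)) := by
  have hN' : (3 : ℝ) ≤ N := by exact_mod_cast hN
  have h1 : (0 : ℝ) < N - 2 := by linarith
  have h2 : 0 < 1 - β := by linarith
  have hS := sphereArea_pos (show 0 < N by omega)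
  unfold alphaCrit gammaExp
  rw [← sphereArea]
  set S := sphereArea N
  set n := (N : ℝ)
  set m := n - 2 with hm
  have hn : n ≠ 0 := by linarith
  rw [Real.mul_rpow (by positivity) (by positivity), Real.mul_rpow (by positivity) (by positivity),
    Real.mul_rpow (by positivity) (by positivity), Real.mul_rpow (by positivity) (by positivity),
    Real.mul_rpow (by positivity) (by positivity), Real.mul_rpow (by positivity) (by positivity),
    Real.mul_rpow (by positivity) (by positivity),
    ← Real.rpow_mul ha, ← Real.rpow_mul h1.le, ← Real.rpow_mul hS.le, ← Real.rpow_mul hT,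
    Real.inv_rpow hS.le, Real.inv_rpow h1.le]
  have e1 : n / 2 * (2 / (m * (1 - β))) = n / (m * (1 - β)) := by field_simp
  have e2 : 1 / (n / 2) * (n / (m * (1 - β))) = 2 / (m * (1 - β)) := by field_simp
  have e3 : 1 / (n / m) * (n / (m * (1 - β))) = 1 / (1 - β) := by field_simp
  rw [e1, e2, e3]
  -- From n = 2 + m, the factor S^{-γ} cancels against one power of S in the constant and one from
  -- the dual integral.
  have e4 : S ^ (n / (m * (1 - β))) = S ^ (2 / (m * (1 - β))) * S ^ (1 / (1 - β)) := by
    rw [← Real.rpow_add hS]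
    congr 1
    have : n = 2 + m := by linarith
    rw [this]
    field_simp
  rw [e4]
  field_simp

/-- Here (1-β)T = ℓ^{1-β} - 1 + (1-β)ℓ^{-β}/N, and the last term is at most 1/4 because N ≥ 4; hence
(1-β)T ≤ ℓ^{1-β}(1 - (3/4)ℓ^{β-1}). Raising a number of [0,1] to the power 1/(1-β) ≥ 1 only
decreases it. The gain (3/4)ℓ^β is what makes the critical exponential integrable. -/
theorem rpow_dualMass_le {N : ℕ} (hN : 4 ≤ N) {β : ℝ} (hβ0 : 0 ≤ β) (hβ1 : β < 1) {r : ℝ}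
    (hr : 0 < r) (hr1 : r ≤ 1) :
    ((1 - β) * dualMass N β r) ^ (1 / (1 - β)) ≤ ell r - 3 / 4 * ell r ^ β := by
  have hN' : (4 : ℝ) ≤ N := by exact_mod_cast hN
  have h2 : 0 < 1 - β := by linarith
  have hℓ := one_le_ell hr hr1
  set ℓ := ell r
  have hℓ0 : 0 < ℓ := by linarith
  have hTn := dualMass_nonneg (N := N) hβ1 hr hr1
  have ha : ℓ ^ (β - 1) ≤ 1 := Real.rpow_le_one_of_one_le_of_nonpos hℓ (by linarith)
  have ha0 : 0 < ℓ ^ (β - 1) := by positivity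
  have hmul : ℓ ^ (1 - β) * ℓ ^ (β - 1) = 1 := by
    rw [← Real.rpow_add hℓ0]; simp
  have h3 : (1 - β) * dualMass N β r ≤ ℓ ^ (1 - β) * (1 - 3 / 4 * ℓ ^ (β - 1)) := by
    have e : (1 - β) * dualMass N β r = ℓ ^ (1 - β) - 1 + (1 - β) * ℓ ^ (-β) / N := by
      rw [show dualMass N β r = (ℓ ^ (1 - β) - 1) / (1 - β) + ℓ ^ (-β) / N from rfl]
      field_simp
    have h5 : ℓ ^ (-β) ≤ 1 := Real.rpow_le_one_of_one_le_of_nonpos hℓ (by linarith)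
    have h6 : (1 - β) * ℓ ^ (-β) / N ≤ 1 / 4 := by
      rw [div_le_div_iff₀ (by linarith) (by norm_num)]
      nlinarith [Real.rpow_nonneg hℓ0.le (-β)]
    rw [e]
    nlinarith
  have h7 : 1 ≤ 1 / (1 - β) := by rw [le_div_iff₀ h2]; linarith
  calc ((1 - β) * dualMass N β r) ^ (1 / (1 - β))
      ≤ (ℓ ^ (1 - β) * (1 - 3 / 4 * ℓ ^ (β - 1))) ^ (1 / (1 - β)) :=
        Real.rpow_le_rpow (by positivity) h3 (by positivity)
    _ = ℓ * (1 - 3 / 4 * ℓ ^ (β - 1)) ^ (1 / (1 - β)) := by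
        rw [Real.mul_rpow (by positivity) (by linarith), ← Real.rpow_mul hℓ0.le,
          mul_one_div_cancel h2.ne', Real.rpow_one]
    _ ≤ ℓ * (1 - 3 / 4 * ℓ ^ (β - 1)) := by
        gcongr
        exact Real.rpow_le_self_of_le_one (by linarith) (by linarith) h7
    _ = ℓ - 3 / 4 * ℓ ^ β := by
        have : ℓ ^ β = ℓ * ℓ ^ (β - 1) := by
          rw [Real.rpow_sub_one hℓ0.ne']; field_simp
        rw [this]; ring

/-- The exponent `N (ell - (3/4) ell^β)` that controls critical functions. -/
noncomputable def critExponent (N : ℕ) (β r : ℝ) : ℝ := N * (ell r - 3 / 4 * ell r ^ β)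

theorem critExponent_nonneg {N : ℕ} {β : ℝ} (hβ1 : β < 1) {r : ℝ}
    (hr : 0 < r) (hr1 : r ≤ 1) : 0 ≤ critExponent N β r := by
  have hℓ := one_le_ell hr hr1
  have : ell r ^ β ≤ ell r := by
    simpa using Real.rpow_le_rpow_of_exponent_le hℓ hβ1.le
  unfold critExponent
  exact mul_nonneg (Nat.cast_nonneg _) (by linarith)

/-- The sharp increment estimate in the form used afterwards. The energy enters through a power
equal to one when A = 1, so the critical exponent is reached without loss at unit energy. -/
theorem alphaCrit_mul_flux_rpow_le {N : ℕ} (hN : 4 ≤ N) {β : ℝ} (hβ0 : 0 ≤ β) (hβ1 : β < 1)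
    {χ : ℝ → ℝ} {f : Rn N → ℝ} {r r₀ : ℝ} (hr : 0 < r) (hrr : r ≤ r₀) (hr₀ : r₀ ≤ 1)
    (hf : IntegrableOn f (Metric.ball 0 r₀)) {A : ℝ} (hA0 : 0 ≤ A)
    (hA : ∫⁻ x in Metric.ball 0 r₀,
      ENNReal.ofReal (weight N β χ x * |f x| ^ ((N : ℝ) / 2)) ≤ ENNReal.ofReal A) :
    alphaCrit N β * |∫ s in r..r₀, flux f s| ^ gammaExp N β ≤
      A ^ (2 / (((N : ℝ) - 2) * (1 - β))) * critExponent N β r := by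
  have hN' : (4 : ℝ) ≤ N := by exact_mod_cast hN
  have h2 : 0 < 1 - β := by linarith
  have h1 : (0 : ℝ) < N - 2 := by linarith
  have hN3 : 3 ≤ N := by omega
  have hr1 := hrr.trans hr₀
  have hT := dualMass_nonneg (N := N) hβ1 hr hr1
  have hα := alphaCrit_pos hN3 hβ1
  have hA' := hA.trans_lt ENNReal.ofReal_lt_top
  have hb := abs_integral_flux_le hN3 hβ0 hβ1 hr hrr hr₀ hf hA'
  have hAr := ENNReal.toReal_le_of_le_ofReal hA0 hA
  refine (mul_le_mul_of_nonneg_left (Real.rpow_le_rpow (abs_nonneg _) hb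
    (gammaExp_pos hN3 hβ1).le) hα.le).trans ?_
  rw [alphaCrit_mul_rpow hN3 hβ1 ENNReal.toReal_nonneg hT]
  have h3 := rpow_dualMass_le hN hβ0 hβ1 hr hr1
  have h4 : 0 ≤ ((1 - β) * dualMass N β r) ^ (1 / (1 - β)) := by positivity
  rw [mul_comm (N : ℝ), mul_assoc]
  unfold critExponent
  gcongr

/-! ### Integrability of the critical exponential -/

/-- The exponential of cℓ^β dominates its n-th Taylor term, and n is taken with βn ≥ 2. -/
theorem exists_exp_neg_rpow_le {c β : ℝ} (hc : 0 < c) (hβ0 : 0 < β) :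
    ∃ C : ℝ, 0 ≤ C ∧ ∀ ℓ : ℝ, 1 ≤ ℓ → Real.exp (-(c * ℓ ^ β)) ≤ C * (ℓ ^ 2)⁻¹ := by
  obtain ⟨n, hn⟩ := exists_nat_ge (2 / β)
  have hn' : 2 ≤ β * n := by
    rw [div_le_iff₀ hβ0] at hn
    linarith
  refine ⟨n.factorial / c ^ n, by positivity, fun ℓ hℓ => ?_⟩
  have hℓ0 : 0 < ℓ := by linarith
  have h1 := Real.pow_div_factorial_le_exp (c * ℓ ^ β) (by positivity) n
  have h2 : ℓ ^ 2 ≤ (ℓ ^ β) ^ n := by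
    rw [← Real.rpow_natCast, ← Real.rpow_natCast, ← Real.rpow_mul hℓ0.le]
    exact Real.rpow_le_rpow_of_exponent_le hℓ (by exact_mod_cast hn')
  rw [Real.exp_neg]
  have h3 : c ^ n * ℓ ^ 2 / n.factorial ≤ Real.exp (c * ℓ ^ β) := by
    refine le_trans ?_ h1
    rw [mul_pow]
    gcongr
  have h4 : (n.factorial / c ^ n) * (ℓ ^ 2)⁻¹ = (c ^ n * ℓ ^ 2 / n.factorial)⁻¹ := by
    field_simp
  rw [h4]
  exact inv_anti₀ (by positivity) h3

/-- The integrand is the derivative of 1/ℓ, which stays bounded up to the origin. -/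
theorem integrableOn_inv_mul_ell_sq_inv :
    IntegrableOn (fun r : ℝ => r⁻¹ * (ell r ^ 2)⁻¹) (Ioc 0 1) := by
  refine intervalIntegral.integrableOn_deriv_of_nonneg (g := fun r => (ell r)⁻¹) ?_ ?_ ?_
  · intro r hr
    rcases hr.1.eq_or_lt with h0 | h0
    · subst h0
      have h1 : Tendsto (fun r => (1 - Real.log r)⁻¹) (𝓝[>] 0) (𝓝 0) := by
        refine tendsto_inv_atTop_zero.comp ?_
        exact tendsto_atTop_add_const_left _ _
          (tendsto_neg_atBot_atTop.comp Real.tendsto_log_nhdsGT_zero)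
      have h2 : Tendsto (fun r => (ell r)⁻¹) (𝓝[>] 0) (𝓝 0) := by
        refine h1.congr' ?_
        filter_upwards [self_mem_nhdsWithin] with r hr
        rw [ell_eq hr]
      -- With the conventions for division by zero and `Real.log 0`, the value of 1/ℓ at zero is
      -- zero, which is also its limit.
      have h3 : ContinuousWithinAt (fun r => (ell r)⁻¹) (Ioi 0) 0 := by
        rw [ContinuousWithinAt]
        simpa [ell] using h2
      exact (continuousWithinAt_Ioi_iff_Ici.1 h3).mono fun x hx => hx.1
    · have := one_le_ell h0 hr.2
      exact ((hasDerivAt_ell h0).continuousAt.inv₀ (by linarith)).continuousWithinAt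
  · intro r hr
    have := one_le_ell hr.1 hr.2.le
    have h := (hasDerivAt_ell hr.1).inv (show ell r ≠ 0 by linarith)
    refine h.congr_deriv ?_
    rw [neg_neg, div_eq_mul_inv]
  · intro r hr
    have := one_le_ell hr.1 hr.2.le
    have := hr.1
    positivity

/-- The factor e^{Nℓ} = e^N |x|^{-N} is just not integrable; the gain exp(-(3N/4)ℓ^β) ≤ Cℓ^{-2}
leaves the radial density 1/(rℓ²). -/
theorem lintegral_exp_critExponent_lt_top {N : ℕ} (hN : 0 < N) {β : ℝ} (hβ0 : 0 < β) :
    ∫⁻ x in unitBall N, ENNReal.ofReal (Real.exp (critExponent N β ‖x‖)) < ⊤ := by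
  have hN0 : (0 : ℝ) < N := by exact_mod_cast hN
  have : Nonempty (Fin N) := ⟨⟨0, hN⟩⟩
  obtain ⟨C, hC0, hC⟩ := exists_exp_neg_rpow_le (c := N * (3 / 4)) (by positivity) hβ0
  set k : ℝ → ℝ := (Ioc 0 1).indicator fun r =>
    Real.exp N * C * ((r ^ N)⁻¹ * (ell r ^ 2)⁻¹) with hk
  have hk0 : ∀ r, 0 ≤ r → 0 ≤ k r := fun r _ => indicator_nonneg (fun s hs => by
    have := hs.1
    positivity) r
  have hi : IntegrableOn (fun y : ℝ => y ^ (N - 1) * k y) (Ioi 0) := by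
    have e : ∀ y : ℝ, y ^ (N - 1) * k y =
        (Ioc 0 1).indicator (fun r => Real.exp N * C * (r⁻¹ * (ell r ^ 2)⁻¹)) y := fun y => by
      by_cases hy : y ∈ Ioc (0 : ℝ) 1
      · simp only [hk, indicator_of_mem hy]
        have := hy.1.ne'
        obtain ⟨n, rfl⟩ : ∃ n, N = n + 1 := ⟨N - 1, by omega⟩
        have h1 := one_le_ell hy.1 hy.2
        have : ell y ≠ 0 := by linarith
        simp only [Nat.add_sub_cancel]
        field_simp
        ring
      · simp only [hk, indicator_of_notMem hy, mul_zero]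
    simp_rw [e]
    refine Integrable.integrableOn ?_
    rw [integrable_indicator_iff measurableSet_Ioc]
    exact integrableOn_inv_mul_ell_sq_inv.const_mul _
  calc ∫⁻ x in unitBall N, ENNReal.ofReal (Real.exp (critExponent N β ‖x‖))
      ≤ ∫⁻ x in unitBall N, ENNReal.ofReal (k ‖x‖) := by
        refine lintegral_mono_ae ?_
        rw [unitBall, ae_restrict_iff' Metric.isOpen_ball.measurableSet]
        filter_upwards [compl_mem_ae_iff.2 (measure_singleton (0 : Rn N))] with x hx0 hx
        refine ENNReal.ofReal_le_ofReal ?_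
        have hx1 : ‖x‖ < 1 := by simpa using hx
        have hx0 : 0 < ‖x‖ := norm_pos_iff.2 (by simpa using hx0)
        have h1 := one_le_ell hx0 hx1.le
        rw [hk, indicator_of_mem (show ‖x‖ ∈ Ioc (0 : ℝ) 1 from ⟨hx0, hx1.le⟩)]
        have h2 : critExponent N β ‖x‖ = N + (-(N * Real.log ‖x‖)) +
            -(N * (3 / 4) * ell ‖x‖ ^ β) := by
          unfold critExponent
          rw [show N * (ell ‖x‖ - 3 / 4 * ell ‖x‖ ^ β) =
            N * ell ‖x‖ - N * (3 / 4) * ell ‖x‖ ^ β by ring]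
          nth_rewrite 1 [ell_eq hx0]
          ring
        have h3 : Real.exp (-(N * Real.log ‖x‖)) = (‖x‖ ^ N)⁻¹ := by
          rw [Real.exp_neg, ← Real.log_pow, Real.exp_log (by positivity)]
        rw [h2, Real.exp_add, Real.exp_add, h3]
        calc Real.exp N * (‖x‖ ^ N)⁻¹ * Real.exp (-(N * (3 / 4) * ell ‖x‖ ^ β))
            ≤ Real.exp N * (‖x‖ ^ N)⁻¹ * (C * (ell ‖x‖ ^ 2)⁻¹) := by
              gcongr
              exact hC _ h1
          _ = _ := by ring
    _ ≤ ∫⁻ x : Rn N, ENNReal.ofReal (k ‖x‖) := setLIntegral_le_lintegral _ _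
    _ < ⊤ := by
        rw [lintegral_radial hN hk0 hi]
        exact ENNReal.ofReal_lt_top

/-! ### Boundedness away from the origin -/

theorem volume_ball_eq {N : ℕ} (hN : 0 < N) {r : ℝ} (hr : 0 ≤ r) :
    volume (Metric.ball (0 : Rn N) r) = ENNReal.ofReal (r ^ N * ballVolume N) := by
  have : Nonempty (Fin N) := ⟨⟨0, hN⟩⟩
  rw [Measure.addHaar_ball volume _ hr, ENNReal.ofReal_mul (by positivity), ballVolume, unitBall,
    ENNReal.ofReal_toReal measure_ball_lt_top.ne]
  simp

/-- Hölder against the constant one; the volume enters with power (N-2)/N, hence s^{N-2}. The flux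
is therefore O(1/s), whose integral over a dyadic interval is bounded uniformly in its position. -/
theorem abs_ballMass_le {N : ℕ} (hN : 3 ≤ N) {f : Rn N → ℝ} (hf : LocallyIntegrable f)
    {A : ℝ} (hA0 : 0 ≤ A)
    (hA : ∫⁻ x, ENNReal.ofReal (|f x| ^ ((N : ℝ) / 2)) ≤ ENNReal.ofReal A) {s : ℝ}
    (hs : 0 < s) :
    |ballMass f s| ≤ A ^ (1 / ((N : ℝ) / 2)) *
      (ballVolume N ^ (1 / ((N : ℝ) / (N - 2))) * s ^ (N - 2)) := by
  have hN0 : 0 < N := by omega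
  have hN' : (3 : ℝ) ≤ N := by exact_mod_cast hN
  have hpq := holderConjugate_half hN
  have hp0 : (0 : ℝ) ≤ 1 / ((N : ℝ) / 2) := by positivity
  have hq0 : (0 : ℝ) ≤ 1 / ((N : ℝ) / (N - 2)) := hpq.symm.one_div_nonneg
  have hV := ballVolume_pos N
  rw [← ENNReal.ofReal_le_ofReal_iff (by positivity), ← Real.norm_eq_abs, ofReal_norm,
    ENNReal.ofReal_mul (by positivity)]
  refine (enorm_integral_le_lintegral_enorm _).trans ?_
  have h := ENNReal.lintegral_mul_le_Lp_mul_Lq (volume.restrict (Metric.ball (0 : Rn N) s)) hpq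
    (f := fun y => ‖f y‖ₑ) (g := fun _ => 1)
    (LocallyIntegrable.integrableOn_ball hf s).aestronglyMeasurable.enorm aemeasurable_const
  simp only [Pi.mul_apply, mul_one, ENNReal.one_rpow, lintegral_const, one_mul,
    Measure.restrict_apply_univ] at h
  refine h.trans ?_
  rw [volume_ball_eq hN0 hs.le]
  gcongr
  · rw [← ENNReal.ofReal_rpow_of_nonneg hA0 hp0]
    refine ENNReal.rpow_le_rpow (le_trans ?_ hA) hp0
    refine (setLIntegral_le_lintegral _ _).trans (lintegral_mono fun y => le_of_eq ?_)
    simp only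
    rw [← ofReal_norm, ENNReal.ofReal_rpow_of_nonneg (norm_nonneg _) hpq.nonneg,
      Real.norm_eq_abs]
  · rw [ENNReal.ofReal_rpow_of_nonneg (by positivity) hq0]
    refine ENNReal.ofReal_le_ofReal (le_of_eq ?_)
    rw [Real.mul_rpow (by positivity) hV.le, mul_comm, ← Real.rpow_natCast, ← Real.rpow_natCast,
      ← Real.rpow_mul hs.le]
    congr 2
    have : (N : ℝ) - 2 ≠ 0 := by linarith
    rw [Nat.cast_sub (by omega)]
    push_cast
    field_simp

/-- Radial functions in `L^{N/2}` with Laplacian in `L^{N/2}` are bounded away from the origin. -/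
theorem exists_outer_bound {N : ℕ} (hN : 3 ≤ N) {A r₀ : ℝ} (hA0 : 0 ≤ A) (hr₀ : 0 < r₀) :
    ∃ C : ℝ, 0 ≤ C ∧ ∀ (u f : Rn N → ℝ) (c : ℝ), LocallyIntegrable f →
      (∀ᵐ x, u x = c + ∫ s in (1 : ℝ)..‖x‖, flux f s) →
      ∫⁻ x, ENNReal.ofReal (|f x| ^ ((N : ℝ) / 2)) ≤ ENNReal.ofReal A →
      ∫⁻ x, ENNReal.ofReal (|u x| ^ ((N : ℝ) / 2)) ≤ ENNReal.ofReal A →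
      ∀ r, r₀ ≤ r → |c + ∫ s in (1 : ℝ)..r, flux f s| ≤ C := by
  have hN0 : 0 < N := by omega
  have hN' : (3 : ℝ) ≤ N := by exact_mod_cast hN
  have hV := ballVolume_pos N
  have hS := sphereArea_pos hN0
  -- K bounds the oscillation of u on any annulus r ≤ |x| < 2r. L is the largest constant whose
  -- modulus to the power N/2, over a set of volume r₀^N V_N, has integral at most A.
  set K : ℝ := A ^ (1 / ((N : ℝ) / 2)) * ballVolume N ^ (1 / ((N : ℝ) / (N - 2))) / sphereArea N
    with hK
  have hK0 : 0 ≤ K := by positivity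
  set L : ℝ := (A / (r₀ ^ N * ballVolume N)) ^ (1 / ((N : ℝ) / 2)) with hL
  have hL0 : 0 ≤ L := by positivity
  refine ⟨K + L, by positivity, fun u f c hf hu hfA huA r hr => ?_⟩
  have hr0 : 0 < r := hr₀.trans_le hr
  have hfl : ∀ s, 0 < s → |flux f s| ≤ K / s := by
    intro s hs
    rw [flux, abs_div, abs_of_pos (show 0 < sphereArea N * s ^ (N - 1) by positivity),
      div_le_div_iff₀ (by positivity) hs]
    have h1 := abs_ballMass_le hN hf hA0 hfA hs
    calc |ballMass f s| * s ≤ A ^ (1 / ((N : ℝ) / 2)) *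
          (ballVolume N ^ (1 / ((N : ℝ) / (N - 2))) * s ^ (N - 2)) * s := by gcongr
      _ = K * (sphereArea N * s ^ (N - 1)) := by
        rw [hK, show N - 1 = N - 2 + 1 by omega, pow_succ]
        field_simp
  have hfc := continuousOn_flux hN0 hf
  have hint : ∀ a b : ℝ, 0 < a → 0 < b → IntervalIntegrable (flux f) volume a b :=
    fun a b ha hb =>
      (hfc.mono fun x hx => (lt_min ha hb).trans_le hx.1).intervalIntegrable
  set M := |c + ∫ s in (1 : ℝ)..r, flux f s| with hM
  by_contra hcon
  rw [not_le] at hcon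
  have hML : L < M - K := by linarith
  -- If the value M at radius r exceeded K + L, then |u| ≥ M - K > L on the whole annulus,
  -- contradicting the L^{N/2} bound.
  have hlow : ∀ᵐ x : Rn N, x ∈ Metric.ball 0 (2 * r) \ Metric.ball 0 r → M - K ≤ |u x| := by
    filter_upwards [hu] with x hx hx2
    have h1 : r ≤ ‖x‖ := by simpa using hx2.2
    have h2 : ‖x‖ < 2 * r := by simpa using hx2.1
    have h3 : |∫ s in r..‖x‖, flux f s| ≤ K := by
      have := intervalIntegral.norm_integral_le_of_norm_le_const (a := r) (b := ‖x‖)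
        (f := flux f) (C := K / r) fun s hs => by
          rw [uIoc_of_le h1] at hs
          refine (hfl s (hr0.trans hs.1)).trans ?_
          gcongr
          exact hs.1.le
      rw [Real.norm_eq_abs, abs_of_nonneg (sub_nonneg.2 h1)] at this
      refine this.trans ?_
      rw [div_mul_eq_mul_div, div_le_iff₀ hr0]
      gcongr
      linarith
    rw [hx, ← intervalIntegral.integral_add_adjacent_intervals (hint 1 r one_pos hr0)
      (hint r ‖x‖ hr0 (hr0.trans_le h1)), ← add_assoc]
    have := abs_sub_abs_le_abs_sub (c + ∫ s in (1 : ℝ)..r, flux f s)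
      (-∫ s in r..‖x‖, flux f s)
    rw [abs_neg, sub_neg_eq_add] at this
    linarith
  -- The annulus has volume (2^N - 1) r^N V_N, which is at least r₀^N V_N for r ≥ r₀.
  have hvol : ENNReal.ofReal (r₀ ^ N * ballVolume N) ≤
      volume (Metric.ball (0 : Rn N) (2 * r) \ Metric.ball 0 r) := by
    rw [measure_sdiff (Metric.ball_subset_ball (by linarith))
      Metric.isOpen_ball.measurableSet.nullMeasurableSet measure_ball_lt_top.ne,
      volume_ball_eq hN0 hr0.le, volume_ball_eq hN0 (by linarith),
      ← ENNReal.ofReal_sub _ (by positivity)]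
    refine ENNReal.ofReal_le_ofReal ?_
    have h2 : (2 : ℝ) ≤ 2 ^ N := by
      calc (2 : ℝ) = 2 ^ 1 := by norm_num
        _ ≤ 2 ^ N := pow_le_pow_right₀ (by norm_num) hN0
    have h1 : r₀ ^ N ≤ r ^ N := by gcongr
    rw [← sub_mul, mul_pow]
    gcongr
    nlinarith [pow_pos hr0 N]
  have hmain : ENNReal.ofReal ((M - K) ^ ((N : ℝ) / 2)) * ENNReal.ofReal (r₀ ^ N * ballVolume N)
      ≤ ENNReal.ofReal A := by
    refine le_trans (mul_le_mul_right hvol _) (le_trans ?_ huA)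
    rw [← setLIntegral_const]
    refine le_trans (lintegral_mono_ae ?_) (setLIntegral_le_lintegral _ _)
    rw [ae_restrict_iff' (Metric.isOpen_ball.measurableSet.diff Metric.isOpen_ball.measurableSet)]
    filter_upwards [hlow] with x hx hx2
    have := hx hx2
    refine ENNReal.ofReal_le_ofReal (Real.rpow_le_rpow (by linarith) this (by positivity))
  rw [← ENNReal.ofReal_mul (Real.rpow_nonneg (by linarith) _),
    ENNReal.ofReal_le_ofReal_iff hA0, ← le_div_iff₀ (by positivity)] at hmain
  have h5 : L ^ ((N : ℝ) / 2) < (M - K) ^ ((N : ℝ) / 2) :=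
    Real.rpow_lt_rpow hL0 hML (by positivity)
  rw [hL, ← Real.rpow_mul (by positivity), one_div_mul_cancel (by positivity),
    Real.rpow_one] at h5
  linarith

/-! ### Exponential integrability on E -/

theorem exp_sub_one_le_mul_exp (t : ℝ) : Real.exp t - 1 ≤ t * Real.exp t := by
  have h := Real.add_one_le_exp (-t)
  have h2 := mul_le_mul_of_nonneg_right h (Real.exp_pos t).le
  rw [← Real.exp_add, neg_add_cancel, Real.exp_zero] at h2
  linarith

/-- The lower bound on β says N(N-2)(1-β) < 2N - 2, while γ ≥ N/2 amounts to N(N-2)(1-β) ≤ 2N. It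
allows |u|^γ to be dominated by a multiple of |u|^{N/2} wherever u is bounded. -/
theorem half_le_gammaExp {N : ℕ} (hN : 4 ≤ N) {β : ℝ} (hβ1 : β < 1)
    (hβ : ((N : ℝ) ^ 2 - 4 * (N : ℝ) + 2) / ((N : ℝ) * ((N : ℝ) - 2)) < β) :
    (N : ℝ) / 2 ≤ gammaExp N β := by
  have hN' : (4 : ℝ) ≤ N := by exact_mod_cast hN
  have h1 : (0 : ℝ) < N - 2 := by linarith
  have h2 : 0 < 1 - β := by linarith
  rw [div_lt_iff₀ (by positivity)] at hβ
  rw [gammaExp, div_le_div_iff₀ (by norm_num) (by positivity)]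
  have h3 : (N : ℝ) * ((N - 2) * (1 - β)) ≤ 2 * N - 2 := by nlinarith
  nlinarith

/-- Exponential integrability from a bound near the origin by the critical exponent and
boundedness elsewhere. -/
theorem lintegral_exp_le {N : ℕ} {β : ℝ} (hγ : (N : ℝ) / 2 ≤ gammaExp N β) (hN : 0 < N)
    {α r₀ C C' : ℝ} (hr₀ : r₀ ≤ 1) (hα : 0 ≤ α) (hC : 0 ≤ C) {u : Rn N → ℝ}
    (hout : ∀ᵐ x, r₀ ≤ ‖x‖ → |u x| ≤ C)
    (hin : ∀ᵐ x, ‖x‖ < r₀ → α * |u x| ^ gammaExp N β ≤ critExponent N β ‖x‖ + C') :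
    ∫⁻ x, ENNReal.ofReal (Real.exp (α * |u x| ^ gammaExp N β) - 1) ≤
      ENNReal.ofReal (Real.exp C') *
        (∫⁻ x in unitBall N, ENNReal.ofReal (Real.exp (critExponent N β ‖x‖))) +
      ENNReal.ofReal (α * C ^ (gammaExp N β - (N : ℝ) / 2) *
        Real.exp (α * C ^ gammaExp N β)) * ∫⁻ x, ENNReal.ofReal (|u x| ^ ((N : ℝ) / 2)) := by
  have hN0 : (0 : ℝ) < N := by exact_mod_cast hN
  have hγ0 : 0 < gammaExp N β := by linarith [half_pos hN0]
  rw [← lintegral_add_compl (μ := volume) _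
    (Metric.isOpen_ball (x := (0 : Rn N)) (ε := r₀)).measurableSet]
  gcongr
  · rw [← lintegral_const_mul' _ _ ENNReal.ofReal_ne_top]
    refine le_trans (lintegral_mono_ae ?_)
      (lintegral_mono_set (Metric.ball_subset_ball hr₀))
    rw [ae_restrict_iff' Metric.isOpen_ball.measurableSet]
    filter_upwards [hin] with x hx hx1
    rw [← ENNReal.ofReal_mul (Real.exp_pos _).le, ← Real.exp_add, add_comm C']
    refine ENNReal.ofReal_le_ofReal ?_
    have := Real.exp_le_exp.2 (hx (by simpa using hx1))
    linarith
  · rw [← lintegral_const_mul' _ _ ENNReal.ofReal_ne_top]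
    refine le_trans (lintegral_mono_ae ?_) (setLIntegral_le_lintegral _ _)
    rw [ae_restrict_iff' Metric.isOpen_ball.measurableSet.compl]
    filter_upwards [hout] with x hx hx1
    have hxC := hx (by simpa using hx1)
    rw [← ENNReal.ofReal_mul (by positivity)]
    refine ENNReal.ofReal_le_ofReal ((exp_sub_one_le_mul_exp _).trans ?_)
    have h1 : |u x| ^ gammaExp N β ≤ C ^ (gammaExp N β - (N : ℝ) / 2) * |u x| ^ ((N : ℝ) / 2) := by
      rcases (abs_nonneg (u x)).eq_or_lt with h | h
      · rw [← h, Real.zero_rpow hγ0.ne']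
        positivity
      · calc |u x| ^ gammaExp N β
            = |u x| ^ (gammaExp N β - (N : ℝ) / 2) * |u x| ^ ((N : ℝ) / 2) := by
              rw [← Real.rpow_add h]; simp
          _ ≤ _ := by
              gcongr
    have h2 : Real.exp (α * |u x| ^ gammaExp N β) ≤ Real.exp (α * C ^ gammaExp N β) := by
      gcongr
    calc α * |u x| ^ gammaExp N β * Real.exp (α * |u x| ^ gammaExp N β)
        ≤ α * (C ^ (gammaExp N β - (N : ℝ) / 2) * |u x| ^ ((N : ℝ) / 2)) *
            Real.exp (α * C ^ gammaExp N β) := by gcongr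
      _ = _ := by ring

/-- Either C ≤ δz, and C + z ≤ (1+δ)z, or z ≤ C/δ, and the sum is bounded. An additive constant thus
costs only a factor as close to one as desired. -/
theorem add_rpow_le {γ δ C z : ℝ} (hγ : 0 ≤ γ) (hδ : 0 < δ) (hC : 0 ≤ C) (hz : 0 ≤ z) :
    (C + z) ^ γ ≤ (1 + δ) ^ γ * z ^ γ + (C * (1 + δ⁻¹)) ^ γ := by
  rcases le_total C (δ * z) with h | h
  · have : (C + z) ^ γ ≤ ((1 + δ) * z) ^ γ :=
      Real.rpow_le_rpow (by positivity) (by linarith) hγ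
    rw [Real.mul_rpow (by positivity) hz] at this
    have : 0 ≤ (C * (1 + δ⁻¹)) ^ γ := by positivity
    linarith
  · have h1 : z ≤ C * δ⁻¹ := by
      rw [← div_eq_mul_inv, le_div_iff₀ hδ]; linarith
    have : (C + z) ^ γ ≤ (C * (1 + δ⁻¹)) ^ γ :=
      Real.rpow_le_rpow (by positivity) (by linarith) hγ
    have : 0 ≤ (1 + δ) ^ γ * z ^ γ := by positivity
    linarith

theorem intervalIntegrable_flux {N : ℕ} (hN : 0 < N) {f : Rn N → ℝ} (hf : LocallyIntegrable f)
    {a b : ℝ} (ha : 0 < a) (hb : 0 < b) : IntervalIntegrable (flux f) volume a b :=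
  ((continuousOn_flux hN hf).mono fun _ hx => (lt_min ha hb).trans_le hx.1).intervalIntegrable

theorem beta_pos {N : ℕ} (hN : 4 ≤ N) {β : ℝ}
    (hβ : ((N : ℝ) ^ 2 - 4 * (N : ℝ) + 2) / ((N : ℝ) * ((N : ℝ) - 2)) < β) : 0 < β := by
  have hN' : (4 : ℝ) ≤ N := by exact_mod_cast hN
  refine lt_of_le_of_lt (div_nonneg (by nlinarith) (by nlinarith)) hβ

theorem lintegral_rpow_le_energy {N : ℕ} (hN : 4 ≤ N) {β : ℝ} (hβ0 : 0 ≤ β) {χ : ℝ → ℝ}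
    (hχ : ∀ t, 1 ≤ t → 1 ≤ χ t) (u : Rn N → ℝ) :
    ∫⁻ x, ENNReal.ofReal (|weakLaplacian univ u x| ^ ((N : ℝ) / 2)) ≤ energy N β χ u := by
  have : Nonempty (Fin N) := ⟨⟨0, by omega⟩⟩
  have h : ∫⁻ x, ENNReal.ofReal (|weakLaplacian univ u x| ^ ((N : ℝ) / 2)) ≤
      ∫⁻ x, ENNReal.ofReal (weight N β χ x * |weakLaplacian univ u x| ^ ((N : ℝ) / 2)) := by
    refine lintegral_mono_ae ?_
    filter_upwards [compl_mem_ae_iff.2 (measure_singleton (0 : Rn N))] with x hx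
    refine ENNReal.ofReal_le_ofReal (le_mul_of_one_le_left (by positivity) ?_)
    exact one_le_weight (by omega) hβ0 hχ (by simpa using hx)
  unfold energy
  rw [add_assoc]
  exact h.trans le_self_add

/-- The common source of the bounds on E. Near the origin |u| is at most an outer bound plus the
increment of the flux, and the condition on α is exactly what the factor (1+δ)^γ and the local
energy ε leave of the critical constant. For a fixed function ε is made small; on the unit ball δ is
made small. -/
theorem exists_exp_bound {N : ℕ} (hN : 4 ≤ N) {β : ℝ}
    (hβ : ((N : ℝ) ^ 2 - 4 * (N : ℝ) + 2) / ((N : ℝ) * ((N : ℝ) - 2)) < β) (hβ1 : β < 1)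
    {χ : ℝ → ℝ} (hχ : ∀ t, 1 ≤ t → 1 ≤ χ t) {A ε δ r₀ α : ℝ} (hA : 0 ≤ A) (hε : 0 ≤ ε)
    (hδ : 0 < δ) (hr₀ : 0 < r₀) (hr₁ : r₀ ≤ 1) (hα : 0 ≤ α)
    (hαε : α * (1 + δ) ^ gammaExp N β * ε ^ (2 / (((N : ℝ) - 2) * (1 - β))) ≤ alphaCrit N β) :
    ∃ B : ℝ≥0∞, B < ⊤ ∧ ∀ u ∈ spaceE N β χ, energy N β χ u ≤ ENNReal.ofReal A →
      ∫⁻ x in Metric.ball 0 r₀, ENNReal.ofReal (weight N β χ x *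
        |weakLaplacian univ u x| ^ ((N : ℝ) / 2)) ≤ ENNReal.ofReal ε →
      ∫⁻ x, ENNReal.ofReal (Real.exp (α * |u x| ^ gammaExp N β) - 1) ≤ B := by
  have hN0 : 0 < N := by omega
  have hN3 : 3 ≤ N := by omega
  have hβ0 := beta_pos hN hβ
  have hγ := gammaExp_pos hN3 hβ1
  have hac := alphaCrit_pos hN3 hβ1
  have : Nonempty (Fin N) := ⟨⟨0, hN0⟩⟩
  obtain ⟨C, hC0, hC⟩ := exists_outer_bound hN3 hA hr₀
  set C' := α * (C * (1 + δ⁻¹)) ^ gammaExp N β with hC'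
  refine ⟨ENNReal.ofReal (Real.exp C') *
        (∫⁻ x in unitBall N, ENNReal.ofReal (Real.exp (critExponent N β ‖x‖))) +
      ENNReal.ofReal (α * C ^ (gammaExp N β - (N : ℝ) / 2) *
        Real.exp (α * C ^ gammaExp N β)) * ENNReal.ofReal A, ?_, fun u hu huA huε => ?_⟩
  · have := lintegral_exp_critExponent_lt_top hN0 hβ0
    exact ENNReal.add_lt_top.2 ⟨ENNReal.mul_lt_top ENNReal.ofReal_lt_top this,
      ENNReal.mul_lt_top ENNReal.ofReal_lt_top ENNReal.ofReal_lt_top⟩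
  obtain ⟨-, ⟨v, hv⟩, -, ⟨g, hg⟩, -⟩ := hu
  have hL : HasWeakLaplacian univ u (weakLaplacian univ u) := by
    have hex : ∃ f, HasWeakLaplacian univ u f := ⟨g, hg⟩
    rw [weakLaplacian, dif_pos hex]
    exact hex.choose_spec
  set f := weakLaplacian univ u with hfdef
  have hf : LocallyIntegrable f := locallyIntegrableOn_univ.1 hL.2.1
  obtain ⟨c, hc⟩ := exists_radial_representation (by omega) hv hL
  have huA' : ∫⁻ x, ENNReal.ofReal (|u x| ^ ((N : ℝ) / 2)) ≤ ENNReal.ofReal A :=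
    le_trans (by unfold energy; exact le_add_self) huA
  have hCu := hC u f c hf hc ((lintegral_rpow_le_energy hN hβ0.le hχ u).trans huA) huA'
  refine (lintegral_exp_le (half_le_gammaExp hN hβ1 hβ) hN0 (C := C) (C' := C') hr₁ hα hC0
    ?_ ?_).trans (by gcongr)
  · filter_upwards [hc] with x hx hxr
    rw [hx]
    exact hCu _ hxr
  · filter_upwards [hc, compl_mem_ae_iff.2 (measure_singleton (0 : Rn N))] with x hx hx0 hxr
    have hx0 : 0 < ‖x‖ := norm_pos_iff.2 (by simpa using hx0)
    -- The increment between |x| and r₀; the value at r₀ itself is already bounded by C.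
    set z := |∫ s in ‖x‖..r₀, flux f s| with hz
    have hux : |u x| ≤ C + z := by
      have e : u x = (c + ∫ s in (1 : ℝ)..r₀, flux f s) - ∫ s in ‖x‖..r₀, flux f s := by
        rw [hx, ← intervalIntegral.integral_add_adjacent_intervals
          (intervalIntegrable_flux hN0 hf one_pos hx0) (intervalIntegrable_flux hN0 hf hx0 hr₀)]
        ring
      rw [e]
      exact (abs_sub _ _).trans (add_le_add_left (hCu r₀ le_rfl) z)
    have hflux := alphaCrit_mul_flux_rpow_le hN hβ0.le hβ1 hx0 hxr.le hr₁
      (LocallyIntegrable.integrableOn_ball hf r₀) hε huε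
    have hcr := critExponent_nonneg (N := N) hβ1 hx0 (hxr.le.trans hr₁)
    have h1 : |u x| ^ gammaExp N β ≤ (1 + δ) ^ gammaExp N β * z ^ gammaExp N β +
        (C * (1 + δ⁻¹)) ^ gammaExp N β :=
      (Real.rpow_le_rpow (abs_nonneg _) hux hγ.le).trans
        (add_rpow_le hγ.le hδ hC0 (abs_nonneg _))
    have h2 : α * ((1 + δ) ^ gammaExp N β * z ^ gammaExp N β) ≤ critExponent N β ‖x‖ := by
      refine le_of_mul_le_mul_left ?_ hac
      calc alphaCrit N β * (α * ((1 + δ) ^ gammaExp N β * z ^ gammaExp N β))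
          = α * (1 + δ) ^ gammaExp N β * (alphaCrit N β * z ^ gammaExp N β) := by ring
        _ ≤ α * (1 + δ) ^ gammaExp N β * (ε ^ (2 / (((N : ℝ) - 2) * (1 - β))) *
            critExponent N β ‖x‖) := by gcongr
        _ = α * (1 + δ) ^ gammaExp N β * ε ^ (2 / (((N : ℝ) - 2) * (1 - β))) *
            critExponent N β ‖x‖ := by ring
        _ ≤ alphaCrit N β * critExponent N β ‖x‖ := by gcongr
    have h3 := mul_le_mul_of_nonneg_left h1 hα
    rw [mul_add] at h3
    linarith

/-- Functions of `E` are exponentially integrable. -/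
theorem integrable_exp_of_mem_spaceE {N : ℕ} (hN : 4 ≤ N) {β : ℝ}
    (hβ : ((N : ℝ) ^ 2 - 4 * (N : ℝ) + 2) / ((N : ℝ) * ((N : ℝ) - 2)) < β) (hβ1 : β < 1)
    {χ : ℝ → ℝ} (hχ : ∀ t, 1 ≤ t → 1 ≤ χ t) {u : Rn N → ℝ} (hu : u ∈ spaceE N β χ) :
    Integrable (fun x : Rn N => Real.exp (|u x| ^ gammaExp N β) - 1) volume := by
  have hN0 : 0 < N := by omega
  have hN3 : 3 ≤ N := by omega
  have hN' : (4 : ℝ) ≤ N := by exact_mod_cast hN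
  have hac := alphaCrit_pos hN3 hβ1
  have hm := hu.1.aestronglyMeasurable
  have hfin := hu.2.2.2.2
  set e := 2 / (((N : ℝ) - 2) * (1 - β)) with he
  have he0 : 0 < e := div_pos two_pos (mul_pos (by linarith) (by linarith))
  -- The value for which the condition of `exists_exp_bound` with α = δ = 1 is an equality.
  set ε := (alphaCrit N β / (1 + 1) ^ gammaExp N β) ^ (1 / e) with hε
  have hε0 : 0 < ε := by positivity
  -- Absolute continuity of the integral: the weighted energy on a ball tends to zero with its
  -- volume.
  have hsmall : ∃ r₀ : ℝ, 0 < r₀ ∧ r₀ ≤ 1 ∧ ∫⁻ x in Metric.ball 0 r₀,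
      ENNReal.ofReal (weight N β χ x * |weakLaplacian univ u x| ^ ((N : ℝ) / 2)) ≤
        ENNReal.ofReal ε := by
    have h1 : ∫⁻ x, ENNReal.ofReal
        (weight N β χ x * |weakLaplacian univ u x| ^ ((N : ℝ) / 2)) ≠ ⊤ := by
      refine (lt_of_le_of_lt ?_ hfin).ne
      unfold energy
      rw [add_assoc]
      exact le_self_add
    have h2 : Tendsto (fun n : ℕ => volume (Metric.ball (0 : Rn N) (1 / ((n : ℝ) + 1)))) atTop
        (𝓝 0) := by
      have e1 : ∀ n : ℕ, volume (Metric.ball (0 : Rn N) (1 / ((n : ℝ) + 1))) =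
          ENNReal.ofReal ((1 / ((n : ℝ) + 1)) ^ N * ballVolume N) := fun n =>
        volume_ball_eq hN0 (by positivity)
      simp_rw [e1]
      have h3 := ((tendsto_one_div_add_atTop_nhds_zero_nat (𝕜 := ℝ)).pow N).mul_const
        (ballVolume N)
      rw [zero_pow hN0.ne', zero_mul] at h3
      simpa using ENNReal.tendsto_ofReal h3
    have h3 := tendsto_setLIntegral_zero h1 h2
    obtain ⟨n, hn⟩ := (h3.eventually_lt_const (ENNReal.ofReal_pos.2 hε0)).exists
    refine ⟨1 / ((n : ℝ) + 1), by positivity, ?_, hn.le⟩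
    rw [div_le_one (by positivity)]
    linarith [n.cast_nonneg (α := ℝ)]
  obtain ⟨r₀, hr₀, hr₁, hrε⟩ := hsmall
  obtain ⟨B, hB, hB2⟩ := exists_exp_bound hN hβ hβ1 hχ (A := (energy N β χ u).toReal) (δ := 1)
    (α := 1) ENNReal.toReal_nonneg hε0.le one_pos hr₀ hr₁ zero_le_one (by
      rw [hε, ← Real.rpow_mul (by positivity), ← he, one_div_mul_cancel he0.ne', Real.rpow_one,
        one_mul, mul_div_cancel₀ _ (by positivity)])
  have h := hB2 u hu (by rw [ENNReal.ofReal_toReal hfin.ne]) hrε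
  simp only [one_mul] at h
  refine ⟨?_, ?_⟩
  · exact (Real.continuous_exp.comp_aestronglyMeasurable
      ((hm.aemeasurable.abs.pow_const _).aestronglyMeasurable)).sub aestronglyMeasurable_const
  · rw [hasFiniteIntegral_iff_ofReal]
    · exact h.trans_lt hB
    · exact Eventually.of_forall fun x => by
        have := Real.one_le_exp (show 0 ≤ |u x| ^ gammaExp N β by positivity)
        simp only [Pi.zero_apply]
        linarith

/-- Uniform exponential bound on the unit ball of `E` for subcritical exponents. -/
theorem iSup_spaceE_lt_top {N : ℕ} (hN : 4 ≤ N) {β : ℝ}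
    (hβ : ((N : ℝ) ^ 2 - 4 * (N : ℝ) + 2) / ((N : ℝ) * ((N : ℝ) - 2)) < β) (hβ1 : β < 1)
    {χ : ℝ → ℝ} (hχ : ∀ t, 1 ≤ t → 1 ≤ χ t) {α : ℝ} (hα : α < alphaCrit N β) :
    (⨆ u ∈ {u ∈ spaceE N β χ | normE N β χ u ≤ 1},
        ∫⁻ x : Rn N, ENNReal.ofReal (Real.exp (α * |u x| ^ gammaExp N β) - 1)) < ⊤ := by
  have hN3 : 3 ≤ N := by omega
  have hac := alphaCrit_pos hN3 hβ1
  have hγ := gammaExp_pos hN3 hβ1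
  have hN' : (4 : ℝ) ≤ N := by exact_mod_cast hN
  rcases le_or_gt α 0 with h0 | h0
  · refine lt_of_le_of_lt (iSup₂_le fun u _ => ?_) ENNReal.zero_lt_top
    refine le_of_eq (lintegral_eq_zero_of_ae_eq_zero (Eventually.of_forall fun x => ?_))
    refine ENNReal.ofReal_eq_zero.2 ?_
    have : Real.exp (α * |u x| ^ gammaExp N β) ≤ 1 :=
      Real.exp_le_one_iff.2 (mul_nonpos_of_nonpos_of_nonneg h0 (by positivity))
    linarith
  · have h1 : 1 < (alphaCrit N β / α) ^ (1 / gammaExp N β) :=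
      Real.one_lt_rpow ((one_lt_div h0).2 hα) (by positivity)
    -- The choice of δ makes (1+δ)^γ = α_β/α, so all the room below the critical constant is spent
    -- on absorbing the outer bound.
    obtain ⟨B, hB, hB2⟩ := exists_exp_bound hN hβ hβ1 hχ (A := 1) (ε := 1) (r₀ := 1) (α := α)
      (δ := (alphaCrit N β / α) ^ (1 / gammaExp N β) - 1) zero_le_one zero_le_one
      (by linarith) one_pos le_rfl h0.le (by
        rw [Real.one_rpow, mul_one, add_sub_cancel, ← Real.rpow_mul (by positivity),
          one_div_mul_cancel hγ.ne', Real.rpow_one, mul_div_cancel₀ _ h0.ne'])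
    refine lt_of_le_of_lt (iSup₂_le fun u hu => ?_) hB
    have hen : energy N β χ u ≤ 1 := by
      have h2 := hu.2
      unfold normE at h2
      have h3 := ENNReal.rpow_le_rpow h2 (show (0 : ℝ) ≤ N / 2 by positivity)
      rwa [← ENNReal.rpow_mul, ENNReal.one_rpow, show 2 / (N : ℝ) * (N / 2) = 1 by field_simp,
        ENNReal.rpow_one] at h3
    refine hB2 u hu.1 (by simpa using hen) ?_
    rw [ENNReal.ofReal_one]
    refine le_trans ((setLIntegral_le_lintegral _ _).trans ?_) hen
    unfold energy
    rw [add_assoc]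
    exact le_self_add

/-! ### The Dirichlet problem on the ball at the critical constant -/

/-- Critical pointwise bound for smooth radial functions with compact support in the ball. -/
theorem alphaCrit_mul_test_rpow_le {N : ℕ} (hN : 4 ≤ N) {β : ℝ} (hβ0 : 0 ≤ β) (hβ1 : β < 1)
    {χ : ℝ → ℝ} {φ : Rn N → ℝ} (hφ : IsTestFunction (unitBall N) φ)
    (hrad : ∀ x y, ‖x‖ = ‖y‖ → φ x = φ y) {A : ℝ} (hA0 : 0 ≤ A)
    (hA : ∫⁻ x in unitBall N,
      ENNReal.ofReal (weight N β χ x * |(Δ φ) x| ^ ((N : ℝ) / 2)) ≤ ENNReal.ofReal A)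
    {x : Rn N} (hx0 : x ≠ 0) (hx1 : ‖x‖ < 1) :
    alphaCrit N β * |φ x| ^ gammaExp N β ≤
      A ^ (2 / (((N : ℝ) - 2) * (1 - β))) * critExponent N β ‖x‖ := by
  have hN0 : 0 < N := by omega
  have : Nonempty (Fin N) := ⟨⟨0, hN0⟩⟩
  set e : Rn N := EuclideanSpace.single ⟨0, hN0⟩ 1 with he
  have hen : ‖e‖ = 1 := by simp [he]
  have hL := hasWeakLaplacian_of_contDiff isOpen_univ hφ.1
  have hf : LocallyIntegrable (Δ φ) := locallyIntegrableOn_univ.1 hL.2.1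
  have hv : φ =ᵐ[volume] fun x => (fun r : ℝ => φ (r • e)) ‖x‖ :=
    Eventually.of_forall fun x => hrad _ _ (by simp [norm_smul, hen])
  obtain ⟨c, hc⟩ := exists_radial_representation (v := fun r : ℝ => φ (r • e)) (by omega) hv hL
  have hfc := continuousOn_flux hN0 hf
  have hQ : ContinuousOn (fun x : Rn N => c + ∫ s in (1 : ℝ)..‖x‖, flux (Δ φ) s) {0}ᶜ := by
    refine continuousOn_const.add fun y hy => ?_
    have hy0 : 0 < ‖y‖ := norm_pos_iff.2 (by simpa using hy)
    have hd : HasDerivAt (fun r => ∫ s in (1 : ℝ)..r, flux (Δ φ) s) (flux (Δ φ) ‖y‖) ‖y‖ :=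
      intervalIntegral.integral_hasDerivAt_right (intervalIntegrable_flux hN0 hf one_pos hy0)
        (hfc.stronglyMeasurableAtFilter isOpen_Ioi _ hy0) (hfc.continuousAt (Ioi_mem_nhds hy0))
    exact (ContinuousAt.comp (f := fun y : Rn N => ‖y‖) hd.continuousAt
      continuous_norm.continuousAt).continuousWithinAt
  -- Both sides are continuous off the origin, so the almost everywhere identity holds at every
  -- nonzero point.
  have heq : EqOn φ (fun x : Rn N => c + ∫ s in (1 : ℝ)..‖x‖, flux (Δ φ) s) {0}ᶜ :=
    Measure.eqOn_open_of_ae_eq (μ := volume) (ae_restrict_of_ae hc) isOpen_compl_singleton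
      hφ.1.continuous.continuousOn hQ
  -- The representation is based at radius one, where φ vanishes. No additive constant is left, and
  -- hence nothing is lost at the critical value.
  have hc0 : c = 0 := by
    have h1 := heq (x := e) (by simp [he])
    have h2 : φ e = 0 := image_eq_zero_of_notMem_tsupport fun hcon => by
      have := hφ.2.2 hcon
      simp [unitBall, hen] at this
    simp only [hen, intervalIntegral.integral_same, add_zero] at h1
    rw [← h1, h2]
  have hx0' : 0 < ‖x‖ := norm_pos_iff.2 hx0
  have h1 := heq (x := x) (by simpa using hx0)
  simp only [hc0, zero_add] at h1
  rw [intervalIntegral.integral_symm] at h1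
  rw [h1, abs_neg]
  exact alphaCrit_mul_flux_rpow_le hN hβ0 hβ1 hx0' hx1.le le_rfl
    (LocallyIntegrable.integrableOn_ball hf 1) hA0 hA

theorem continuous_laplacian {N : ℕ} {φ : Rn N → ℝ} (h : ContDiff ℝ ∞ φ) : Continuous (Δ φ) := by
  rw [show (Δ φ) = fun x => ∑ i, partialDeriv i (partialDeriv i φ) x from
    funext fun x => laplacian_eq_sum_partialDeriv h x]
  exact continuous_finsetSum _ fun i _ =>
    (partialDeriv_contDiff (partialDeriv_contDiff h i) i).continuous

theorem weight_nonneg {N : ℕ} {β : ℝ} {χ : ℝ → ℝ} {x : Rn N} (hx : x ∈ unitBall N) :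
    0 ≤ weight N β χ x := by
  have hx1 : ‖x‖ < 1 := by simpa [unitBall] using hx
  rw [weight_of_mem hx1]
  rcases (norm_nonneg x).eq_or_lt with h | h
  · rw [← h]
    exact Real.rpow_nonneg (by simp [ell]) _
  · have := one_le_ell h hx1.le
    positivity

/-- The weighted norm of the Laplacian is controlled along an approximating sequence. -/
theorem lintegral_laplacian_le {N : ℕ} (hN : 4 ≤ N) {β : ℝ} {χ : ℝ → ℝ} {φ u : Rn N → ℝ}
    {G : Rn N → Rn N} {H : Fin N → Rn N → Rn N} (hφ : ContDiff ℝ ∞ φ)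
    (hH : ∀ i j, LocallyIntegrableOn (fun x => H i x j) (unitBall N))
    (h1 : ∫⁻ x in unitBall N,
      ENNReal.ofReal (weight N β χ x * |∑ i, H i x i| ^ ((N : ℝ) / 2)) ≤ 1) :
    ∫⁻ x in unitBall N, ENNReal.ofReal (weight N β χ x * |(Δ φ) x| ^ ((N : ℝ) / 2)) ≤
      ((ENNReal.ofReal ((N : ℝ) ^ ((N : ℝ) / 2 - 1)) * distW2 N β χ φ u G H) ^
        (1 / ((N : ℝ) / 2)) + 1) ^ ((N : ℝ) / 2) := by
  have hN0 : 0 < N := by omega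
  have hN' : (4 : ℝ) ≤ N := by exact_mod_cast hN
  have hp1 : (1 : ℝ) ≤ (N : ℝ) / 2 := by linarith
  have hp0 : (0 : ℝ) < (N : ℝ) / 2 := by linarith
  have hmB : MeasurableSet (unitBall N) := Metric.isOpen_ball.measurableSet
  set p := (N : ℝ) / 2 with hp
  have hHm : AEMeasurable (fun x => ∑ i, H i x i) (volume.restrict (unitBall N)) :=
    Finset.aemeasurable_fun_sum _ fun i _ => (hH i i).aestronglyMeasurable.aemeasurable
  have hΔm : AEMeasurable (fun x => (Δ φ) x) (volume.restrict (unitBall N)) :=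
    (continuous_laplacian hφ).aemeasurable
  have hwm : AEMeasurable (weight N β χ) (volume.restrict (unitBall N)) :=
    aemeasurable_weight β χ le_rfl
  -- Minkowski in L^{N/2}, with w^{2/N} absorbed into the functions: `a` is the approximation error,
  -- and `b` is the Laplacian of u, of norm at most one.
  set a : Rn N → ℝ≥0∞ := fun x =>
    ENNReal.ofReal (weight N β χ x ^ (1 / p) * |(Δ φ) x - ∑ i, H i x i|) with ha
  set b : Rn N → ℝ≥0∞ := fun x =>
    ENNReal.ofReal (weight N β χ x ^ (1 / p) * |∑ i, H i x i|) with hb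
  have hpow : ∀ (t : ℝ), ∀ x ∈ unitBall N, ENNReal.ofReal (weight N β χ x ^ (1 / p) * |t|) ^ p =
      ENNReal.ofReal (weight N β χ x * |t| ^ p) := fun t x hx => by
    have hw := weight_nonneg (β := β) (χ := χ) hx
    rw [ENNReal.ofReal_rpow_of_nonneg (by positivity) hp0.le, Real.mul_rpow (by positivity)
      (abs_nonneg _), ← Real.rpow_mul hw, one_div_mul_cancel hp0.ne', Real.rpow_one]
  have ham : AEMeasurable a (volume.restrict (unitBall N)) :=
    ((hwm.pow_const _).mul (hΔm.sub hHm).abs).ennreal_ofReal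
  have hbm : AEMeasurable b (volume.restrict (unitBall N)) :=
    ((hwm.pow_const _).mul hHm.abs).ennreal_ofReal
  have hmink := ENNReal.lintegral_Lp_add_le ham hbm hp1
  have hb1 : (∫⁻ x in unitBall N, b x ^ p) ^ (1 / p) ≤ 1 := by
    rw [setLIntegral_congr_fun hmB fun x hx => hpow _ x hx]
    simpa using ENNReal.rpow_le_rpow h1 (show 0 ≤ 1 / p by positivity)
  have ha1 : ∫⁻ x in unitBall N, a x ^ p ≤
      ENNReal.ofReal ((N : ℝ) ^ (p - 1)) * distW2 N β χ φ u G H := by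
    calc ∫⁻ x in unitBall N, a x ^ p
        ≤ ∫⁻ x in unitBall N, ENNReal.ofReal ((N : ℝ) ^ (p - 1)) *
            ∑ i, ∑ j, ENNReal.ofReal
              (weight N β χ x * |partialDeriv j (partialDeriv i φ) x - H i x j| ^ p) := by
          refine setLIntegral_mono_ae' hmB (Eventually.of_forall fun x hx => ?_)
          have hw := weight_nonneg (β := β) (χ := χ) hx
          rw [ha]
          simp only
          rw [hpow _ x hx, laplacian_eq_sum_partialDeriv hφ, ← Finset.sum_sub_distrib]
          have h2 : |∑ i, (partialDeriv i (partialDeriv i φ) x - H i x i)| ^ p ≤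
              (N : ℝ) ^ (p - 1) * ∑ i, |partialDeriv i (partialDeriv i φ) x - H i x i| ^ p := by
            have h3 := Real.rpow_sum_le_const_mul_sum_rpow (s := Finset.univ)
              (f := fun i : Fin N => partialDeriv i (partialDeriv i φ) x - H i x i) hp1
            rw [Finset.card_univ, Fintype.card_fin] at h3
            refine le_trans ?_ h3
            exact Real.rpow_le_rpow (abs_nonneg _) (Finset.abs_sum_le_sum_abs _ _) hp0.le
          calc ENNReal.ofReal (weight N β χ x *
                |∑ i, (partialDeriv i (partialDeriv i φ) x - H i x i)| ^ p)
              ≤ ENNReal.ofReal ((N : ℝ) ^ (p - 1) * ∑ i, weight N β χ x *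
                |partialDeriv i (partialDeriv i φ) x - H i x i| ^ p) := by
                refine ENNReal.ofReal_le_ofReal ?_
                rw [← Finset.mul_sum]
                calc _ ≤ weight N β χ x * ((N : ℝ) ^ (p - 1) *
                    ∑ i, |partialDeriv i (partialDeriv i φ) x - H i x i| ^ p) := by gcongr
                  _ = _ := by ring
            _ = ENNReal.ofReal ((N : ℝ) ^ (p - 1)) * ∑ i, ENNReal.ofReal (weight N β χ x *
                |partialDeriv i (partialDeriv i φ) x - H i x i| ^ p) := by
                rw [ENNReal.ofReal_mul (by positivity),
                  ENNReal.ofReal_sum_of_nonneg fun i _ => by positivity]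
            _ ≤ _ := by
                gcongr with i
                -- Only the diagonal second derivatives enter the Laplacian; the distance controls
                -- all of them.
                exact Finset.single_le_sum (f := fun j => ENNReal.ofReal (weight N β χ x *
                  |partialDeriv j (partialDeriv i φ) x - H i x j| ^ p))
                  (fun _ _ => zero_le) (Finset.mem_univ i)
      _ = ENNReal.ofReal ((N : ℝ) ^ (p - 1)) * ∑ i, ∑ j, ∫⁻ x in unitBall N, ENNReal.ofReal
              (weight N β χ x * |partialDeriv j (partialDeriv i φ) x - H i x j| ^ p) := by
          have hm : ∀ i j, AEMeasurable (fun x => ENNReal.ofReal (weight N β χ x *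
              |partialDeriv j (partialDeriv i φ) x - H i x j| ^ p))
              (volume.restrict (unitBall N)) := fun i j =>
            (hwm.mul (((partialDeriv_contDiff (partialDeriv_contDiff hφ i)
              j).continuous.aemeasurable.sub
              (hH i j).aestronglyMeasurable.aemeasurable).abs.pow_const _)).ennreal_ofReal
          rw [lintegral_const_mul' _ _ ENNReal.ofReal_ne_top, lintegral_finsetSum' _ fun i _ =>
            Finset.aemeasurable_fun_sum _ fun j _ => hm i j]
          congr 1
          exact Finset.sum_congr rfl fun i _ => lintegral_finsetSum' _ fun j _ => hm i j
      _ ≤ _ := by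
          gcongr
          unfold distW2
          exact le_add_self
  have hab : ∫⁻ x in unitBall N, ENNReal.ofReal (weight N β χ x * |(Δ φ) x| ^ p) ≤
      ∫⁻ x in unitBall N, (a + b) x ^ p := by
    refine setLIntegral_mono_ae' hmB (Eventually.of_forall fun x hx => ?_)
    rw [← hpow _ x hx]
    refine ENNReal.rpow_le_rpow ?_ hp0.le
    have hw := weight_nonneg (β := β) (χ := χ) hx
    rw [Pi.add_apply, ha, hb, ← ENNReal.ofReal_add (by positivity) (by positivity), ← mul_add]
    refine ENNReal.ofReal_le_ofReal (mul_le_mul_of_nonneg_left ?_ (by positivity))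
    have := abs_add_le ((Δ φ) x - ∑ i, H i x i) (∑ i, H i x i)
    rwa [sub_add_cancel] at this
  refine hab.trans ?_
  have h5 := hmink.trans (add_le_add (ENNReal.rpow_le_rpow ha1 (show 0 ≤ 1 / p by positivity)) hb1)
  have h6 := ENNReal.rpow_le_rpow h5 hp0.le
  rwa [← ENNReal.rpow_mul, one_div_mul_cancel hp0.ne', ENNReal.rpow_one] at h6

/-- Critical pointwise bound for `W_0^{2,N/2}` radial functions. -/
theorem ae_alphaCrit_mul_rpow_le {N : ℕ} (hN : 4 ≤ N) {β : ℝ} (hβ0 : 0 ≤ β) (hβ1 : β < 1)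
    {χ : ℝ → ℝ} {u : Rn N → ℝ} (hu : u ∈ spaceW0rad N β χ)
    (h1 : ∫⁻ x in unitBall N, ENNReal.ofReal
      (weight N β χ x * |weakLaplacian (unitBall N) u x| ^ ((N : ℝ) / 2)) ≤ 1) :
    ∀ᵐ x ∂volume.restrict (unitBall N),
      alphaCrit N β * |u x| ^ gammaExp N β ≤ critExponent N β ‖x‖ := by
  have hN0 : 0 < N := by omega
  have hN' : (4 : ℝ) ≤ N := by exact_mod_cast hN
  have hp0 : (0 : ℝ) < (N : ℝ) / 2 := by linarith
  have : Nonempty (Fin N) := ⟨⟨0, hN0⟩⟩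
  have hB : IsOpen (unitBall N) := Metric.isOpen_ball
  have hγ := gammaExp_pos (show 3 ≤ N by omega) hβ1
  obtain ⟨G, H, ⟨hG, hH, -, -, -⟩, φ, hφ, hlim⟩ := hu
  have hL := (hasWeakLaplacian_of_hessian hB hG hH).weakLaplacian_ae_eq hB
  have h1' : ∫⁻ x in unitBall N,
      ENNReal.ofReal (weight N β χ x * |∑ i, H i x i| ^ ((N : ℝ) / 2)) ≤ 1 := by
    refine le_trans (le_of_eq (lintegral_congr_ae ?_)) h1
    filter_upwards [hL] with x hx
    rw [hx]
  -- The energy of φ_n is at most (d_n + 1)^{N/2}, which tends to one, so the critical bound for φ_n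
  -- loses a factor that disappears in the limit.
  set d : ℕ → ℝ≥0∞ := fun n => (ENNReal.ofReal ((N : ℝ) ^ ((N : ℝ) / 2 - 1)) *
    distW2 N β χ (φ n) u G H) ^ (1 / ((N : ℝ) / 2)) with hd
  have hd0 : Tendsto d atTop (𝓝 0) := by
    have h2 := ENNReal.Tendsto.const_mul (a := ENNReal.ofReal ((N : ℝ) ^ ((N : ℝ) / 2 - 1)))
      hlim (Or.inr ENNReal.ofReal_ne_top)
    have h3 := h2.ennrpow_const (1 / ((N : ℝ) / 2))
    rwa [mul_zero, ENNReal.zero_rpow_of_pos (by positivity)] at h3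
  have hA : Tendsto (fun n => (d n + 1) ^ ((N : ℝ) / 2)) atTop (𝓝 1) := by
    have h3 := (hd0.add_const 1).ennrpow_const ((N : ℝ) / 2)
    rwa [zero_add, ENNReal.one_rpow] at h3
  have hAr : Tendsto (fun n => ((d n + 1) ^ ((N : ℝ) / 2)).toReal) atTop (𝓝 1) := by
    rw [← ENNReal.toReal_one]
    exact (ENNReal.tendsto_toReal ENNReal.one_ne_top).comp hA
  have hpt : ∀ᶠ n in atTop, ∀ x : Rn N, x ≠ 0 → ‖x‖ < 1 →
      alphaCrit N β * |φ n x| ^ gammaExp N β ≤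
        ((d n + 1) ^ ((N : ℝ) / 2)).toReal ^ (2 / (((N : ℝ) - 2) * (1 - β))) *
          critExponent N β ‖x‖ := by
    filter_upwards [hA.eventually_lt_const ENNReal.one_lt_top] with n hn x hx0 hx1
    refine alphaCrit_mul_test_rpow_le hN hβ0 hβ1 (χ := χ) (hφ n).1 (hφ n).2
      ENNReal.toReal_nonneg ?_ hx0 hx1
    rw [ENNReal.ofReal_toReal hn.ne]
    exact lintegral_laplacian_le hN (hφ n).1.1
      (fun i j => locallyIntegrableOn_apply (hH i).2.1 j) h1'
  -- The zeroth order part of the distance gives L^{N/2} convergence, hence almost everywhere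
  -- convergence of a subsequence.
  have hsub : ∃ ns : ℕ → ℕ, StrictMono ns ∧ ∀ᵐ x ∂volume.restrict (unitBall N),
      Tendsto (fun i => φ (ns i) x) atTop (𝓝 (u x)) := by
    refine (tendstoInMeasure_of_tendsto_eLpNorm (p := ENNReal.ofReal ((N : ℝ) / 2)) ?_ ?_ ?_
      ?_).exists_seq_tendsto_ae
    · exact (ENNReal.ofReal_pos.2 hp0).ne'
    · exact fun n => (hφ n).1.1.continuous.aestronglyMeasurable
    · exact hG.1.aestronglyMeasurable
    · have h2 : ∀ n, eLpNorm (φ n - u) (ENNReal.ofReal ((N : ℝ) / 2))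
          (volume.restrict (unitBall N)) ≤
          (distW2 N β χ (φ n) u G H) ^ (1 / ((N : ℝ) / 2)) := fun n => by
        rw [eLpNorm_eq_lintegral_rpow_enorm_toReal (ENNReal.ofReal_pos.2 hp0).ne'
          ENNReal.ofReal_ne_top, ENNReal.toReal_ofReal hp0.le]
        refine ENNReal.rpow_le_rpow ?_ (by positivity)
        unfold distW2
        rw [add_assoc]
        refine le_trans (le_of_eq (lintegral_congr fun x => ?_)) le_self_add
        rw [← ofReal_norm, ENNReal.ofReal_rpow_of_nonneg (norm_nonneg _) hp0.le,
          Real.norm_eq_abs, Pi.sub_apply]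
      have h3 := hlim.ennrpow_const (1 / ((N : ℝ) / 2))
      rw [ENNReal.zero_rpow_of_pos (by positivity)] at h3
      exact tendsto_of_tendsto_of_tendsto_of_le_of_le tendsto_const_nhds h3
        (fun _ => zero_le) h2
  obtain ⟨ns, hns, hns2⟩ := hsub
  filter_upwards [hns2, ae_restrict_mem hB.measurableSet,
    ae_restrict_of_ae (compl_mem_ae_iff.2 (measure_singleton (0 : Rn N)))] with x hx hxB hx0
  have l1 : Tendsto (fun i => alphaCrit N β * |φ (ns i) x| ^ gammaExp N β) atTop
      (𝓝 (alphaCrit N β * |u x| ^ gammaExp N β)) :=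
    (hx.abs.rpow_const (Or.inr hγ.le)).const_mul _
  have l2 : Tendsto (fun i => ((d (ns i) + 1) ^ ((N : ℝ) / 2)).toReal ^
      (2 / (((N : ℝ) - 2) * (1 - β))) * critExponent N β ‖x‖) atTop
      (𝓝 (critExponent N β ‖x‖)) := by
    have := ((hAr.comp hns.tendsto_atTop).rpow_const (p := 2 / (((N : ℝ) - 2) * (1 - β)))
      (Or.inl one_ne_zero)).mul_const (critExponent N β ‖x‖)
    simpa using this
  refine le_of_tendsto_of_tendsto l1 l2 ?_
  filter_upwards [hns.tendsto_atTop.eventually hpt] with i hi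
  exact hi x (by simpa using hx0) (by simpa [unitBall] using hxB)

/-- The pointwise bound does not depend on u, so a single integrable function dominates the whole
family, including at α = α_β. -/
theorem iSup_spaceW0rad_lt_top {N : ℕ} (hN : 4 ≤ N) {β : ℝ} (hβ0 : 0 < β) (hβ1 : β < 1)
    {χ : ℝ → ℝ} {α : ℝ} (hα : α ≤ alphaCrit N β) :
    (⨆ u ∈ {u ∈ spaceW0rad N β χ |
          ∫⁻ x in unitBall N, ENNReal.ofReal
            (weight N β χ x * |weakLaplacian (unitBall N) u x| ^ ((N : ℝ) / 2)) ≤ 1},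
        ∫⁻ x in unitBall N, ENNReal.ofReal (Real.exp (α * |u x| ^ gammaExp N β) - 1)) < ⊤ := by
  refine lt_of_le_of_lt (iSup₂_le fun u hu => ?_)
    (lintegral_exp_critExponent_lt_top (show 0 < N by omega) hβ0)
  refine lintegral_mono_ae ?_
  filter_upwards [ae_alphaCrit_mul_rpow_le hN hβ0.le hβ1 hu.1 hu.2] with x hx
  refine ENNReal.ofReal_le_ofReal ?_
  have h1 : α * |u x| ^ gammaExp N β ≤ critExponent N β ‖x‖ :=
    (mul_le_mul_of_nonneg_right hα (by positivity)).trans hx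
  linarith [Real.exp_le_exp.2 h1]

/-! ### The extremal profile -/

/-- A smooth cutoff equal to one on `[2δ, 1-2δ]` and supported in `[δ, 1-δ]`. -/
noncomputable def smoothPlateau (δ y : ℝ) : ℝ :=
  Real.smoothTransition ((y - δ) / δ) * Real.smoothTransition ((1 - δ - y) / δ)

theorem smoothPlateau_contDiff (δ : ℝ) : ContDiff ℝ ∞ (smoothPlateau δ) :=
  (Real.smoothTransition.contDiff.comp (by fun_prop)).mul
    (Real.smoothTransition.contDiff.comp (by fun_prop))

theorem smoothPlateau_nonneg (δ y : ℝ) : 0 ≤ smoothPlateau δ y :=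
  mul_nonneg (Real.smoothTransition.nonneg _) (Real.smoothTransition.nonneg _)

theorem smoothPlateau_le_one (δ y : ℝ) : smoothPlateau δ y ≤ 1 :=
  mul_le_one₀ (Real.smoothTransition.le_one _) (Real.smoothTransition.nonneg _)
    (Real.smoothTransition.le_one _)

theorem smoothPlateau_eq_zero_of_le {δ y : ℝ} (hδ : 0 < δ) (hy : y ≤ δ) :
    smoothPlateau δ y = 0 := by
  rw [smoothPlateau, Real.smoothTransition.zero_of_nonpos, zero_mul]
  exact div_nonpos_of_nonpos_of_nonneg (by linarith) hδ.le

theorem smoothPlateau_eq_zero_of_ge {δ y : ℝ} (hδ : 0 < δ) (hy : 1 - δ ≤ y) :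
    smoothPlateau δ y = 0 := by
  rw [smoothPlateau, Real.smoothTransition.zero_of_nonpos (x := (1 - δ - y) / δ), mul_zero]
  exact div_nonpos_of_nonpos_of_nonneg (by linarith) hδ.le

theorem smoothPlateau_eq_one {δ y : ℝ} (hδ : 0 < δ) (h1 : 2 * δ ≤ y) (h2 : y ≤ 1 - 2 * δ) :
    smoothPlateau δ y = 1 := by
  rw [smoothPlateau, Real.smoothTransition.one_of_one_le, Real.smoothTransition.one_of_one_le,
    mul_one]
  · rw [le_div_iff₀ hδ]; linarith
  · rw [le_div_iff₀ hδ]; linarith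

/-- Above the critical constant there is a profile of weighted norm less than one whose height
makes the exponential integral diverge. -/
theorem exists_profile {N : ℕ} (hN : 4 ≤ N) {β : ℝ} (hβ0 : 0 < β) (hβ1 : β < 1) {α : ℝ}
    (hα : alphaCrit N β < α) :
    ∃ (ζ : ℝ → ℝ) (δ : ℝ), ContDiff ℝ ∞ ζ ∧ 0 < δ ∧ δ < 1 ∧ (∀ y, 0 ≤ ζ y) ∧
      (∀ y, y ≤ δ → ζ y = 0) ∧ (∀ y, 1 - δ ≤ y → ζ y = 0) ∧
      sphereArea N * ∫ y in (0 : ℝ)..1, y ^ (β * ((N : ℝ) / 2 - 1)) *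
        |((N : ℝ) - 2) * ζ y| ^ ((N : ℝ) / 2) < 1 ∧
      N < α * (∫ y in (0 : ℝ)..1, ζ y) ^ gammaExp N β := by
  have hN' : (4 : ℝ) ≤ N := by exact_mod_cast hN
  have h1 : (0 : ℝ) < N - 2 := by linarith
  have h2 : 0 < 1 - β := by linarith
  have hN0 : 0 < N := by omega
  have hS := sphereArea_pos hN0
  have hac := alphaCrit_pos (show 3 ≤ N by omega) hβ1
  have hγ := gammaExp_pos (show 3 ≤ N by omega) hβ1
  have hα0 : 0 < α := hac.trans hα
  -- An intermediate exponent leaves room on both sides: α_β < α' puts the energy strictly below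
  -- one, and α' < α keeps the height condition strict after truncation.
  obtain ⟨α', hα1, hα2⟩ := exists_between hα
  have hα'0 : 0 < α' := hac.trans hα1
  set p := (N : ℝ) / 2 with hp
  have hp0 : 0 < p := by positivity
  set γ := gammaExp N β with hγdef
  -- The height for which α' c^γ = N. The untruncated profile c(1-β)y^{-β} has integral c over
  -- (0,1).
  set c := (N / α') ^ (1 / γ) with hc
  have hc0 : 0 < c := by positivity
  have hcγ : c ^ γ = N / α' := by
    rw [hc, ← Real.rpow_mul (by positivity), one_div_mul_cancel hγ.ne', Real.rpow_one]
  -- The left side is the limiting energy of the untruncated profile; its power 2/((N-2)(1-β)) is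
  -- α_β/α', which is less than one.
  have hcrit : sphereArea N * ((N : ℝ) - 2) ^ p * c ^ p * (1 - β) ^ (p - 1) < 1 := by
    set X := sphereArea N * ((N : ℝ) - 2) ^ p * c ^ p * (1 - β) ^ (p - 1) with hX
    have hX0 : 0 < X := by positivity
    have e1 : X ^ (2 / (((N : ℝ) - 2) * (1 - β))) = alphaCrit N β / α' := by
      have hγ2 : p * (2 / (((N : ℝ) - 2) * (1 - β))) = γ := by
        rw [hp, hγdef, gammaExp]; field_simp
      have e3 : (p - 1) * (2 / (((N : ℝ) - 2) * (1 - β))) = 1 / (1 - β) := by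
        rw [hp]; field_simp
      rw [hX, Real.mul_rpow (by positivity) (by positivity), Real.mul_rpow (by positivity)
        (by positivity), ← Real.rpow_mul hc0.le, ← Real.rpow_mul h2.le, hγ2, e3, hcγ, alphaCrit,
        ← sphereArea, mul_comm (sphereArea N)]
      ring
    have e2 : X ^ (2 / (((N : ℝ) - 2) * (1 - β))) < 1 := by
      rw [e1, div_lt_one hα'0]; exact hα1
    by_contra hcon
    exact absurd (Real.one_le_rpow (not_lt.1 hcon) (show 0 ≤ 2 / (((N : ℝ) - 2) * (1 - β)) by
      positivity)) (not_le.2 e2)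
  -- The part of the profile on [2δ, 1-2δ], which truncation leaves unchanged, has nearly the full
  -- height c.
  have hlim : Tendsto (fun δ : ℝ => α * (c * ((1 - 2 * δ) ^ (1 - β) - (2 * δ) ^ (1 - β))) ^ γ)
      (𝓝[>] 0) (𝓝 (α * c ^ γ)) := by
    have hcont : Continuous fun δ : ℝ =>
        α * (c * ((1 - 2 * δ) ^ (1 - β) - (2 * δ) ^ (1 - β))) ^ γ := by
      refine continuous_const.mul (Continuous.rpow_const ?_ fun _ => Or.inr hγ.le)
      refine continuous_const.mul (Continuous.sub ?_ ?_)
      · exact Continuous.rpow_const (by fun_prop) fun _ => Or.inr h2.le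
      · exact Continuous.rpow_const (by fun_prop) fun _ => Or.inr h2.le
    have := hcont.tendsto 0
    simp only [mul_zero, sub_zero, Real.one_rpow, Real.zero_rpow h2.ne', mul_one] at this
    exact this.mono_left nhdsWithin_le_nhds
  have hgt : (N : ℝ) < α * c ^ γ := by
    rw [hcγ, mul_div_assoc', lt_div_iff₀ hα'0, mul_comm]
    gcongr
  obtain ⟨δ, hδ, hδ0, hδ1⟩ := ((hlim.eventually_const_lt hgt).and (Ioo_mem_nhdsGT
    (show (0 : ℝ) < 1 / 4 by norm_num))).exists
  set ζ : ℝ → ℝ := fun y => c * (1 - β) * (y ^ (-β) * smoothPlateau δ y) with hζ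
  have hζ1 : ContDiff ℝ ∞ ζ := by
    refine contDiff_const.mul (contDiff_iff_contDiffAt.2 fun y => ?_)
    by_cases hy : y < δ
    · refine (contDiffAt_const (c := (0 : ℝ))).congr_of_eventuallyEq ?_
      filter_upwards [Iio_mem_nhds hy] with t ht
      rw [smoothPlateau_eq_zero_of_le hδ0 (le_of_lt ht), mul_zero]
    · have hy0 : y ≠ 0 := (hδ0.trans_le (not_lt.1 hy)).ne'
      exact (Real.contDiffAt_rpow_const_of_ne hy0).mul (smoothPlateau_contDiff δ).contDiffAt
  have hζl : ∀ y, y ≤ δ → ζ y = 0 := fun y hy => by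
    simp [hζ, smoothPlateau_eq_zero_of_le hδ0 hy]
  have hζr : ∀ y, 1 - δ ≤ y → ζ y = 0 := fun y hy => by
    simp [hζ, smoothPlateau_eq_zero_of_ge hδ0 hy]
  have hζ0 : ∀ y, 0 ≤ ζ y := fun y => by
    rcases le_or_gt y δ with hy | hy
    · rw [hζl y hy]
    · have : 0 < y := hδ0.trans hy
      have := smoothPlateau_nonneg δ y
      positivity
  have hb0 : 0 ≤ β * (p - 1) := mul_nonneg hβ0.le (by rw [hp]; linarith)
  refine ⟨ζ, δ, hζ1, hδ0, by linarith, hζ0, hζl, hζr, ?_, ?_⟩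
  -- Truncation only decreases the energy, and without it the exponents combine as β(p-1) - βp = -β.
  · have hle : ∀ y ∈ Ioc (0 : ℝ) 1, y ^ (β * (p - 1)) * |((N : ℝ) - 2) * ζ y| ^ p ≤
        (((N : ℝ) - 2) * (c * (1 - β))) ^ p * y ^ (-β) := fun y hy => by
      have hy0 := hy.1
      rw [abs_of_nonneg (mul_nonneg h1.le (hζ0 y))]
      have h3 : ((N : ℝ) - 2) * ζ y ≤ ((N : ℝ) - 2) * (c * (1 - β)) * y ^ (-β) := by
        have h4 : y ^ (-β) * smoothPlateau δ y ≤ y ^ (-β) :=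
          mul_le_of_le_one_right (by positivity) (smoothPlateau_le_one δ y)
        calc ((N : ℝ) - 2) * ζ y =
            ((N : ℝ) - 2) * (c * (1 - β)) * (y ^ (-β) * smoothPlateau δ y) := by
              simp only [hζ]; ring
          _ ≤ _ := by gcongr
      calc y ^ (β * (p - 1)) * (((N : ℝ) - 2) * ζ y) ^ p
          ≤ y ^ (β * (p - 1)) * (((N : ℝ) - 2) * (c * (1 - β)) * y ^ (-β)) ^ p := by
            gcongr
            exact mul_nonneg h1.le (hζ0 y)
        _ = (((N : ℝ) - 2) * (c * (1 - β))) ^ p * y ^ (-β) := by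
            rw [Real.mul_rpow (by positivity) (by positivity), ← Real.rpow_mul hy0.le,
              mul_left_comm, ← Real.rpow_add hy0]
            congr 2
            ring
    have hint : IntervalIntegrable (fun y : ℝ => y ^ (-β)) volume 0 1 :=
      intervalIntegral.intervalIntegrable_rpow' (by linarith)
    have hcz : Continuous fun y : ℝ => y ^ (β * (p - 1)) * |((N : ℝ) - 2) * ζ y| ^ p :=
      (Real.continuous_rpow_const hb0).mul
        ((continuous_const.mul hζ1.continuous).abs.rpow_const fun _ => Or.inr hp0.le)
    have hI : ∫ y in (0 : ℝ)..1, y ^ (β * (p - 1)) * |((N : ℝ) - 2) * ζ y| ^ p ≤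
        ∫ y in (0 : ℝ)..1, (((N : ℝ) - 2) * (c * (1 - β))) ^ p * y ^ (-β) := by
      rw [intervalIntegral.integral_of_le zero_le_one, intervalIntegral.integral_of_le zero_le_one]
      refine setIntegral_mono_on ?_ ?_ measurableSet_Ioc hle
      · exact (hcz.integrableOn_Icc).mono_set Ioc_subset_Icc_self
      · exact ((intervalIntegrable_iff_integrableOn_Ioc_of_le zero_le_one).1 hint).const_mul _
    rw [intervalIntegral.integral_const_mul, integral_rpow (Or.inl (by linarith)),
      Real.one_rpow, Real.zero_rpow (by linarith)] at hI
    refine lt_of_le_of_lt (mul_le_mul_of_nonneg_left hI hS.le) ?_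
    refine lt_of_eq_of_lt ?_ hcrit
    rw [Real.mul_rpow (by positivity) (by positivity), Real.mul_rpow (by positivity)
      (by positivity), Real.rpow_sub_one h2.ne', show -β + 1 = 1 - β by ring]
    field_simp
    ring
  · refine hδ.trans_le ?_
    have hmono : (2 * δ) ^ (1 - β) ≤ (1 - 2 * δ) ^ (1 - β) :=
      Real.rpow_le_rpow (by linarith) (by linarith) h2.le
    have hI : c * ((1 - 2 * δ) ^ (1 - β) - (2 * δ) ^ (1 - β)) ≤ ∫ y in (0 : ℝ)..1, ζ y := by
      have e1 : ∫ y in (2 * δ)..(1 - 2 * δ), ζ y =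
          c * ((1 - 2 * δ) ^ (1 - β) - (2 * δ) ^ (1 - β)) := by
        rw [intervalIntegral.integral_congr (g := fun y => c * (1 - β) * y ^ (-β)) fun y hy => by
          rw [uIcc_of_le (by linarith)] at hy
          simp only [hζ]
          rw [smoothPlateau_eq_one hδ0 hy.1 hy.2, mul_one]]
        rw [intervalIntegral.integral_const_mul, integral_rpow (Or.inl (by linarith)),
          show -β + 1 = 1 - β by ring]
        field_simp
      rw [← e1]
      exact intervalIntegral.integral_mono_interval (by linarith) (by linarith) (by linarith)
        (Eventually.of_forall hζ0) (hζ1.continuous.intervalIntegrable _ _)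
    gcongr

/-! ### Concentrating functions -/

/-- The radial derivative of the concentrating function `k^θ η(-log r / k)` with `η' = ζ`. -/
noncomputable def concSlope (θ : ℝ) (ζ : ℝ → ℝ) (k s : ℝ) : ℝ :=
  -(k ^ (θ - 1)) * (ζ (-Real.log s / k) / s)

section Concentration

variable {θ δ k : ℝ} {ζ : ℝ → ℝ}

theorem concSlope_eq_zero_of_abs_lt (hk : 0 < k) (hδ : 0 < δ) (hr : ∀ y, 1 - δ ≤ y → ζ y = 0)
    {s : ℝ} (hs : |s| < Real.exp (-k)) : concSlope θ ζ k s = 0 := by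
  by_cases h0 : s = 0
  · simp [concSlope, h0]
  · have h1 : Real.log s < -k := by
      rw [← Real.log_abs, ← Real.log_exp (-k)]
      exact Real.log_lt_log (abs_pos.2 h0) hs
    have h2 : 1 ≤ -Real.log s / k := by
      rw [le_div_iff₀ hk]; linarith
    rw [concSlope, hr _ (by linarith), zero_div, mul_zero]

theorem concSlope_eq_zero_of_ge (hk : 0 < k) (hl : ∀ y, y ≤ δ → ζ y = 0)
    {s : ℝ} (hs : Real.exp (-(k * δ)) ≤ s) : concSlope θ ζ k s = 0 := by
  have h1 : -(k * δ) ≤ Real.log s := by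
    rw [← Real.log_exp (-(k * δ))]
    exact Real.log_le_log (Real.exp_pos _) hs
  have h2 : -Real.log s / k ≤ δ := by
    rw [div_le_iff₀ hk]; linarith
  rw [concSlope, hl _ h2, zero_div, mul_zero]

theorem concSlope_hasDerivAt (hζ : ContDiff ℝ ∞ ζ) (hk : 0 < k) {s : ℝ} (hs : 0 < s) :
    HasDerivAt (concSlope θ ζ k) (k ^ (θ - 1) * s⁻¹ ^ 2 *
      (deriv ζ (-Real.log s / k) / k + ζ (-Real.log s / k))) s := by
  have h1 : HasDerivAt ζ (deriv ζ (-Real.log s / k)) (-Real.log s / k) :=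
    (hζ.contDiffAt.differentiableAt (by simp)).hasDerivAt
  have h2 : HasDerivAt (fun s => -Real.log s / k) (-s⁻¹ / k) s :=
    (Real.hasDerivAt_log hs.ne').neg.div_const k
  have h3 := ((h1.comp s h2).div (hasDerivAt_id s) hs.ne').const_mul (-(k ^ (θ - 1)))
  refine h3.congr_deriv ?_
  simp
  field_simp
  ring

theorem concSlope_contDiff (hζ : ContDiff ℝ ∞ ζ) (hk : 0 < k) (hδ : 0 < δ)
    (hr : ∀ y, 1 - δ ≤ y → ζ y = 0) : ContDiff ℝ ∞ (concSlope θ ζ k) := by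
  rw [contDiff_iff_contDiffAt]
  intro s
  by_cases hs : s = 0
  · refine (contDiffAt_const (c := (0 : ℝ))).congr_of_eventuallyEq ?_
    rw [hs]
    filter_upwards [Metric.ball_mem_nhds (0 : ℝ) (Real.exp_pos (-k))] with t ht
    exact concSlope_eq_zero_of_abs_lt hk hδ hr (by simpa using ht)
  · unfold concSlope
    refine contDiffAt_const.mul (ContDiffAt.div ?_ contDiffAt_id hs)
    exact hζ.contDiffAt.comp s ((Real.contDiffAt_log.2 hs).neg.div_const k)

/-- The concentrating functions. -/
noncomputable def concFun (N : ℕ) (θ δ : ℝ) (ζ : ℝ → ℝ) (k : ℝ) : Rn N → ℝ :=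
  radialPrimitive N (concSlope θ ζ k) (Real.exp (-(k * δ)))

theorem concFun_eq {N : ℕ} (hζ : ContDiff ℝ ∞ ζ) (hk : 0 < k) (hδ : 0 < δ)
    (hr : ∀ y, 1 - δ ≤ y → ζ y = 0) {x : Rn N} (hx : x ≠ 0) :
    concFun N θ δ ζ k x = k ^ θ * ∫ y in δ..(-Real.log ‖x‖ / k), ζ y := by
  have hx0 : 0 < ‖x‖ := norm_pos_iff.2 hx
  have hb := Real.exp_pos (-(k * δ))
  have hd : ∀ s ∈ uIcc (Real.exp (-(k * δ))) ‖x‖,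
      HasDerivAt (fun s => k ^ θ * ∫ y in δ..(-Real.log s / k), ζ y) (concSlope θ ζ k s) s := by
    intro s hs
    have hs0 : 0 < s := (lt_min hb hx0).trans_le hs.1
    have h1 : HasDerivAt (fun t => ∫ y in δ..t, ζ y) (ζ (-Real.log s / k)) (-Real.log s / k) :=
      intervalIntegral.integral_hasDerivAt_right (hζ.continuous.intervalIntegrable _ _)
        (hζ.continuous.stronglyMeasurableAtFilter _ _) hζ.continuous.continuousAt
    have h2 : HasDerivAt (fun s => -Real.log s / k) (-s⁻¹ / k) s :=
      (Real.hasDerivAt_log hs0.ne').neg.div_const k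
    refine ((h1.comp s h2).const_mul (k ^ θ)).congr_deriv ?_
    rw [concSlope, Real.rpow_sub_one hk.ne']
    field_simp
  rw [concFun, radialPrimitive, intervalIntegral.integral_eq_sub_of_hasDerivAt hd
    ((concSlope_contDiff hζ hk hδ hr).continuous.intervalIntegrable _ _), Real.log_exp, neg_neg,
    mul_div_cancel_left₀ _ hk.ne', intervalIntegral.integral_same, mul_zero, sub_zero]

theorem integral_profile_le (hζ : ContDiff ℝ ∞ ζ) (h0 : ∀ y, 0 ≤ ζ y) (hδ0 : 0 < δ)
    (hl : ∀ y, y ≤ δ → ζ y = 0) (hr : ∀ y, 1 - δ ≤ y → ζ y = 0) {t : ℝ} :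
    |∫ y in δ..t, ζ y| ≤ ∫ y in (0 : ℝ)..1, ζ y := by
  have hi : ∀ a b : ℝ, IntervalIntegrable ζ volume a b :=
    fun a b => hζ.continuous.intervalIntegrable _ _
  have hI0 : 0 ≤ ∫ y in (0 : ℝ)..1, ζ y :=
    intervalIntegral.integral_nonneg zero_le_one fun y _ => h0 y
  rcases le_total t δ with h | h
  · rw [intervalIntegral.integral_zero_ae (Eventually.of_forall fun y hy => hl y ?_), abs_zero]
    · exact hI0
    · rw [uIoc_of_ge h] at hy
      exact hy.2
  · rw [abs_of_nonneg (intervalIntegral.integral_nonneg h fun y _ => h0 y)]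
    calc ∫ y in δ..t, ζ y ≤ ∫ y in (0 : ℝ)..(max t 1), ζ y :=
        intervalIntegral.integral_mono_interval hδ0.le h (le_max_left _ _)
          (Eventually.of_forall h0) (hi _ _)
      _ = ∫ y in (0 : ℝ)..1, ζ y := by
        rw [← intervalIntegral.integral_add_adjacent_intervals (hi 0 1) (hi 1 _),
          intervalIntegral.integral_zero_ae (a := 1), add_zero]
        refine Eventually.of_forall fun y hy => hr y ?_
        rw [uIoc_of_le (le_max_right _ _)] at hy
        linarith [hy.1]

theorem integral_profile_eq (hζ : ContDiff ℝ ∞ ζ) (hδ0 : 0 < δ)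
    (hl : ∀ y, y ≤ δ → ζ y = 0) (hr : ∀ y, 1 - δ ≤ y → ζ y = 0) {t : ℝ} (ht : 1 ≤ t) :
    ∫ y in δ..t, ζ y = ∫ y in (0 : ℝ)..1, ζ y := by
  have hi : ∀ a b : ℝ, IntervalIntegrable ζ volume a b :=
    fun a b => hζ.continuous.intervalIntegrable _ _
  rw [← intervalIntegral.integral_add_adjacent_intervals (hi δ 1) (hi 1 t),
    ← intervalIntegral.integral_add_adjacent_intervals (hi 0 δ) (hi δ 1),
    intervalIntegral.integral_zero_ae (a := 1) (Eventually.of_forall fun y hy => hr y ?_),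
    intervalIntegral.integral_zero_ae (a := 0) (Eventually.of_forall fun y hy => hl y ?_),
    add_zero, zero_add]
  · rw [uIoc_of_le hδ0.le] at hy
    exact hy.2
  · rw [uIoc_of_le ht] at hy
    linarith [hy.1]

theorem laplacian_concFun {N : ℕ} (hζ : ContDiff ℝ ∞ ζ) (hk : 0 < k) (hδ : 0 < δ)
    (hr : ∀ y, 1 - δ ≤ y → ζ y = 0) {x : Rn N} (hx : x ≠ 0) :
    (Δ (concFun N θ δ ζ k)) x = k ^ (θ - 1) * ‖x‖⁻¹ ^ 2 *
      (deriv ζ (-Real.log ‖x‖ / k) / k - ((N : ℝ) - 2) * ζ (-Real.log ‖x‖ / k)) := by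
  have hx0 : 0 < ‖x‖ := norm_pos_iff.2 hx
  rw [concFun, laplacian_radialPrimitive (Real.exp_pos (-k)) (concSlope_contDiff hζ hk hδ hr)
    (fun s hs => concSlope_eq_zero_of_abs_lt hk hδ hr hs) hx,
    (concSlope_hasDerivAt hζ hk hx0).deriv, concSlope]
  field_simp
  ring

/-- The substitution y = -log r / k, which carries the scale-invariant measure dr/r to k dy. -/
theorem integral_log_subst {g : ℝ → ℝ} (hk : 0 < k) (hg : ContinuousOn g (Icc 0 1)) :
    ∫ r in (Real.exp (-k))..1, r⁻¹ * g (-Real.log r / k) = k * ∫ y in (0 : ℝ)..1, g y := by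
  have h1 : Real.exp (-k) ≤ 1 := Real.exp_le_one_iff.2 (by linarith)
  have hpos : ∀ r ∈ uIcc (Real.exp (-k)) 1, 0 < r := fun r hr => by
    rw [uIcc_of_le h1] at hr
    exact (Real.exp_pos _).trans_le hr.1
  have him : (fun r => -Real.log r / k) '' uIcc (Real.exp (-k)) 1 ⊆ Icc 0 1 := by
    rintro _ ⟨r, hr, rfl⟩
    have hr0 := hpos r hr
    rw [uIcc_of_le h1] at hr
    have h2 : -k ≤ Real.log r := by
      rw [← Real.log_exp (-k)]
      exact Real.log_le_log (Real.exp_pos _) hr.1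
    have h3 := Real.log_nonpos hr0.le hr.2
    exact ⟨div_nonneg (by linarith) hk.le, by rw [div_le_one hk]; linarith⟩
  have := intervalIntegral.integral_comp_mul_deriv' (f := fun r => -Real.log r / k)
    (f' := fun r => -r⁻¹ / k) (g := g) (a := Real.exp (-k)) (b := 1)
    (fun r hr => (Real.hasDerivAt_log (hpos r hr).ne').neg.div_const k)
    ((ContinuousOn.inv₀ continuousOn_id fun r hr => (hpos r hr).ne').neg.div_const k)
    (hg.mono him)
  simp only [Function.comp_apply, Real.log_exp, neg_neg, div_self hk.ne', Real.log_one, neg_zero,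
    zero_div] at this
  rw [intervalIntegral.integral_symm 0 1] at this
  rw [← neg_neg (∫ y in (0 : ℝ)..1, g y), ← this, mul_neg, ← neg_mul,
    ← intervalIntegral.integral_const_mul]
  refine intervalIntegral.integral_congr fun r _ => ?_
  field_simp

theorem deriv_profile_eq_zero (hl : ∀ y, y ≤ δ → ζ y = 0) {y : ℝ} (hy : y < δ) :
    deriv ζ y = 0 := by
  have : ζ =ᶠ[𝓝 y] fun _ => 0 := by
    filter_upwards [Iio_mem_nhds hy] with t ht
    exact hl t (le_of_lt ht)
  simp [this.deriv_eq]

theorem deriv_profile_eq_zero' (hr : ∀ y, 1 - δ ≤ y → ζ y = 0) {y : ℝ} (hy : 1 - δ < y) :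
    deriv ζ y = 0 := by
  have : ζ =ᶠ[𝓝 y] fun _ => 0 := by
    filter_upwards [Ioi_mem_nhds hy] with t ht
    exact hr t (le_of_lt ht)
  simp [this.deriv_eq]

/-- With the first coordinate standing for 1/k, joint continuity down to zero gives convergence of
the energies as k tends to infinity. -/
theorem continuous_energyDensity {N : ℕ} (hN : 4 ≤ N) {β : ℝ} (hβ0 : 0 ≤ β)
    (hζ : ContDiff ℝ ∞ ζ) : Continuous fun z : ℝ × ℝ =>
      (z.1 + z.2) ^ (β * ((N : ℝ) / 2 - 1)) *
        |deriv ζ z.2 * z.1 - ((N : ℝ) - 2) * ζ z.2| ^ ((N : ℝ) / 2) := by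
  have hN' : (4 : ℝ) ≤ N := by exact_mod_cast hN
  have h1 : Continuous (deriv ζ) := hζ.continuous_deriv (by simp)
  have h2 := hζ.continuous
  refine Continuous.mul (Continuous.rpow_const (by fun_prop) fun _ => Or.inr ?_)
    (Continuous.rpow_const (by fun_prop) fun _ => Or.inr (by positivity))
  exact mul_nonneg hβ0 (by linarith)

/-- On the annulus e^{-k} < |x| < 1 one has ℓ = k(1/k + y), and the change of variables contributes
one more power of k. The hypothesis on θ is that all powers of k cancel. -/
theorem lintegral_weight_laplacian_concFun {N : ℕ} (hN : 4 ≤ N) {β : ℝ} (hβ0 : 0 ≤ β)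
    {χ : ℝ → ℝ} (hζ : ContDiff ℝ ∞ ζ) (hk : 0 < k) (hδ : 0 < δ) (hδ1 : δ < 1)
    (hl : ∀ y, y ≤ δ → ζ y = 0) (hr : ∀ y, 1 - δ ≤ y → ζ y = 0)
    (hθ : (θ - 1) * ((N : ℝ) / 2) + 1 + β * ((N : ℝ) / 2 - 1) = 0) :
    ∫⁻ x : Rn N, ENNReal.ofReal
        (weight N β χ x * |(Δ (concFun N θ δ ζ k)) x| ^ ((N : ℝ) / 2)) ≤
      ENNReal.ofReal (sphereArea N * ∫ y in (0 : ℝ)..1, (k⁻¹ + y) ^ (β * ((N : ℝ) / 2 - 1)) *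
        |deriv ζ y * k⁻¹ - ((N : ℝ) - 2) * ζ y| ^ ((N : ℝ) / 2)) := by
  have hN0 : 0 < N := by omega
  have hN' : (4 : ℝ) ≤ N := by exact_mod_cast hN
  have : Nonempty (Fin N) := ⟨⟨0, hN0⟩⟩
  have hp0 : (0 : ℝ) < (N : ℝ) / 2 := by linarith
  set g : ℝ → ℝ := fun y => (k⁻¹ + y) ^ (β * ((N : ℝ) / 2 - 1)) *
        |deriv ζ y * k⁻¹ - ((N : ℝ) - 2) * ζ y| ^ ((N : ℝ) / 2) with hg
  have hgc : Continuous g := (continuous_energyDensity hN hβ0 hζ).comp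
    (continuous_const.prodMk continuous_id)
  have he1 : Real.exp (-k) ≤ 1 := Real.exp_le_one_iff.2 (by linarith)
  have hlog : ∀ r ∈ Ioc (Real.exp (-k)) 1, 0 < r ∧ -Real.log r / k ∈ Icc (0 : ℝ) 1 := by
    intro r hr
    have hr0 := (Real.exp_pos (-k)).trans hr.1
    have h2 : -k ≤ Real.log r := by
      rw [← Real.log_exp (-k)]
      exact Real.log_le_log (Real.exp_pos _) hr.1.le
    have h3 := Real.log_nonpos hr0.le hr.2
    exact ⟨hr0, div_nonneg (by linarith) hk.le, by rw [div_le_one hk]; linarith⟩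
  set F : ℝ → ℝ := (Ioc (Real.exp (-k)) 1).indicator
    fun r => (r ^ N)⁻¹ * (k⁻¹ * g (-Real.log r / k)) with hF
  have hF0 : ∀ r, 0 ≤ r → 0 ≤ F r := fun r _ => indicator_nonneg (fun s hs => by
    obtain ⟨h1, h2⟩ := hlog s hs
    have h3 : 0 ≤ k⁻¹ + -Real.log s / k := add_nonneg (by positivity) h2.1
    have h4 : 0 ≤ g (-Real.log s / k) :=
      mul_nonneg (Real.rpow_nonneg h3 _) (Real.rpow_nonneg (abs_nonneg _) _)
    positivity) r
  have e : ∀ y : ℝ, y ^ (N - 1) * F y = (Ioc (Real.exp (-k)) 1).indicator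
      (fun r => k⁻¹ * (r⁻¹ * g (-Real.log r / k))) y := fun y => by
    by_cases hy : y ∈ Ioc (Real.exp (-k)) 1
    · simp only [hF, indicator_of_mem hy]
      have := (hlog y hy).1.ne'
      obtain ⟨n, rfl⟩ : ∃ n, N = n + 1 := ⟨N - 1, by omega⟩
      simp only [Nat.add_sub_cancel]
      field_simp
      ring
    · simp only [hF, indicator_of_notMem hy, mul_zero]
  have hci : ContinuousOn (fun r => k⁻¹ * (r⁻¹ * g (-Real.log r / k)))
      (Icc (Real.exp (-k)) 1) := by
    have hne : ∀ r ∈ Icc (Real.exp (-k)) 1, r ≠ 0 := fun r hr =>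
      ((Real.exp_pos _).trans_le hr.1).ne'
    exact continuousOn_const.mul ((continuousOn_id.inv₀ hne).mul (hgc.comp_continuousOn
      ((continuousOn_id.log hne).neg.div_const k)))
  have hi : IntegrableOn (fun y : ℝ => y ^ (N - 1) * F y) (Ioi 0) := by
    simp_rw [e]
    refine Integrable.integrableOn ?_
    rw [integrable_indicator_iff measurableSet_Ioc]
    exact hci.integrableOn_Icc.mono_set Ioc_subset_Icc_self
  calc ∫⁻ x : Rn N, ENNReal.ofReal
        (weight N β χ x * |(Δ (concFun N θ δ ζ k)) x| ^ ((N : ℝ) / 2))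
      ≤ ∫⁻ x : Rn N, ENNReal.ofReal (F ‖x‖) := by
        refine lintegral_mono_ae ?_
        filter_upwards [compl_mem_ae_iff.2 (measure_singleton (0 : Rn N))] with x hx0
        have hx0 : x ≠ 0 := by simpa using hx0
        have hn0 : 0 < ‖x‖ := norm_pos_iff.2 hx0
        refine ENNReal.ofReal_le_ofReal ?_
        rw [laplacian_concFun hζ hk hδ hr hx0]
        by_cases hx : ‖x‖ ∈ Ioo (Real.exp (-k)) 1
        · have hx' : ‖x‖ ∈ Ioc (Real.exp (-k)) 1 := ⟨hx.1, hx.2.le⟩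
          obtain ⟨-, hy⟩ := hlog _ hx'
          rw [hF, indicator_of_mem hx', weight_of_mem hx.2]
          set y := -Real.log ‖x‖ / k with hydef
          have hky : 0 < k⁻¹ + y := add_pos_of_pos_of_nonneg (by positivity) hy.1
          have h1 : ell ‖x‖ = k * (k⁻¹ + y) := by
            rw [ell_eq hn0, hydef]; field_simp; ring
          have h2 : (‖x‖⁻¹ ^ 2) ^ ((N : ℝ) / 2) = (‖x‖ ^ N)⁻¹ := by
            rw [← Real.rpow_natCast, ← Real.rpow_mul (by positivity),
              show ((2 : ℕ) : ℝ) * ((N : ℝ) / 2) = N by push_cast; ring, Real.rpow_natCast, inv_pow]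
          have h3 : k ^ (β * ((N : ℝ) / 2 - 1)) * k ^ ((θ - 1) * ((N : ℝ) / 2)) = k⁻¹ := by
            rw [← Real.rpow_add hk, ← Real.rpow_neg_one]
            congr 1
            linarith
          rw [h1, Real.mul_rpow hk.le hky.le, abs_mul, abs_of_pos (show
            0 < k ^ (θ - 1) * ‖x‖⁻¹ ^ 2 by positivity), Real.mul_rpow (by positivity)
            (abs_nonneg _), Real.mul_rpow (by positivity) (by positivity), ← Real.rpow_mul hk.le,
            h2]
          have h4 : g y = (k⁻¹ + y) ^ (β * ((N : ℝ) / 2 - 1)) *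
            |deriv ζ y / k - ((N : ℝ) - 2) * ζ y| ^ ((N : ℝ) / 2) := by
            simp only [hg, div_eq_mul_inv (deriv ζ y) k]
          generalize g y = gy at h4 ⊢
          rw [h4, ← h3]
          refine le_of_eq ?_
          generalize (k⁻¹ + y) ^ (β * ((N : ℝ) / 2 - 1)) = X
          ring
        -- Off the annulus y lies outside (0, 1), where the profile and its derivative both vanish.
        · have hz : deriv ζ (-Real.log ‖x‖ / k) / k - ((N : ℝ) - 2) * ζ (-Real.log ‖x‖ / k) = 0 := by
            rcases not_and_or.1 hx with h | h
            · have h1 : Real.log ‖x‖ ≤ -k := by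
                rw [← Real.log_exp (-k)]
                exact Real.log_le_log hn0 (not_lt.1 h)
              have h2 : 1 ≤ -Real.log ‖x‖ / k := by
                rw [le_div_iff₀ hk]; linarith
              rw [deriv_profile_eq_zero' hr (by linarith), hr _ (by linarith)]
              simp
            · have h1 := Real.log_nonneg (not_lt.1 h)
              have h2 : -Real.log ‖x‖ / k ≤ 0 :=
                div_nonpos_of_nonpos_of_nonneg (by linarith) hk.le
              rw [deriv_profile_eq_zero hl (by linarith), hl _ (by linarith)]
              simp
          rw [hz, mul_zero, abs_zero, Real.zero_rpow hp0.ne', mul_zero]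
          exact hF0 _ (norm_nonneg x)
    _ = _ := by
        rw [lintegral_radial hN0 hF0 hi]
        congr 2
        simp_rw [e]
        rw [setIntegral_indicator measurableSet_Ioc, inter_eq_self_of_subset_right
          (show Ioc (Real.exp (-k)) 1 ⊆ Ioi 0 from fun r hr => (hlog r hr).1),
          ← intervalIntegral.integral_of_le he1, intervalIntegral.integral_const_mul,
          integral_log_subst hk hgc.continuousOn]
        field_simp

theorem concFun_eq_zero {N : ℕ} (hk : 0 < k) (hl : ∀ y, y ≤ δ → ζ y = 0) {x : Rn N}
    (hx : Real.exp (-(k * δ)) ≤ ‖x‖) : concFun N θ δ ζ k x = 0 :=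
  radialPrimitive_eq_zero (fun _ hs => concSlope_eq_zero_of_ge hk hl hs) hx

/-- The slope is at most Z/r and lives in r ≤ e^{-kδ} ≤ 1. There r^{-N/2} ≤ r^{1-N}, so the polar
weight cancels and the length of the interval remains. -/
theorem lintegral_gradVec_concFun {N : ℕ} (hN : 4 ≤ N) (hζ : ContDiff ℝ ∞ ζ) (hk : 1 ≤ k)
    (hθ : θ ≤ 1) (hδ : 0 < δ) (hl : ∀ y, y ≤ δ → ζ y = 0) (hr : ∀ y, 1 - δ ≤ y → ζ y = 0)
    {Z : ℝ} (hZ : ∀ y, |ζ y| ≤ Z) :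
    ∫⁻ x : Rn N, ENNReal.ofReal (‖gradVec (concFun N θ δ ζ k) x‖ ^ ((N : ℝ) / 2)) ≤
      ENNReal.ofReal (sphereArea N * (Z ^ ((N : ℝ) / 2) * Real.exp (-(k * δ)))) := by
  have hN0 : 0 < N := by omega
  have hN' : (4 : ℝ) ≤ N := by exact_mod_cast hN
  have hk0 : 0 < k := by linarith
  have : Nonempty (Fin N) := ⟨⟨0, hN0⟩⟩
  have hZ0 : 0 ≤ Z := (abs_nonneg _).trans (hZ 0)
  have hp0 : (0 : ℝ) < (N : ℝ) / 2 := by linarith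
  set b := Real.exp (-(k * δ)) with hb
  have hb0 : 0 < b := Real.exp_pos _
  have hb1 : b ≤ 1 := Real.exp_le_one_iff.2 (by nlinarith)
  set F : ℝ → ℝ := (Ioc 0 b).indicator fun r => Z ^ ((N : ℝ) / 2) * (r ^ (N - 1))⁻¹ with hF
  have hF0 : ∀ r, 0 ≤ r → 0 ≤ F r := fun r _ => indicator_nonneg (fun s hs => by
    have := hs.1
    positivity) r
  have e : ∀ y : ℝ, y ^ (N - 1) * F y = (Ioc 0 b).indicator
      (fun _ => Z ^ ((N : ℝ) / 2)) y := fun y => by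
    by_cases hy : y ∈ Ioc 0 b
    · simp only [hF, indicator_of_mem hy]
      have := hy.1.ne'
      field_simp
    · simp only [hF, indicator_of_notMem hy, mul_zero]
  have hi : IntegrableOn (fun y : ℝ => y ^ (N - 1) * F y) (Ioi 0) := by
    simp_rw [e]
    refine Integrable.integrableOn ?_
    rw [integrable_indicator_iff measurableSet_Ioc]
    exact continuousOn_const.integrableOn_Icc.mono_set Ioc_subset_Icc_self
  calc ∫⁻ x : Rn N, ENNReal.ofReal (‖gradVec (concFun N θ δ ζ k) x‖ ^ ((N : ℝ) / 2))
      ≤ ∫⁻ x : Rn N, ENNReal.ofReal (F ‖x‖) := by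
        refine lintegral_mono_ae ?_
        filter_upwards [compl_mem_ae_iff.2 (measure_singleton (0 : Rn N))] with x hx0
        have hx0 : x ≠ 0 := by simpa using hx0
        have hn0 : 0 < ‖x‖ := norm_pos_iff.2 hx0
        refine ENNReal.ofReal_le_ofReal ?_
        rw [concFun, norm_gradVec_radialPrimitive (Real.exp_pos (-k))
          (concSlope_contDiff hζ hk0 hδ hr) fun s hs => concSlope_eq_zero_of_abs_lt hk0 hδ hr hs]
        by_cases hx : ‖x‖ ∈ Ioc 0 b
        · rw [hF, indicator_of_mem hx, concSlope, abs_mul, abs_neg, abs_div, abs_norm]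
          have h1 : |k ^ (θ - 1)| ≤ 1 := by
            rw [abs_of_pos (by positivity)]
            exact Real.rpow_le_one_of_one_le_of_nonpos hk (by linarith)
          have h2 : |k ^ (θ - 1)| * (|ζ (-Real.log ‖x‖ / k)| / ‖x‖) ≤ 1 * (Z / ‖x‖) := by
            gcongr
            exact hZ _
          refine (Real.rpow_le_rpow (by positivity) h2 hp0.le).trans ?_
          rw [one_mul, Real.div_rpow hZ0 hn0.le, div_eq_mul_inv]
          gcongr
          rw [← Real.rpow_natCast]
          refine Real.rpow_le_rpow_of_exponent_ge hn0 (hx.2.trans hb1) ?_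
          rw [Nat.cast_sub (by omega)]
          push_cast
          linarith
        · have h1 : b ≤ ‖x‖ := by
            by_contra hc
            exact hx ⟨hn0, (not_le.1 hc).le⟩
          rw [concSlope_eq_zero_of_ge hk0 hl h1, abs_zero, Real.zero_rpow hp0.ne']
          exact hF0 _ hn0.le
    _ = _ := by
        rw [lintegral_radial hN0 hF0 hi]
        congr 2
        simp_rw [e]
        rw [setIntegral_indicator measurableSet_Ioc, inter_eq_self_of_subset_right
          (show Ioc 0 b ⊆ Ioi 0 from fun r hr => hr.1), setIntegral_const]
        simp [hb0.le, mul_comm]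

/-- The function is bounded by k ∫ζ and supported in a ball of radius e^{-kδ}, so exponential decay
beats the power of k. -/
theorem lintegral_concFun {N : ℕ} (hN : 4 ≤ N) (hζ : ContDiff ℝ ∞ ζ) (hk : 1 ≤ k)
    (hθ : θ ≤ 1) (hδ : 0 < δ) (h0 : ∀ y, 0 ≤ ζ y) (hl : ∀ y, y ≤ δ → ζ y = 0)
    (hr : ∀ y, 1 - δ ≤ y → ζ y = 0) :
    ∫⁻ x : Rn N, ENNReal.ofReal (|concFun N θ δ ζ k x| ^ ((N : ℝ) / 2)) ≤
      ENNReal.ofReal ((∫ y in (0 : ℝ)..1, ζ y) ^ ((N : ℝ) / 2) * ballVolume N *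
        (k ^ ((N : ℝ) / 2) * Real.exp (-(δ * k)))) := by
  have hN0 : 0 < N := by omega
  have hN' : (4 : ℝ) ≤ N := by exact_mod_cast hN
  have hk0 : 0 < k := by linarith
  have : Nonempty (Fin N) := ⟨⟨0, hN0⟩⟩
  have hp0 : (0 : ℝ) < (N : ℝ) / 2 := by linarith
  have hV := ballVolume_pos N
  set I := ∫ y in (0 : ℝ)..1, ζ y with hI
  have hI0 : 0 ≤ I := intervalIntegral.integral_nonneg zero_le_one fun y _ => h0 y
  set b := Real.exp (-(k * δ)) with hb
  have hb0 : 0 < b := Real.exp_pos _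
  have hb1 : b ≤ 1 := Real.exp_le_one_iff.2 (by nlinarith)
  calc ∫⁻ x : Rn N, ENNReal.ofReal (|concFun N θ δ ζ k x| ^ ((N : ℝ) / 2))
      ≤ ∫⁻ x : Rn N, (Metric.ball (0 : Rn N) b).indicator
          (fun _ => ENNReal.ofReal ((k * I) ^ ((N : ℝ) / 2))) x := by
        refine lintegral_mono_ae ?_
        filter_upwards [compl_mem_ae_iff.2 (measure_singleton (0 : Rn N))] with x hx0
        have hx0 : x ≠ 0 := by simpa using hx0
        by_cases hx : ‖x‖ < b
        · rw [indicator_of_mem (by simpa using hx), concFun_eq hζ hk0 hδ hr hx0, abs_mul,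
            abs_of_pos (by positivity)]
          have h1 : k ^ θ ≤ k := by
            simpa using Real.rpow_le_rpow_of_exponent_le hk hθ
          have h2 := integral_profile_le hζ h0 hδ hl hr (t := -Real.log ‖x‖ / k)
          gcongr
        · rw [concFun_eq_zero hk0 hl (not_lt.1 hx), abs_zero, Real.zero_rpow hp0.ne']
          simp
    _ = ENNReal.ofReal ((k * I) ^ ((N : ℝ) / 2) * (b ^ N * ballVolume N)) := by
        rw [lintegral_indicator Metric.isOpen_ball.measurableSet, setLIntegral_const,
          volume_ball_eq hN0 hb0.le, ← ENNReal.ofReal_mul (by positivity)]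
    _ ≤ _ := by
        refine ENNReal.ofReal_le_ofReal ?_
        have h1 : b ^ N ≤ Real.exp (-(δ * k)) := by
          rw [mul_comm δ k, ← hb]
          exact pow_le_of_le_one hb0.le hb1 hN0.ne'
        rw [Real.mul_rpow hk0.le hI0]
        calc k ^ ((N : ℝ) / 2) * I ^ ((N : ℝ) / 2) * (b ^ N * ballVolume N)
            ≤ k ^ ((N : ℝ) / 2) * I ^ ((N : ℝ) / 2) * (Real.exp (-(δ * k)) * ballVolume N) := by
              gcongr
          _ = _ := by ring

/-- On the ball of radius e^{-k} the function equals k^θ ∫ζ, and θγ = 1 makes its γ-th power linear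
in k. This competes with the volume V_N e^{-kN}, which is where the threshold α(∫ζ)^γ > N comes
from. -/
theorem le_lintegral_exp_concFun {N : ℕ} (hN : 4 ≤ N) {α γ : ℝ} (hζ : ContDiff ℝ ∞ ζ)
    (hk : 0 < k) (hθ : θ * γ = 1) (hδ : 0 < δ) (h0 : ∀ y, 0 ≤ ζ y)
    (hl : ∀ y, y ≤ δ → ζ y = 0) (hr : ∀ y, 1 - δ ≤ y → ζ y = 0) :
    ENNReal.ofReal (ballVolume N *
        (Real.exp (k * (α * (∫ y in (0 : ℝ)..1, ζ y) ^ γ - N)) - Real.exp (-(k * N)))) ≤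
      ∫⁻ x in unitBall N, ENNReal.ofReal (Real.exp (α * |concFun N θ δ ζ k x| ^ γ) - 1) := by
  have hN0 : 0 < N := by omega
  have : Nonempty (Fin N) := ⟨⟨0, hN0⟩⟩
  set I := ∫ y in (0 : ℝ)..1, ζ y with hI
  have hI0 : 0 ≤ I := intervalIntegral.integral_nonneg zero_le_one fun y _ => h0 y
  have he := Real.exp_pos (-k)
  have hV := ballVolume_pos N
  have he1 : Real.exp (-k) ≤ 1 := Real.exp_le_one_iff.2 (by linarith)
  calc ENNReal.ofReal (ballVolume N * (Real.exp (k * (α * I ^ γ - N)) - Real.exp (-(k * N))))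
      = ∫⁻ x in Metric.ball (0 : Rn N) (Real.exp (-k)),
          ENNReal.ofReal (Real.exp (α * (k * I ^ γ)) - 1) := by
        rw [setLIntegral_const, volume_ball_eq hN0 he.le, ← ENNReal.ofReal_mul' (by positivity)]
        congr 1
        have h1 : Real.exp (-k) ^ N = Real.exp (-(k * N)) := by
          rw [← Real.exp_nat_mul]; congr 1; ring
        have h2 : Real.exp (k * (α * I ^ γ - N)) =
            Real.exp (α * (k * I ^ γ)) * Real.exp (-(k * N)) := by
          rw [← Real.exp_add]; congr 1; ring
        rw [h1, h2]
        ring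
    _ ≤ ∫⁻ x in Metric.ball (0 : Rn N) (Real.exp (-k)),
          ENNReal.ofReal (Real.exp (α * |concFun N θ δ ζ k x| ^ γ) - 1) := by
        refine lintegral_mono_ae ?_
        rw [ae_restrict_iff' Metric.isOpen_ball.measurableSet]
        filter_upwards [compl_mem_ae_iff.2 (measure_singleton (0 : Rn N))] with x hx0 hx
        have hx0 : x ≠ 0 := by simpa using hx0
        have hx : ‖x‖ < Real.exp (-k) := by simpa using hx
        have h1 : Real.log ‖x‖ ≤ -k := by
          rw [← Real.log_exp (-k)]
          exact Real.log_le_log (norm_pos_iff.2 hx0) hx.le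
        have h2 : 1 ≤ -Real.log ‖x‖ / k := by
          rw [le_div_iff₀ hk]; linarith
        rw [concFun_eq hζ hk hδ hr hx0, integral_profile_eq hζ hδ hl hr h2, ← hI,
          abs_of_nonneg (by positivity), Real.mul_rpow (by positivity) hI0, ← Real.rpow_mul hk.le,
          hθ, Real.rpow_one]
    _ ≤ _ := lintegral_mono_set (Metric.ball_subset_ball he1)

end Concentration

/-! ### Sharpness of the critical constant -/

theorem energy_eq_of_contDiff {N : ℕ} {β : ℝ} {χ : ℝ → ℝ} {φ : Rn N → ℝ} (h : ContDiff ℝ ∞ φ) :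
    energy N β χ φ =
      (∫⁻ x, ENNReal.ofReal (weight N β χ x * |(Δ φ) x| ^ ((N : ℝ) / 2))) +
      (∫⁻ x, ENNReal.ofReal (‖gradVec φ x‖ ^ ((N : ℝ) / 2))) +
      ∫⁻ x, ENNReal.ofReal (|φ x| ^ ((N : ℝ) / 2)) := by
  have h1 := (hasWeakLaplacian_of_contDiff isOpen_univ h).weakLaplacian_ae_eq isOpen_univ
  have h2 := (hasWeakGradient_of_contDiff univ h).weakGradient_ae_eq isOpen_univ
  rw [Measure.restrict_univ] at h1 h2
  unfold energy
  congr 2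
  · exact lintegral_congr_ae (by filter_upwards [h1] with x hx; rw [hx])
  · exact lintegral_congr_ae (by filter_upwards [h2] with x hx; rw [hx])

theorem mem_spaceE_of_test {N : ℕ} (hN : 0 < N) {β : ℝ} {χ : ℝ → ℝ} {φ : Rn N → ℝ}
    {Ω : Set (Rn N)} (h : IsTestFunction Ω φ) (hrad : ∀ x y, ‖x‖ = ‖y‖ → φ x = φ y)
    (hE : energy N β χ φ < ⊤) : φ ∈ spaceE N β χ := by
  refine ⟨h.1.continuous.memLp_of_hasCompactSupport h.2.1, ?_,
    ⟨_, hasWeakGradient_of_contDiff univ h.1⟩,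
    ⟨_, hasWeakLaplacian_of_contDiff isOpen_univ h.1⟩, hE⟩
  refine ⟨fun r => φ (r • EuclideanSpace.single ⟨0, hN⟩ 1), Eventually.of_forall fun x => ?_⟩
  exact hrad _ _ (by simp [norm_smul])

theorem lintegral_abs_rpow_lt_top {N : ℕ} {p : ℝ} (hp : 0 ≤ p) {φ : Rn N → ℝ}
    (h1 : Continuous φ) (h2 : HasCompactSupport φ) :
    ∫⁻ x in unitBall N, ENNReal.ofReal (|φ x| ^ p) < ⊤ := by
  obtain ⟨C, hC⟩ := h1.bounded_above_of_compact_support h2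
  refine lt_of_le_of_lt (lintegral_mono fun x => ENNReal.ofReal_le_ofReal
    (Real.rpow_le_rpow (abs_nonneg _) (hC x) hp)) ?_
  rw [setLIntegral_const]
  exact ENNReal.mul_lt_top ENNReal.ofReal_lt_top measure_ball_lt_top

/-- Smooth radial functions with compact support in the ball that are constant near the origin
belong to `W_{0,rad}^{2,N/2}`. -/
theorem mem_spaceW0rad_of_test {N : ℕ} (hN : 4 ≤ N) {β : ℝ} (hβ0 : 0 ≤ β) {χ : ℝ → ℝ}
    {φ : Rn N → ℝ} (h : IsTestFunction (unitBall N) φ)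
    (hrad : ∀ x y, ‖x‖ = ‖y‖ → φ x = φ y) {a : ℝ} (ha : 0 < a)
    (hflat : ∀ x : Rn N, ‖x‖ < a → φ x = φ 0) : φ ∈ spaceW0rad N β χ := by
  have hN' : (4 : ℝ) ≤ N := by exact_mod_cast hN
  have hp0 : (0 : ℝ) < (N : ℝ) / 2 := by linarith
  have hb0 : 0 ≤ β * ((N : ℝ) / 2 - 1) := mul_nonneg hβ0 (by linarith)
  refine ⟨gradVec φ, fun i => gradVec (partialDeriv i φ),
    ⟨hasWeakGradient_of_contDiff _ h.1,
      fun i => hasWeakGradient_of_contDiff _ (partialDeriv_contDiff h.1 i),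
      lintegral_abs_rpow_lt_top hp0.le h.1.continuous h.2.1,
      fun i => lintegral_abs_rpow_lt_top hp0.le (h.partialDeriv i).1.continuous
        (h.partialDeriv i).2.1, fun i j => ?_⟩,
    fun _ => φ, fun _ => ⟨h, hrad⟩, ?_⟩
  · have ht := (h.partialDeriv i).partialDeriv j
    obtain ⟨C, hC⟩ := ht.1.continuous.bounded_above_of_compact_support ht.2.1
    have hC0 : 0 ≤ C := (norm_nonneg _).trans (hC 0)
    -- The weight is unbounded only near the origin, where all derivatives of φ vanish, so the
    -- weighted second order terms stay bounded.
    have hflat1 : ∀ x : Rn N, ‖x‖ < a → partialDeriv i φ x = 0 := fun x hx => by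
      have : φ =ᶠ[𝓝 x] fun _ => φ 0 := by
        filter_upwards [Metric.isOpen_ball.mem_nhds (show x ∈ Metric.ball (0 : Rn N) a by
          simpa using hx)] with y hy
        exact hflat y (by simpa using hy)
      simp [partialDeriv, this.fderiv_eq]
    have hflat2 : ∀ x : Rn N, ‖x‖ < a → partialDeriv j (partialDeriv i φ) x = 0 := fun x hx => by
      have : partialDeriv i φ =ᶠ[𝓝 x] fun _ => 0 := by
        filter_upwards [Metric.isOpen_ball.mem_nhds (show x ∈ Metric.ball (0 : Rn N) a by
          simpa using hx)] with y hy
        exact hflat1 y (by simpa using hy)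
      unfold partialDeriv at this ⊢
      simp [this.fderiv_eq]
    refine lt_of_le_of_lt (setLIntegral_mono_ae' Metric.isOpen_ball.measurableSet
      (g := fun _ => ENNReal.ofReal (|ell a| ^ (β * ((N : ℝ) / 2 - 1)) * C ^ ((N : ℝ) / 2)))
      (Eventually.of_forall fun x hx => ENNReal.ofReal_le_ofReal ?_)) ?_
    · have hx1 : ‖x‖ < 1 := by simpa [unitBall] using hx
      rw [gradVec_apply]
      by_cases hxa : ‖x‖ < a
      · rw [hflat2 x hxa, abs_zero, Real.zero_rpow hp0.ne', mul_zero]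
        positivity
      · have hxa := not_lt.1 hxa
        have hℓ := one_le_ell (ha.trans_le hxa) hx1.le
        rw [weight_of_mem hx1]
        have h1 : ell ‖x‖ ≤ |ell a| := (ell_anti ha hxa).trans (le_abs_self _)
        gcongr
        exact hC x
    · rw [setLIntegral_const]
      exact ENNReal.mul_lt_top ENNReal.ofReal_lt_top measure_ball_lt_top
  · have : distW2 N β χ φ φ (gradVec φ) (fun i => gradVec (partialDeriv i φ)) = 0 := by
      simp [distW2, Real.zero_rpow hp0.ne']
    simp [this]

/-- Above the critical constant, concentrating functions of energy at most one have arbitrarily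
large exponential integrals. -/
theorem exists_concentrating {N : ℕ} (hN : 4 ≤ N) {β : ℝ}
    (hβ : ((N : ℝ) ^ 2 - 4 * (N : ℝ) + 2) / ((N : ℝ) * ((N : ℝ) - 2)) < β) (hβ1 : β < 1)
    (χ : ℝ → ℝ) {α : ℝ} (hα : alphaCrit N β < α) (M : ℝ) :
    ∃ φ : Rn N → ℝ, IsTestFunction (unitBall N) φ ∧ φ ∈ spaceE N β χ ∧ φ ∈ spaceW0rad N β χ ∧
      energy N β χ φ ≤ 1 ∧ ENNReal.ofReal M ≤
        ∫⁻ x in unitBall N, ENNReal.ofReal (Real.exp (α * |φ x| ^ gammaExp N β) - 1) := by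
  have hN' : (4 : ℝ) ≤ N := by exact_mod_cast hN
  have h1 : (0 : ℝ) < N - 2 := by linarith
  have h2 : 0 < 1 - β := by linarith
  have hβ0 := beta_pos hN hβ
  have hγ := gammaExp_pos (show 3 ≤ N by omega) hβ1
  have hS := sphereArea_pos (show 0 < N by omega)
  have hV := ballVolume_pos N
  obtain ⟨ζ, δ, hζ, hδ0, hδ1, h0, hl, hr, hJ, hI⟩ := exists_profile hN hβ0 hβ1 hα
  set θ := 1 / gammaExp N β with hθ
  have hθ1 : θ ≤ 1 := by
    rw [hθ, div_le_one hγ]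
    linarith [half_le_gammaExp hN hβ1 hβ]
  have hθγ : θ * gammaExp N β = 1 := by rw [hθ]; field_simp
  -- With θ = 1/γ one has θN/2 = (N/2-1)(1-β), so the powers of k cancel in the energy.
  have hθ2 : (θ - 1) * ((N : ℝ) / 2) + 1 + β * ((N : ℝ) / 2 - 1) = 0 := by
    rw [hθ, gammaExp]
    field_simp
    ring
  have hsupp : HasCompactSupport ζ := by
    refine HasCompactSupport.intro (isCompact_Icc (a := δ) (b := 1 - δ)) fun y hy => ?_
    rcases not_and_or.1 hy with h | h
    · exact hl y (not_le.1 h).le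
    · exact hr y (not_le.1 h).le
  obtain ⟨Z, hZ⟩ := hζ.continuous.bounded_above_of_compact_support hsupp
  set b := β * ((N : ℝ) / 2 - 1) with hb
  -- The leading energy divided by ω, with ε = 1/k; at ε = 0 it is the energy functional of the
  -- profile.
  set Φ : ℝ → ℝ := fun ε => ∫ y in (0 : ℝ)..1, (ε + y) ^ b *
    |deriv ζ y * ε - ((N : ℝ) - 2) * ζ y| ^ ((N : ℝ) / 2) with hΦ
  have hΦc : Continuous Φ :=
    intervalIntegral.continuous_parametric_intervalIntegral_of_continuous'
      (continuous_energyDensity hN hβ0.le hζ) 0 1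
  have hΦ0 : sphereArea N * Φ 0 < 1 := by
    simpa [hΦ] using hJ
  have t1 : Tendsto (fun k : ℝ => sphereArea N * Φ k⁻¹) atTop (𝓝 (sphereArea N * Φ 0)) :=
    ((hΦc.tendsto 0).comp tendsto_inv_atTop_zero).const_mul _
  have t2 : Tendsto (fun k : ℝ => sphereArea N * (Z ^ ((N : ℝ) / 2) * Real.exp (-(k * δ)))) atTop
      (𝓝 0) := by
    have : Tendsto (fun k : ℝ => Real.exp (-(k * δ))) atTop (𝓝 0) :=
      Real.tendsto_exp_neg_atTop_nhds_zero.comp (tendsto_id.atTop_mul_const hδ0)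
    simpa using (this.const_mul (Z ^ ((N : ℝ) / 2))).const_mul (sphereArea N)
  have t3 : Tendsto (fun k : ℝ => (∫ y in (0 : ℝ)..1, ζ y) ^ ((N : ℝ) / 2) * ballVolume N *
        (k ^ ((N : ℝ) / 2) * Real.exp (-(δ * k)))) atTop (𝓝 0) := by
    have := (tendsto_rpow_mul_exp_neg_mul_atTop_nhds_zero ((N : ℝ) / 2) δ hδ0).const_mul
      ((∫ y in (0 : ℝ)..1, ζ y) ^ ((N : ℝ) / 2) * ballVolume N)
    simpa [neg_mul] using this
  have t4 := (t1.add t2).add t3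
  rw [add_zero, add_zero] at t4
  have t5 : Tendsto (fun k : ℝ => ballVolume N * (Real.exp (k *
      (α * (∫ y in (0 : ℝ)..1, ζ y) ^ gammaExp N β - N)) - Real.exp (-(k * N)))) atTop atTop := by
    have e1 : Tendsto (fun k : ℝ => Real.exp (k *
        (α * (∫ y in (0 : ℝ)..1, ζ y) ^ gammaExp N β - N))) atTop atTop :=
      Real.tendsto_exp_atTop.comp (tendsto_id.atTop_mul_const (by linarith))
    have e2 : Tendsto (fun k : ℝ => -Real.exp (-(k * N))) atTop (𝓝 (-0)) :=
      (Real.tendsto_exp_neg_atTop_nhds_zero.comp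
        (tendsto_id.atTop_mul_const (show (0 : ℝ) < N by linarith))).neg
    exact (e1.atTop_add e2).const_mul_atTop hV
  -- For large k the three energy terms sum to less than one, because the limit is already below
  -- one, while the exponential integral exceeds M.
  obtain ⟨k, ⟨hk4, hk5⟩, hk1⟩ := (((t4.eventually_lt_const hΦ0).and
    (t5.eventually_ge_atTop M)).and (eventually_ge_atTop 1)).exists
  have hk0 : 0 < k := by linarith
  have hq := concSlope_contDiff (θ := θ) hζ hk0 hδ0 hr
  have hq0 : ∀ s, |s| < Real.exp (-k) → concSlope θ ζ k s = 0 :=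
    fun s hs => concSlope_eq_zero_of_abs_lt hk0 hδ0 hr hs
  have htest : IsTestFunction (unitBall N) (concFun N θ δ ζ k) := by
    refine radialPrimitive_isTestFunction (Real.exp_pos (-k)) hq hq0
      (fun s hs => concSlope_eq_zero_of_ge hk0 hl hs) ?_
    exact Metric.closedBall_subset_ball (Real.exp_lt_one_iff.2 (by nlinarith))
  have hrad : ∀ x y : Rn N, ‖x‖ = ‖y‖ → concFun N θ δ ζ k x = concFun N θ δ ζ k y :=
    fun x y hxy => by rw [concFun, radialPrimitive, radialPrimitive, hxy]
  have hE : energy N β χ (concFun N θ δ ζ k) ≤ 1 := by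
    have a1 := lintegral_weight_laplacian_concFun hN hβ0.le (χ := χ) hζ hk0 hδ0 hδ1 hl hr hθ2
    have a2 := lintegral_gradVec_concFun hN hζ hk1 hθ1 hδ0 hl hr hZ
    have a3 := lintegral_concFun hN hζ hk1 hθ1 hδ0 h0 hl hr
    rw [energy_eq_of_contDiff htest.1]
    refine (add_le_add (add_le_add a1 a2) a3).trans ?_
    have hΦn : 0 ≤ Φ k⁻¹ := intervalIntegral.integral_nonneg zero_le_one fun y hy =>
      mul_nonneg (Real.rpow_nonneg (add_nonneg (by positivity) hy.1) _)
        (Real.rpow_nonneg (abs_nonneg _) _)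
    have hZ0 : 0 ≤ Z := (norm_nonneg _).trans (hZ 0)
    have hI0 : 0 ≤ ∫ y in (0 : ℝ)..1, ζ y :=
      intervalIntegral.integral_nonneg zero_le_one fun y _ => h0 y
    rw [← ENNReal.ofReal_add (mul_nonneg hS.le hΦn) (by positivity),
      ← ENNReal.ofReal_add (add_nonneg (mul_nonneg hS.le hΦn) (by positivity)) (by positivity)]
    exact ENNReal.ofReal_le_one.2 hk4.le
  refine ⟨concFun N θ δ ζ k, htest, mem_spaceE_of_test (by omega) htest hrad
    (hE.trans_lt ENNReal.one_lt_top), mem_spaceW0rad_of_test hN hβ0.le htest hrad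
      (Real.exp_pos (-k)) fun x hx => ?_, hE, ?_⟩
  · rw [concFun, radialPrimitive_eq_of_norm_lt hq hq0 hx,
      radialPrimitive_eq_of_norm_lt hq hq0 (by simpa using Real.exp_pos (-k))]
  · exact (ENNReal.ofReal_le_ofReal hk5).trans
      (le_lintegral_exp_concFun hN hζ hk0 hθγ hδ0 h0 hl hr)

theorem iSup_spaceE_eq_top {N : ℕ} (hN : 4 ≤ N) {β : ℝ}
    (hβ : ((N : ℝ) ^ 2 - 4 * (N : ℝ) + 2) / ((N : ℝ) * ((N : ℝ) - 2)) < β) (hβ1 : β < 1)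
    (χ : ℝ → ℝ) {α : ℝ} (hα : alphaCrit N β < α) :
    (⨆ u ∈ {u ∈ spaceE N β χ | normE N β χ u ≤ 1},
        ∫⁻ x : Rn N, ENNReal.ofReal (Real.exp (α * |u x| ^ gammaExp N β) - 1)) = ⊤ := by
  refine ENNReal.eq_top_of_forall_nnreal_le fun M => ?_
  obtain ⟨φ, -, hE, -, hen, hM⟩ := exists_concentrating hN hβ hβ1 χ hα M
  rw [ENNReal.ofReal_coe_nnreal] at hM
  refine hM.trans ((setLIntegral_le_lintegral _ _).trans ?_)
  refine le_iSup₂_of_le φ ⟨hE, ?_⟩ le_rfl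
  unfold normE
  simpa using ENNReal.rpow_le_rpow hen (show (0 : ℝ) ≤ 2 / N by positivity)

theorem iSup_spaceW0rad_eq_top {N : ℕ} (hN : 4 ≤ N) {β : ℝ}
    (hβ : ((N : ℝ) ^ 2 - 4 * (N : ℝ) + 2) / ((N : ℝ) * ((N : ℝ) - 2)) < β) (hβ1 : β < 1)
    (χ : ℝ → ℝ) {α : ℝ} (hα : alphaCrit N β < α) :
    (⨆ u ∈ {u ∈ spaceW0rad N β χ |
          ∫⁻ x in unitBall N, ENNReal.ofReal
            (weight N β χ x * |weakLaplacian (unitBall N) u x| ^ ((N : ℝ) / 2)) ≤ 1},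
        ∫⁻ x in unitBall N, ENNReal.ofReal (Real.exp (α * |u x| ^ gammaExp N β) - 1)) = ⊤ := by
  refine ENNReal.eq_top_of_forall_nnreal_le fun M => ?_
  obtain ⟨φ, ht, -, hW, hen, hM⟩ := exists_concentrating hN hβ hβ1 χ hα M
  rw [ENNReal.ofReal_coe_nnreal] at hM
  refine hM.trans (le_iSup₂_of_le φ ⟨hW, ?_⟩ le_rfl)
  have hB : IsOpen (unitBall N) := Metric.isOpen_ball
  have h1 := (hasWeakLaplacian_of_contDiff hB ht.1).weakLaplacian_ae_eq hB
  rw [energy_eq_of_contDiff ht.1, add_assoc] at hen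
  refine le_trans ?_ (le_self_add.trans hen)
  refine le_trans (le_of_eq (lintegral_congr_ae ?_)) (setLIntegral_le_lintegral (unitBall N) _)
  filter_upwards [h1] with x hx
  rw [hx]

end LogAdams

theorem theorem1p4 (N : ℕ) (hN : 4 ≤ N) (β : ℝ)
    (hβ : ((N : ℝ) ^ 2 - 4 * (N : ℝ) + 2) / ((N : ℝ) * ((N : ℝ) - 2)) < β) (hβ1 : β < 1)
    (χ : ℝ → ℝ) (hχ : AdmissibleChi N χ) :
    (∀ u ∈ spaceE N β χ,
      Integrable (fun x : Rn N => Real.exp (|u x| ^ gammaExp N β) - 1) volume) ∧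
    (∀ α : ℝ,
      (⨆ u ∈ {u ∈ spaceW0rad N β χ |
          ∫⁻ x in unitBall N, ENNReal.ofReal
            (weight N β χ x * |weakLaplacian (unitBall N) u x| ^ ((N : ℝ) / 2)) ≤ 1},
        ∫⁻ x in unitBall N, ENNReal.ofReal (Real.exp (α * |u x| ^ gammaExp N β) - 1)) < ⊤
      ↔ α ≤ alphaCrit N β) ∧
    (∀ α : ℝ, α < alphaCrit N β →
      (⨆ u ∈ {u ∈ spaceE N β χ | normE N β χ u ≤ 1},
        ∫⁻ x : Rn N, ENNReal.ofReal (Real.exp (α * |u x| ^ gammaExp N β) - 1)) < ⊤) ∧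
    (∀ α : ℝ, alphaCrit N β < α →
      (⨆ u ∈ {u ∈ spaceE N β χ | normE N β χ u ≤ 1},
        ∫⁻ x : Rn N, ENNReal.ofReal (Real.exp (α * |u x| ^ gammaExp N β) - 1)) = ⊤) := by
  have hβ0 := beta_pos hN hβ
  refine ⟨fun u hu => integrable_exp_of_mem_spaceE hN hβ hβ1 hχ.one_le hu,
    fun α => ⟨fun h => ?_, fun h => iSup_spaceW0rad_lt_top hN hβ0 hβ1 h⟩,
    fun α hα => iSup_spaceE_lt_top hN hβ hβ1 hχ.one_le hα,
    fun α hα => iSup_spaceE_eq_top hN hβ hβ1 χ hα⟩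
  by_contra hα
  exact h.ne (iSup_spaceW0rad_eq_top hN hβ hβ1 χ (not_le.1 hα))
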